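/- Each unit carries covariates $X\in\mathcal X$, a treatment $T\in\{0,1\}$, potential surrogates $S(0),S(1)\in\mathcal S$, potential outcomes $Y(0),Y(1)\in\mathbb R$ and a labelling indicator $R\in\{0,1\}$, where $\mathcal X,\mathcal S$ are standard Borel spaces (e.g. Borel subsets of Euclidean spaces). Put $S=S(T)$ and $Y=Y(T)$. A population $\mathbb P$ is given by the two conditional laws of $(X,T,S(0),S(1),Y(0),Y(1))$ given $R=1$ and given $R=0$ and by $\mathbb P(R=1)\in[0,1]$; the value $\mathbb P(R=1)=0$ is allowed. Conditional independence statements about $R$ are understood for the mixture of the two conditional laws in which $R=1$ has some probability in $(0,1)$ (which one is immaterial). Fix $\epsilon\in(0,1/2)$ and $C>0$, and consider the following conditions on $\mathbb P$: for $t=0,1$, (i) $(Y(t),S(t))\perp T\mid X$; (ii) $R\perp Y(t)\mid (X,T=t,S(t))$; (iii) $R\perp S(t)\mid T,X$; (iv) $R\perp T\mid X$; (v) $\epsilon\le e^*(X)\le 1-\epsilon$ almost surely, where $e^*(x)=\mathbb P(T=1\mid X=x)$; (vi) the law of $X$ has a density $\lambda^*=f^*(X)/f^*(X\mid R=1)$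 with respect to the law of $X$ given $R=1$, and $\lambda^*(X)\le C$ almost surely; (vii) $\mathbb E[Y(t)^2]<\infty$ and $\mathbb E[|Y|\mid R=1]<\infty$. Let $\mathbb P$ satisfy (i)-(vii). Suppose that only labelled data are observed, i.e. i.i.d. copies of $(X,T,S,Y)$ from its conditional law $Q$ given $R=1$, and that the unconditional law of $(X,T,S)$ is known; that is, let the model $\mathcal M$ consist of all populations that satisfy (i)-(vii) (with the same $\epsilon$, $C$) and have the same unconditional law of $(X,T,S)$ as $\mathbb P$. The parameter is the average treatment effect $\delta=\mathbb E[Y(1)]-\mathbb E[Y(0)]$. A smooth submodel with score $g\in L^2(Q)$ is a family $(\mathbb P_\theta)_{\theta\in\mathbb R}$ in $\mathcal M$ whose laws $Q_\theta$ of $(X,T,S,Y)$ given $R=1$ are dominated by a common $\sigma$-finite measure, satisfy $Q_0=Q$, and are differentiable in quadratic mean at $\theta=0$ with score $g$, and along which $\mathbb E_{\mathbb P_\theta}[Y(t)^2]$, $t=0,1$, is bounded. Let $\tilde\mu^*(t,x,s)=\mathbb E[Y\mid T=t,X=x,S=s,R=1]$ and $$\tilde\psi=\frac{T\lambda^*(X)}{e^*(X)}\bigl(Y-\tilde\mu^*(1,X,S)\bigr)-\frac{(1-T)\lambda^*(X)}{1-e^*(X)}\bigl(Y-\tilde\mu^*(0,X,S)\bigr).$$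 Then $\tilde\psi$ is the efficient influence function of $\delta$ at $\mathbb P$ in $\mathcal M$: it belongs to the tangent space (the closed linear span in $L^2(Q)$ of the scores of all smooth submodels), and along every smooth submodel with score $g$ the map $\theta\mapsto\delta(\mathbb P_\theta)$ is differentiable at $0$ with derivative $\mathbb E[\tilde\psi g\mid R=1]$. The efficiency lower bound, i.e. the supremum over all smooth submodels of the Cramér-Rao bounds $\bigl(\tfrac{d}{d\theta}\delta(\mathbb P_\theta)|_{\theta=0}\bigr)^2/\mathbb E[g^2\mid R=1]$ (with $0/0=0$), is $$\tilde V^*=\mathbb E[\tilde\psi^2\mid R=1].$$ -/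

import Mathlib

open MeasureTheory ProbabilityTheory Filter Topology
open scoped ENNReal NNReal

namespace SurrogateATE

noncomputable section

/-! ### Units, populations and observed data

Binary variables take values in `Bool`, with `true` for `1` and `false` for `0`.  The covariate space
`𝒳` and the surrogate space `𝒮` are standard Borel spaces, e.g. Borel subsets of Euclidean spaces. -/

/-- One unit without its label: `(X, T, (S(0), S(1)), (Y(0), Y(1)))`. -/
abbrev Unlabelled (𝒳 𝒮 : Type*) := 𝒳 × Bool × (Bool → 𝒮) × (Bool → ℝ)

/-- One full unit: `(X, T, (S(0), S(1)), (Y(0), Y(1)))` together with the labelling indicator `R`. -/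
abbrev Full (𝒳 𝒮 : Type*) := Unlabelled 𝒳 𝒮 × Bool

/-- What is seen of a labelled unit: `(X, T, S, Y)`. -/
abbrev Obs (𝒳 𝒮 : Type*) := 𝒳 × Bool × 𝒮 × ℝ

section Variables

variable {𝒳 𝒮 : Type*}

/-- Covariates. -/
def X (w : Full 𝒳 𝒮) : 𝒳 := w.1.1

/-- Treatment indicator. -/
def T (w : Full 𝒳 𝒮) : Bool := w.1.2.1

/-- Potential surrogates. -/
def Spot (a : Bool) (w : Full 𝒳 𝒮) : 𝒮 := w.1.2.2.1 a

/-- Potential outcomes. -/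
def Ypot (a : Bool) (w : Full 𝒳 𝒮) : ℝ := w.1.2.2.2 a

/-- Labelling indicator. -/
def R (w : Full 𝒳 𝒮) : Bool := w.2

/-- The actual surrogate `S = S(T)`. -/
def S (w : Full 𝒳 𝒮) : 𝒮 := Spot (T w) w

/-- The actual outcome `Y = Y(T)`. -/
def Y (w : Full 𝒳 𝒮) : ℝ := Ypot (T w) w

/-- The observed variables `(X, T, S, Y)`. -/
def obs (w : Full 𝒳 𝒮) : Obs 𝒳 𝒮 := (X w, T w, S w, Y w)

variable [MeasurableSpace 𝒳] [MeasurableSpace 𝒮]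

theorem measurable_X : Measurable (X : Full 𝒳 𝒮 → 𝒳) :=
  measurable_fst.comp measurable_fst

theorem measurable_T : Measurable (T : Full 𝒳 𝒮 → Bool) :=
  measurable_fst.comp (measurable_snd.comp measurable_fst)

theorem measurable_Spot (a : Bool) : Measurable (Spot a : Full 𝒳 𝒮 → 𝒮) :=
  (measurable_pi_apply a).comp
    (measurable_fst.comp (measurable_snd.comp (measurable_snd.comp measurable_fst)))

theorem measurable_Ypot (a : Bool) : Measurable (Ypot a : Full 𝒳 𝒮 → ℝ) :=
  (measurable_pi_apply a).comp
    (measurable_snd.comp (measurable_snd.comp (measurable_snd.comp measurable_fst)))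

theorem measurable_R : Measurable (R : Full 𝒳 𝒮 → Bool) := measurable_snd

theorem measurable_S : Measurable (S : Full 𝒳 𝒮 → 𝒮) := by
  have h : (S : Full 𝒳 𝒮 → 𝒮) = fun w => if T w = true then Spot true w else Spot false w := by
    funext w
    cases h : T w <;> simp [S, h]
  rw [h]
  exact Measurable.ite (measurable_T (measurableSet_singleton true))
    (measurable_Spot true) (measurable_Spot false)

theorem measurable_Y : Measurable (Y : Full 𝒳 𝒮 → ℝ) := by
  have h : (Y : Full 𝒳 𝒮 → ℝ) = fun w => if T w = true then Ypot true w else Ypot false w := by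
    funext w
    cases h : T w <;> simp [Y, h]
  rw [h]
  exact Measurable.ite (measurable_T (measurableSet_singleton true))
    (measurable_Ypot true) (measurable_Ypot false)

theorem measurable_obs : Measurable (obs : Full 𝒳 𝒮 → Obs 𝒳 𝒮) :=
  measurable_X.prodMk (measurable_T.prodMk (measurable_S.prodMk measurable_Y))

end Variables

/-- A population: the conditional laws of `(X, T, S(·), Y(·))` given `R = 1` (`law true`) and given
`R = 0` (`law false`), and the probability `P(R = 1)`.  Keeping the two conditional laws apart makes
"given `R = 1`" meaningful also when `P(R = 1) = 0`. -/
structure Population (𝒳 𝒮 : Type*) [MeasurableSpace 𝒳] [MeasurableSpace 𝒮] where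
  /-- `P(R = 1)`; the value `0` is allowed. -/
  labelProb : unitInterval
  /-- Conditional law of the unit given its label. -/
  law : Bool → ProbabilityMeasure (Unlabelled 𝒳 𝒮)

namespace Population

variable {𝒳 𝒮 : Type*} [MeasurableSpace 𝒳] [MeasurableSpace 𝒮]

/-- The law of a full unit given `R = ℓ`. -/
def given (p : Population 𝒳 𝒮) (ℓ : Bool) : Measure (Full 𝒳 𝒮) :=
  (p.law ℓ : Measure (Unlabelled 𝒳 𝒮)).prod (Measure.dirac ℓ)

instance (p : Population 𝒳 𝒮) (ℓ : Bool) : IsProbabilityMeasure (p.given ℓ) := by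
  unfold given; infer_instance

/-- The law of a full unit that has the same conditional laws given `R = 1` and given `R = 0` as the
population `p`, but in which `R = 1` has probability `ρ`. -/
def mix (p : Population 𝒳 𝒮) (ρ : unitInterval) : Measure (Full 𝒳 𝒮) :=
  unitInterval.toNNReal ρ • p.given true +
    unitInterval.toNNReal (unitInterval.symm ρ) • p.given false

instance (p : Population 𝒳 𝒮) (ρ : unitInterval) : IsFiniteMeasure (p.mix ρ) := by
  unfold mix; infer_instance

/-- The law `P` of a full unit. -/
def P (p : Population 𝒳 𝒮) : Measure (Full 𝒳 𝒮) := p.mix p.labelProb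

instance (p : Population 𝒳 𝒮) : IsProbabilityMeasure p.P := by
  refine ⟨?_⟩
  have h : unitInterval.toNNReal p.labelProb
      + unitInterval.toNNReal (unitInterval.symm p.labelProb) = 1 := by
    ext
    simp
  rw [P, mix, Measure.add_apply, Measure.smul_apply, Measure.smul_apply, measure_univ, measure_univ,
    ← add_smul, h, one_smul]

/-- The law `Q` of the observed data: the conditional law of `(X, T, S, Y)` given `R = 1`. -/
def Q (p : Population 𝒳 𝒮) : Measure (Obs 𝒳 𝒮) := (p.given true).map obs

instance (p : Population 𝒳 𝒮) : IsProbabilityMeasure p.Q :=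
  Measure.isProbabilityMeasure_map measurable_obs.aemeasurable

/-- The unconditional law of `(X, T, S)`. -/
def lawXTS (p : Population 𝒳 𝒮) : Measure (𝒳 × Bool × 𝒮) :=
  p.P.map fun w => (X w, T w, S w)

/-- The average treatment effect `δ* = E[Y(1)] - E[Y(0)]`. -/
def ate (p : Population 𝒳 𝒮) : ℝ :=
  (∫ w, Ypot true w ∂p.P) - ∫ w, Ypot false w ∂p.P

/-- The law of the covariates under `P`. -/
def lawX (p : Population 𝒳 𝒮) : Measure 𝒳 := p.P.map X

/-- The law of the covariates given `R = 1`. -/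
def lawXLabelled (p : Population 𝒳 𝒮) : Measure 𝒳 := (p.given true).map X

/-- The density ratio `λ*(x) = f*(x) / f*(x | R = 1)`: the density of the law of `X` under `P` with
respect to the law of `X` given `R = 1`. -/
def densityRatio (p : Population 𝒳 𝒮) (x : 𝒳) : ℝ :=
  (p.lawX.rnDeriv p.lawXLabelled x).toReal

/-- The propensity score `e*(x) = P(T = 1 | X = x)`. -/
def propensity (p : Population 𝒳 𝒮) (x : 𝒳) : ℝ :=
  (condDistrib T X p.P x).real {true}

/-- The regression function `μ̃*(t, x, s) = E[Y | T = t, X = x, S = s, R = 1]`. -/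
def regression (p : Population 𝒳 𝒮) (t : Bool) (x : 𝒳) (s : 𝒮) : ℝ :=
  ∫ y, y ∂(condDistrib Y (fun w => (X w, T w, S w)) (p.given true) (x, t, s))

/-- The function `ψ̃(x, t, s, y)`. -/
def psi (p : Population 𝒳 𝒮) : Obs 𝒳 𝒮 → ℝ
  | (x, t, s, y) =>
    (if t then (1 : ℝ) else 0) * p.densityRatio x / p.propensity x *
        (y - p.regression true x s) -
      (1 - (if t then (1 : ℝ) else 0)) * p.densityRatio x / (1 - p.propensity x) *
        (y - p.regression false x s)

end Population

/-! ### Assumptions and the statistical model -/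

section Model

variable {𝒳 𝒮 : Type*} [MeasurableSpace 𝒳] [MeasurableSpace 𝒮]
  [StandardBorelSpace 𝒳] [StandardBorelSpace 𝒮]

/-- The conditions on a population.  Conditions on the labelling indicator `R` are conditions on the
two conditional laws given `R = 1` and given `R = 0`: conditional independence of `R` is required in a
mixture of these laws in which both labels have positive probability.  Reweighting the two labels does
not affect it, so the choice of the probability `ρ ∈ (0, 1)` does not matter; if `0 < P(R = 1) < 1`, one
can take `ρ = P(R = 1)` and the mixture is `P` itself. -/
structure Assumptions (ε : ℝ) (C : ℝ≥0) (p : Population 𝒳 𝒮) : Prop where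
  /-- `(Y(t), S(t)) ⊥ T ∣ X`. -/
  unconfounded : ∀ a : Bool,
    CondIndepFun (MeasurableSpace.comap X inferInstance) measurable_X.comap_le
      (fun w => (Ypot a w, Spot a w)) T p.P
  /-- `R ⊥ Y(t) ∣ (X, T = t, S(t))`. -/
  missing_at_random : ∀ a : Bool, ∃ ρ : unitInterval, 0 < ρ ∧ ρ < 1 ∧
    CondIndepFun (MeasurableSpace.comap (fun w => (X w, Spot a w)) inferInstance)
      (measurable_X.prodMk (measurable_Spot a)).comap_le
      R (Ypot a) (cond (p.mix ρ) {w | T w = a})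
  /-- `R ⊥ S(t) ∣ T, X`. -/
  label_surrogate : ∀ a : Bool, ∃ ρ : unitInterval, 0 < ρ ∧ ρ < 1 ∧
    CondIndepFun (MeasurableSpace.comap (fun w => (T w, X w)) inferInstance)
      (measurable_T.prodMk measurable_X).comap_le R (Spot a) (p.mix ρ)
  /-- `R ⊥ T ∣ X`. -/
  label_treatment : ∃ ρ : unitInterval, 0 < ρ ∧ ρ < 1 ∧
    CondIndepFun (MeasurableSpace.comap X inferInstance) measurable_X.comap_le R T (p.mix ρ)
  /-- Strict overlap of the treatment propensity: `ε ≤ e*(X) ≤ 1 - ε` almost surely. -/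
  overlap : ∀ᵐ x ∂p.lawX, ε ≤ p.propensity x ∧ p.propensity x ≤ 1 - ε
  /-- The density ratio exists ... -/
  absolutelyContinuous : p.lawX ≪ p.lawXLabelled
  /-- ... and is bounded: `‖λ*(X)‖_∞ ≤ C`. -/
  densityRatio_le : ∀ᵐ x ∂p.lawX, p.densityRatio x ≤ C
  /-- The potential outcomes are square integrable ... -/
  outcome_memLp : ∀ a : Bool, MemLp (Ypot a) 2 p.P
  /-- ... and the outcome has a mean given `R = 1`, so that `μ̃*` is meaningful. -/
  outcome_integrable : Integrable Y (p.given true)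

/-- The semiparametric model around `p₀`: all populations that satisfy the conditions and in which the
unconditional law of `(X, T, S)` is the known one. -/
def model (ε : ℝ) (C : ℝ≥0) (p₀ : Population 𝒳 𝒮) : Set (Population 𝒳 𝒮) :=
  {p | Assumptions ε C p ∧ p.lawXTS = p₀.lawXTS}

end Model

/-! ### Semiparametric efficiency -/

section Efficiency

/-- Differentiability in quadratic mean at `0` of a one-parameter family of laws `Q θ`, dominated by a
`σ`-finite measure `μ`, with score `g`:
`∫ ((√(q_θ) - √(q_0)) / θ - g √(q_0) / 2)² dμ → 0` as `θ → 0`, where `q_θ = dQ_θ/dμ`. -/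
def HasScore {O : Type*} [MeasurableSpace O] (Q : ℝ → Measure O) (g : O → ℝ) : Prop :=
  ∃ μ : Measure O, SigmaFinite μ ∧ (∀ θ, Q θ ≪ μ) ∧
    Tendsto
      (fun θ : ℝ => ∫⁻ o, ENNReal.ofReal
        (((√((Q θ).rnDeriv μ o).toReal - √((Q 0).rnDeriv μ o).toReal) / θ
          - g o * √((Q 0).rnDeriv μ o).toReal / 2) ^ 2) ∂μ)
      (𝓝[≠] 0) (𝓝 0)

variable {𝒳 𝒮 : Type*} [MeasurableSpace 𝒳] [MeasurableSpace 𝒮]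

/-- A smooth one-dimensional parametric submodel of `M` through `p₀` with score `g`: a family `γ` of
populations in `M` whose laws of the observed data pass through that of `p₀` at the parameter value
`0`, are differentiable in quadratic mean there with score `g`, and for which the second moments of the
potential outcomes stay bounded. -/
structure IsSmoothSubmodel (M : Set (Population 𝒳 𝒮)) (p₀ : Population 𝒳 𝒮)
    (γ : ℝ → Population 𝒳 𝒮) (g : Lp ℝ 2 p₀.Q) : Prop where
  mem : ∀ θ, γ θ ∈ M
  base : (γ 0).Q = p₀.Q
  score : HasScore (fun θ => (γ θ).Q) g
  moment : ∃ K : ℝ, ∀ (θ : ℝ) (a : Bool), ∫ w, Ypot a w ^ 2 ∂(γ θ).P ≤ K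

/-- The tangent space at `p₀`: the closed linear span in `L²(Q)` of the scores of smooth submodels. -/
def tangentSpace (M : Set (Population 𝒳 𝒮)) (p₀ : Population 𝒳 𝒮) :
    Submodule ℝ (Lp ℝ 2 p₀.Q) :=
  (Submodule.span ℝ {g | ∃ γ, IsSmoothSubmodel M p₀ γ g}).topologicalClosure

/-- `φ` is the efficient influence function at `p₀` of the average treatment effect in the model `M`:
it is a square-integrable element of the tangent space, and along every smooth submodel the derivative
of the average treatment effect at `p₀` is the `L²(Q)` inner product of `φ` with the score. -/
def IsEfficientInfluenceFunction (M : Set (Population 𝒳 𝒮)) (p₀ : Population 𝒳 𝒮)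
    (φ : Obs 𝒳 𝒮 → ℝ) : Prop :=
  (∃ h : MemLp φ 2 p₀.Q, h.toLp φ ∈ tangentSpace M p₀) ∧
    ∀ (γ : ℝ → Population 𝒳 𝒮) (g : Lp ℝ 2 p₀.Q), IsSmoothSubmodel M p₀ γ g →
      HasDerivAt (fun θ => (γ θ).ate) (∫ o, φ o * g o ∂p₀.Q) 0

/-- The efficiency lower bound at `p₀` for the average treatment effect in the model `M`: the supremum
of the Cramér-Rao bounds `d² / E[g²]` over all smooth submodels, where `g` is the score of the submodel
and `d` is the derivative of the average treatment effect along it. -/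
def efficiencyBound (M : Set (Population 𝒳 𝒮)) (p₀ : Population 𝒳 𝒮) : ℝ≥0∞ :=
  ⨆ (γ : ℝ → Population 𝒳 𝒮) (g : Lp ℝ 2 p₀.Q) (_ : IsSmoothSubmodel M p₀ γ g)
    (d : ℝ) (_ : HasDerivAt (fun θ => (γ θ).ate) d 0),
    ENNReal.ofReal (d ^ 2) / ENNReal.ofReal (∫ o, g o ^ 2 ∂p₀.Q)

end Efficiency

end

end SurrogateATE

/-! Unconfoundedness, the conditions on the label and overlap identify the average treatment effect
of every population `q` in the model: up to a constant that depends only on `p` and on the known law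
of `(X, T, S)`, it is the integral under `q.Q` of the density ratio of `q` times a residual `r` that
does not involve `q`. At `q = p` the integrand is `ψ̃`, and `r` has conditional mean zero given `X`.

Along a smooth submodel only the square roots of the densities of `Q_θ` are regular. The density
ratio `λ_θ` may vary wildly with `θ`, but `λ_θ` times the law of `X` under `Q_θ` is the known law
of `X`. Replacing `√λ_θ √q_θ` by the truncated `min (√λ_θ) (2 √λ_0) √q_0` is therefore accurate to
first order, and the square of the latter is a function of `X` times `q_0`, against which `r`
integrates to zero. What remains is the derivative `∫ ψ̃ g dQ`.

Conversely, a bounded function of `(X, T, S, Y)` with conditional mean zero given `(X, T, S)` is the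
score obtained by tilting the outcome laws linearly, which leaves the law of `(X, T, S)` alone, and
`ψ̃` is an `L²` limit of such functions. The bound is then the Cauchy–Schwarz inequality. -/

namespace SurrogateATE

noncomputable section

section L2

variable {Ω ι : Type*} [MeasurableSpace Ω] {μ : Measure Ω} {l : Filter ι}

theorem eLpNorm_two_eq (u : Ω → ℝ) :
    eLpNorm u 2 μ = (∫⁻ o, ENNReal.ofReal (u o ^ 2) ∂μ) ^ (1 / 2 : ℝ) := by
  have h (o : Ω) : ‖u o‖ₑ ^ (2 : ℝ) = ENNReal.ofReal (u o ^ 2) := by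
    rw [Real.enorm_eq_ofReal_abs, ENNReal.ofReal_rpow_of_nonneg (abs_nonneg _) zero_le_two,
      Real.rpow_two, sq_abs]
  simp only [eLpNorm_eq_lintegral_rpow_enorm_toReal two_ne_zero ENNReal.ofNat_ne_top,
    ENNReal.toReal_ofNat, h]

theorem memLp_two_iff_lintegral_sq {u : Ω → ℝ} (hu : AEStronglyMeasurable u μ) :
    MemLp u 2 μ ↔ ∫⁻ o, ENNReal.ofReal (u o ^ 2) ∂μ ≠ ∞ := by
  rw [MemLp, eLpNorm_two_eq, ENNReal.rpow_lt_top_iff_of_pos (by norm_num), lt_top_iff_ne_top]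
  exact and_iff_right hu

theorem lintegral_enorm_mul_le {u v : Ω → ℝ} (hu : AEStronglyMeasurable u μ)
    (hv : AEStronglyMeasurable v μ) :
    ∫⁻ o, ‖u o * v o‖ₑ ∂μ ≤ eLpNorm u 2 μ * eLpNorm v 2 μ := by
  rw [← eLpNorm_one_eq_lintegral_enorm]
  exact eLpNorm_smul_le_mul_eLpNorm (φ := u) hv hu

theorem enorm_integral_mul_le {u v : Ω → ℝ} (hu : AEStronglyMeasurable u μ)
    (hv : AEStronglyMeasurable v μ) :
    ‖∫ o, u o * v o ∂μ‖ₑ ≤ eLpNorm u 2 μ * eLpNorm v 2 μ :=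
  (enorm_integral_le_lintegral_enorm _).trans (lintegral_enorm_mul_le hu hv)

theorem eLpNorm_abs_add_abs_le {v w : Ω → ℝ} (hv : AEStronglyMeasurable v μ)
    (hw : AEStronglyMeasurable w μ) :
    eLpNorm (fun o => |v o| + |w o|) 2 μ ≤ eLpNorm v 2 μ + eLpNorm w 2 μ := by
  rw [← eLpNorm_norm v, ← eLpNorm_norm w]
  exact eLpNorm_add_le hv.norm hw.norm one_le_two

theorem eLpNorm_le_add_of_abs_le_add {u v w : Ω → ℝ} (hv : AEStronglyMeasurable v μ)
    (hw : AEStronglyMeasurable w μ) (h : ∀ o, |u o| ≤ |v o| + |w o|) :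
    eLpNorm u 2 μ ≤ eLpNorm v 2 μ + eLpNorm w 2 μ :=
  (eLpNorm_mono_real h).trans (eLpNorm_abs_add_abs_le hv hw)

theorem eLpNorm_le_ofReal_mul_of_abs_le_mul {u v : Ω → ℝ} {c : ℝ}
    (h : ∀ o, |u o| ≤ c * |v o|) : eLpNorm u 2 μ ≤ ENNReal.ofReal c * eLpNorm v 2 μ :=
  eLpNorm_le_mul_eLpNorm_of_ae_le_mul (ae_of_all _ h) 2

theorem two_mul_eLpNorm (u : Ω → ℝ) (p : ℝ≥0∞) :
    2 * eLpNorm u p μ = eLpNorm (fun o => 2 * u o) p μ := by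
  have htwo : ‖(2 : ℝ)‖ₑ = 2 := by rw [Real.enorm_eq_ofReal zero_le_two, ENNReal.ofReal_ofNat]
  exact htwo ▸ (eLpNorm_const_smul (2 : ℝ) u p μ).symm

theorem tendsto_eLpNorm_indicator_natCast_lt {f : Ω → ℝ} (hf : Measurable f) {p : ℝ≥0∞}
    (hp : p ≠ ∞) {k : Ω → ℝ} (hk : MemLp k p μ) :
    Tendsto (fun n : ℕ => eLpNorm ({o | (n : ℝ) < |f o|}.indicator k) p μ) atTop (𝓝 0) := by
  rcases eq_or_ne p 0 with rfl | hp0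
  · simp
  have hpos : 0 < p.toReal := ENNReal.toReal_pos hp0 hp
  have h : Tendsto (fun n : ℕ => ∫⁻ o, ‖{o | (n : ℝ) < |f o|}.indicator k o‖ₑ ^ p.toReal ∂μ)
      atTop (𝓝 (∫⁻ _, 0 ∂μ)) := by
    refine tendsto_lintegral_filter_of_dominated_convergence' (fun o => ‖k o‖ₑ ^ p.toReal)
      (.of_forall fun n => ?_) (.of_forall fun n => ae_of_all _ fun o => ?_) ?_
      (ae_of_all _ fun o => ?_)
    · exact ((hk.1.indicator (measurableSet_lt measurable_const hf.abs)).enorm.pow_const _)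
    · gcongr
      exact enorm_indicator_le_enorm_self _ _
    · exact (lintegral_rpow_enorm_lt_top_of_eLpNorm_lt_top hp0 hp hk.2).ne
    · refine tendsto_const_nhds.congr' ?_
      filter_upwards [eventually_ge_atTop ⌈|f o|⌉₊] with n hn
      have : o ∉ {o | (n : ℝ) < |f o|} := not_lt.2 (Nat.ceil_le.1 hn)
      rw [Set.indicator_of_notMem this, enorm_zero, ENNReal.zero_rpow_of_pos hpos]
  simpa [eLpNorm_eq_lintegral_rpow_enorm_toReal hp0 hp, hpos] using
    h.ennrpow_const (1 / p.toReal)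

theorem tendsto_zero_of_le_natCast_mul_add {u r : ι → ℝ≥0∞} {s : ℕ → ℝ≥0∞}
    (hr : Tendsto r l (𝓝 0)) (hs : Tendsto s atTop (𝓝 0)) (h : ∀ n i, u i ≤ n * r i + s n) :
    Tendsto u l (𝓝 0) := by
  refine ENNReal.tendsto_nhds_zero.2 fun δ hδ => ?_
  have hδ' : 0 < δ / 2 := ENNReal.half_pos hδ.ne'
  obtain ⟨n, hn⟩ := (ENNReal.tendsto_nhds_zero.1 hs _ hδ').exists
  have hnr : Tendsto (fun i => n * r i) l (𝓝 0) := by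
    simpa using ENNReal.Tendsto.const_mul hr (Or.inr (ENNReal.natCast_ne_top n))
  filter_upwards [ENNReal.tendsto_nhds_zero.1 hnr _ hδ'] with i hi
  exact (h n i).trans ((add_le_add hi hn).trans (ENNReal.add_halves δ).le)

theorem tendsto_integral_mul_mul_zero {f k : Ω → ℝ} {r : ι → Ω → ℝ} (hf : Measurable f)
    (hk : MemLp k 2 μ) (hr : ∀ i, AEStronglyMeasurable (r i) μ) {K : ℝ≥0}
    (hfr : ∀ i, eLpNorm (fun o => f o * r i o) 2 μ ≤ K)
    (hr0 : Tendsto (fun i => eLpNorm (r i) 2 μ) l (𝓝 0)) :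
    Tendsto (fun i => ‖∫ o, f o * r i o * k o ∂μ‖ₑ) l (𝓝 0) := by
  have hrk : Tendsto (fun i => eLpNorm (r i) 2 μ * eLpNorm k 2 μ) l (𝓝 0) := by
    simpa using ENNReal.Tendsto.mul_const hr0 (Or.inr hk.2.ne)
  have hKk : Tendsto (fun n : ℕ => K * eLpNorm ({o | (n : ℝ) < |f o|}.indicator k) 2 μ)
      atTop (𝓝 0) := by
    simpa using ENNReal.Tendsto.const_mul
      (tendsto_eLpNorm_indicator_natCast_lt hf ENNReal.ofNat_ne_top hk)
      (Or.inr ENNReal.coe_ne_top)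
  refine tendsto_zero_of_le_natCast_mul_add hrk hKk fun n i => ?_
  set s := {o | (n : ℝ) < |f o|}
  have hs : MeasurableSet s := measurableSet_lt measurable_const hf.abs
  have hsplit (o : Ω) : ‖f o * r i o * k o‖ₑ ≤
      ‖(n : ℝ) * r i o * k o‖ₑ + ‖f o * r i o * s.indicator k o‖ₑ := by
    by_cases ho : o ∈ s
    · rw [Set.indicator_of_mem ho]
      exact le_add_self
    · refine le_add_right (enorm_le_iff_norm_le.2 ?_)
      simp only [norm_mul, Real.norm_eq_abs, Nat.abs_cast]
      gcongr
      exact not_lt.1 ho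
  calc ‖∫ o, f o * r i o * k o ∂μ‖ₑ
      ≤ ∫⁻ o, ‖f o * r i o * k o‖ₑ ∂μ := enorm_integral_le_lintegral_enorm _
    _ ≤ ∫⁻ o, ‖(n : ℝ) * r i o * k o‖ₑ ∂μ + ∫⁻ o, ‖f o * r i o * s.indicator k o‖ₑ ∂μ :=
        (lintegral_mono hsplit).trans_eq
          (lintegral_add_left' (((hr i).const_mul _).mul hk.1).enorm _)
    _ ≤ eLpNorm (fun o => (n : ℝ) * r i o) 2 μ * eLpNorm k 2 μ +
          eLpNorm (fun o => f o * r i o) 2 μ * eLpNorm (s.indicator k) 2 μ := by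
        gcongr
        · exact lintegral_enorm_mul_le ((hr i).const_mul _) hk.1
        · exact lintegral_enorm_mul_le (hf.aestronglyMeasurable.mul (hr i)) (hk.1.indicator hs)
    _ ≤ n * (eLpNorm (r i) 2 μ * eLpNorm k 2 μ) + K * eLpNorm (s.indicator k) 2 μ := by
        rw [← mul_assoc]
        gcongr
        · exact (eLpNorm_const_smul (n : ℝ) (r i) 2 μ).trans_le (by simp)
        · exact hfr i

theorem tendsto_integral_mul_mul {f u₀ w₀ : Ω → ℝ} {u w : ι → Ω → ℝ} (hf : Measurable f)
    (hu : ∀ i, AEStronglyMeasurable (u i) μ) (hu₀ : AEStronglyMeasurable u₀ μ)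
    (hw : ∀ i, MemLp (w i) 2 μ) (hw₀ : MemLp w₀ 2 μ) {K : ℝ≥0}
    (hfu : ∀ i, eLpNorm (fun o => f o * u i o) 2 μ ≤ K)
    (hfu₀ : eLpNorm (fun o => f o * u₀ o) 2 μ ≤ K)
    (hlim_u : Tendsto (fun i => eLpNorm (fun o => u i o - u₀ o) 2 μ) l (𝓝 0))
    (hlim_w : Tendsto (fun i => eLpNorm (fun o => w i o - w₀ o) 2 μ) l (𝓝 0)) :
    Tendsto (fun i => ∫ o, f o * u i o * w i o ∂μ) l (𝓝 (∫ o, f o * u₀ o * w₀ o ∂μ)) := by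
  have hfu_meas (i : ι) : AEStronglyMeasurable (fun o => f o * u i o) μ :=
    hf.aestronglyMeasurable.mul (hu i)
  have hfu₀_meas : AEStronglyMeasurable (fun o => f o * u₀ o) μ := hf.aestronglyMeasurable.mul hu₀
  have hfu_memLp (i : ι) : MemLp (fun o => f o * u i o) 2 μ :=
    ⟨hfu_meas i, (hfu i).trans_lt ENNReal.coe_lt_top⟩
  have hfu₀_memLp : MemLp (fun o => f o * u₀ o) 2 μ :=
    ⟨hfu₀_meas, hfu₀.trans_lt ENNReal.coe_lt_top⟩
  have hfdiff (i : ι) : eLpNorm (fun o => f o * (u i o - u₀ o)) 2 μ ≤ (K + K : ℝ≥0) := by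
    simp only [mul_sub, ENNReal.coe_add]
    exact (eLpNorm_sub_le (hfu_meas i) hfu₀_meas one_le_two).trans (add_le_add (hfu i) hfu₀)
  have hweak := tendsto_integral_mul_mul_zero hf hw₀ (fun i => (hu i).sub hu₀) hfdiff hlim_u
  have hstrong : Tendsto (fun i => K * eLpNorm (fun o => w i o - w₀ o) 2 μ) l (𝓝 0) := by
    simpa using ENNReal.Tendsto.const_mul hlim_w (Or.inr ENNReal.coe_ne_top)
  refine tendsto_iff_edist_tendsto_0.2 ?_
  refine tendsto_of_tendsto_of_tendsto_of_le_of_le tendsto_const_nhds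
    (by simpa only [add_zero] using hstrong.add hweak) (fun _ => zero_le) fun i => ?_
  have hdecomp : ∫ o, f o * u i o * w i o ∂μ - ∫ o, f o * u₀ o * w₀ o ∂μ =
      ∫ o, f o * u i o * (w i o - w₀ o) ∂μ + ∫ o, f o * (u i o - u₀ o) * w₀ o ∂μ := by
    simp only [mul_sub, sub_mul]
    rw [integral_sub, integral_sub]
    · ring
    · exact (hfu_memLp i).integrable_mul hw₀
    · exact hfu₀_memLp.integrable_mul hw₀
    · exact (hfu_memLp i).integrable_mul (hw i)
    · exact (hfu_memLp i).integrable_mul hw₀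
  rw [edist_eq_enorm_sub, hdecomp]
  refine (enorm_add_le _ _).trans (add_le_add ?_ le_rfl)
  exact (enorm_integral_mul_le (hfu_meas i) ((hw i).1.sub hw₀.1)).trans
    (mul_le_mul_left (hfu i) _)

theorem tendsto_eLpNorm_mul_mul_zero {a g : Ω → ℝ} {φ : ι → Ω → ℝ} (hg : Measurable g)
    (hga : MemLp (fun o => g o * a o) 2 μ) (hφ : ∀ i, AEStronglyMeasurable (φ i) μ)
    (ha : AEStronglyMeasurable a μ) {M : ℝ} (hφM : ∀ i o, |φ i o| ≤ M)
    (hlim : Tendsto (fun i => eLpNorm (fun o => φ i o * a o) 2 μ) l (𝓝 0)) :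
    Tendsto (fun i => eLpNorm (fun o => φ i o * (g o * a o)) 2 μ) l (𝓝 0) := by
  have htail : Tendsto (fun n : ℕ => ENNReal.ofReal M *
      eLpNorm ({o | (n : ℝ) < |g o|}.indicator fun o => g o * a o) 2 μ) atTop (𝓝 0) := by
    simpa using ENNReal.Tendsto.const_mul
      (tendsto_eLpNorm_indicator_natCast_lt hg ENNReal.ofNat_ne_top hga)
      (Or.inr ENNReal.ofReal_ne_top)
  refine tendsto_zero_of_le_natCast_mul_add hlim htail fun n i => ?_
  set s := {o | (n : ℝ) < |g o|}
  have hs : MeasurableSet s := measurableSet_lt measurable_const hg.abs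
  refine (eLpNorm_le_add_of_abs_le_add (v := fun o => sᶜ.indicator g o * (φ i o * a o))
    (w := fun o => φ i o * s.indicator (fun o => g o * a o) o)
    ((hg.indicator hs.compl).aestronglyMeasurable.mul ((hφ i).mul ha))
    ((hφ i).mul (hga.1.indicator hs)) fun o => ?_).trans (add_le_add ?_ ?_)
  · by_cases ho : o ∈ s <;> simp [ho, abs_mul, mul_left_comm]
  · rw [← ENNReal.ofReal_natCast]
    refine eLpNorm_le_ofReal_mul_of_abs_le_mul fun o => ?_
    rw [abs_mul]
    gcongr
    by_cases ho : o ∈ s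
    · simp [ho]
    · simpa [ho] using not_lt.1 ho
  · refine eLpNorm_le_ofReal_mul_of_abs_le_mul fun o => ?_
    rw [abs_mul]
    exact mul_le_mul_of_nonneg_right (hφM i o) (abs_nonneg _)

end L2

section RootLaw

variable {Ω E : Type*} [MeasurableSpace Ω] [MeasurableSpace E] {μ : Measure Ω} {π : Ω → E}

theorem integral_withDensity_sq {c : Ω → ℝ} (hc : Measurable c) (f : Ω → ℝ) :
    ∫ o, f o ∂μ.withDensity (fun o => ENNReal.ofReal (c o ^ 2)) = ∫ o, f o * c o ^ 2 ∂μ := by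
  rw [integral_withDensity_eq_integral_toReal_smul (hc.pow_const 2).ennreal_ofReal (by simp)]
  simp only [ENNReal.toReal_ofReal (sq_nonneg _), smul_eq_mul, mul_comm]

theorem eLpNorm_withDensity_sq {c f : Ω → ℝ} (hc : Measurable c) (hf : Measurable f) :
    eLpNorm f 2 (μ.withDensity fun o => ENNReal.ofReal (c o ^ 2)) =
      eLpNorm (fun o => f o * c o) 2 μ := by
  rw [eLpNorm_two_eq, eLpNorm_two_eq, lintegral_withDensity_eq_lintegral_mul _
    (hc.pow_const 2).ennreal_ofReal (hf.pow_const 2).ennreal_ofReal]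
  simp only [Pi.mul_apply, ← ENNReal.ofReal_mul (sq_nonneg _), mul_pow, mul_comm]

/-- The law of the statistic `π` under the measure that has the square-root density `c` with respect
to `μ`. -/
def rootLaw (μ : Measure Ω) (π : Ω → E) (c : Ω → ℝ) : Measure E :=
  (μ.withDensity fun o => ENNReal.ofReal (c o ^ 2)).map π

theorem integral_rootLaw (hπ : Measurable π) {c : Ω → ℝ} (hc : Measurable c) {u : E → ℝ}
    (hu : Measurable u) : ∫ x, u x ∂rootLaw μ π c = ∫ o, u (π o) * c o ^ 2 ∂μ :=
  (integral_map hπ.aemeasurable hu.aestronglyMeasurable).trans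
    (integral_withDensity_sq hc fun o => u (π o))

theorem eLpNorm_indicator_preimage_congr (hπ : Measurable π) {c c' : Ω → ℝ}
    (h : rootLaw μ π c = rootLaw μ π c') {B : Set E} (hB : MeasurableSet B) :
    eLpNorm ((π ⁻¹' B).indicator c) 2 μ = eLpNorm ((π ⁻¹' B).indicator c') 2 μ := by
  have hB' (c : Ω → ℝ) :
      eLpNorm ((π ⁻¹' B).indicator c) 2 μ = rootLaw μ π c B ^ (1 / 2 : ℝ) := by
    rw [eLpNorm_indicator_eq_eLpNorm_restrict (hπ hB), eLpNorm_two_eq, rootLaw,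
      Measure.map_apply hπ hB, withDensity_apply _ (hπ hB)]
  rw [hB', hB', h]

/-- A square-root weight bounded by `M`: the square root of a density ratio bounded by `M ^ 2`. -/
structure IsRootWeight (M : ℝ) (m : E → ℝ) : Prop where
  measurable : Measurable m
  nonneg : ∀ x, 0 ≤ m x
  le : ∀ x, m x ≤ M

variable {m m₀ : E → ℝ} {M : ℝ} {a b : Ω → ℝ}

theorem IsRootWeight.abs_le (hm : IsRootWeight M m) (x : E) : |m x| ≤ M := by
  rw [abs_of_nonneg (hm.nonneg x)]
  exact hm.le x

theorem IsRootWeight.sq_le (hm : IsRootWeight M m) (x : E) : m x ^ 2 ≤ M ^ 2 :=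
  pow_le_pow_left₀ (hm.nonneg x) (hm.le x) 2

theorem IsRootWeight.abs_sub_le (hm : IsRootWeight M m) (hm₀ : IsRootWeight M m₀) (x : E) :
    |m x - m₀ x| ≤ M :=
  abs_sub_le_of_nonneg_of_le (hm.nonneg x) (hm.le x) (hm₀.nonneg x) (hm₀.le x)

theorem IsRootWeight.min_two_mul (hm : IsRootWeight M m) (hm₀ : IsRootWeight M m₀) :
    IsRootWeight M fun x => min (m x) (2 * m₀ x) where
  measurable := hm.measurable.min (hm₀.measurable.const_mul 2)
  nonneg x := le_min (hm.nonneg x) (mul_nonneg zero_le_two (hm₀.nonneg x))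
  le x := (min_le_left _ _).trans (hm.le x)

theorem IsRootWeight.memLp_mul (hm : IsRootWeight M m) (hπ : Measurable π) (ha : MemLp a 2 μ) :
    MemLp (fun o => m (π o) * a o) 2 μ :=
  MemLp.of_le_mul (c := M) ha ((hm.measurable.comp hπ).aestronglyMeasurable.mul ha.1)
    (ae_of_all _ fun o => by
      rw [norm_mul]
      exact mul_le_mul_of_nonneg_right (hm.abs_le _) (norm_nonneg _))

theorem IsRootWeight.integrable_mul_mul_mul (hm : IsRootWeight M m) (hπ : Measurable π)
    (ha : MemLp a 2 μ) {s : E → ℝ} (hs : Measurable s) (hs1 : ∀ x, |s x| ≤ 1) (hb : MemLp b 2 μ) :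
    Integrable (fun o => s (π o) * (m (π o) ^ 2 * (a o * b o))) μ := by
  refine ((ha.integrable_mul hb).bdd_mul
    ((hm.measurable.comp hπ).pow_const 2).aestronglyMeasurable (c := M ^ 2)
    (ae_of_all _ fun o => ?_)).bdd_mul (hs.comp hπ).aestronglyMeasurable
    (ae_of_all _ fun o => hs1 _)
  rw [Real.norm_eq_abs, abs_of_nonneg (sq_nonneg _)]
  exact hm.sq_le _

theorem exists_measurable_sign {r : E → ℝ} (hr : Measurable r) :
    ∃ s : E → ℝ, Measurable s ∧ (∀ x, |s x| = 1) ∧ ∀ x, s x * r x = |r x| := by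
  refine ⟨fun x => if 0 ≤ r x then 1 else -1,
    .ite (measurableSet_le measurable_const hr) measurable_const measurable_const,
    fun x => ?_, fun x => ?_⟩
  · dsimp only
    split_ifs <;> simp
  · dsimp only
    split_ifs with h
    · rw [one_mul, abs_of_nonneg h]
    · rw [neg_one_mul, abs_of_neg (not_le.1 h)]

-- With `s` the sign of `m ^ 2 - m₀ ^ 2`, the equality of the two laws turns `∫ s * m₀ ^ 2 * b ^ 2`
-- into `∫ s * m ^ 2 * a ^ 2`, so that only the difference of `a` and `b` is left.
theorem integral_abs_sq_sub_sq_mul_sq_le (hπ : Measurable π) (hm : IsRootWeight M m)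
    (hm₀ : IsRootWeight M m₀) (ha : Measurable a) (hb : Measurable b) (ha2 : MemLp a 2 μ)
    (hb2 : MemLp b 2 μ)
    (h : rootLaw μ π (fun o => m (π o) * a o) = rootLaw μ π fun o => m₀ (π o) * b o) :
    ENNReal.ofReal (∫ o, |m (π o) ^ 2 - m₀ (π o) ^ 2| * b o ^ 2 ∂μ) ≤
      ENNReal.ofReal (M ^ 2) *
        (eLpNorm (fun o => a o - b o) 2 μ * eLpNorm (fun o => a o + b o) 2 μ) := by
  have hmπ := hm.measurable.comp hπ
  have hm₀π := hm₀.measurable.comp hπ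
  obtain ⟨s, hs, hs1, hsr⟩ := exists_measurable_sign (r := fun x => m x ^ 2 - m₀ x ^ 2)
    ((hm.measurable.pow_const 2).sub (hm₀.measurable.pow_const 2))
  have hsπ := hs.comp hπ
  have hs1' (x : E) : |s x| ≤ 1 := (hs1 x).le
  have hsame : ∫ o, s (π o) * (m₀ (π o) ^ 2 * (b o * b o)) ∂μ =
      ∫ o, s (π o) * (m (π o) ^ 2 * (a o * a o)) ∂μ := by
    simp only [← sq, ← mul_pow]
    exact (integral_rootLaw hπ (c := fun o => m₀ (π o) * b o) (hm₀π.mul hb) hs).symm.trans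
      (h ▸ integral_rootLaw hπ (c := fun o => m (π o) * a o) (hmπ.mul ha) hs)
  have hint : ∫ o, |m (π o) ^ 2 - m₀ (π o) ^ 2| * b o ^ 2 ∂μ =
      ∫ o, s (π o) * m (π o) ^ 2 * (b o - a o) * (a o + b o) ∂μ :=
    calc ∫ o, |m (π o) ^ 2 - m₀ (π o) ^ 2| * b o ^ 2 ∂μ
        = ∫ o, (s (π o) * (m (π o) ^ 2 * (b o * b o)) -
            s (π o) * (m₀ (π o) ^ 2 * (b o * b o))) ∂μ := by
          refine integral_congr_ae (ae_of_all _ fun o => ?_)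
          dsimp only
          rw [← hsr]
          ring
      _ = ∫ o, (s (π o) * (m (π o) ^ 2 * (b o * b o)) -
            s (π o) * (m (π o) ^ 2 * (a o * a o))) ∂μ := by
          have hbb := hm.integrable_mul_mul_mul hπ hb2 hs hs1' hb2
          rw [integral_sub hbb (hm₀.integrable_mul_mul_mul hπ hb2 hs hs1' hb2), hsame,
            ← integral_sub hbb (hm.integrable_mul_mul_mul hπ ha2 hs hs1' ha2)]
      _ = ∫ o, s (π o) * m (π o) ^ 2 * (b o - a o) * (a o + b o) ∂μ :=
          integral_congr_ae (ae_of_all _ fun o => by ring)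
  rw [hint, ← mul_assoc]
  refine (ENNReal.ofReal_le_ofReal (le_abs_self _)).trans ?_
  rw [← Real.enorm_eq_ofReal_abs]
  refine (enorm_integral_mul_le (u := fun o => s (π o) * m (π o) ^ 2 * (b o - a o))
    (v := fun o => a o + b o)
    ((hsπ.mul (hmπ.pow_const 2)).mul (hb.sub ha)).aestronglyMeasurable
    (ha.add hb).aestronglyMeasurable).trans ?_
  gcongr
  refine eLpNorm_le_ofReal_mul_of_abs_le_mul fun o => ?_
  rw [abs_mul, abs_mul, hs1, one_mul, abs_of_nonneg (sq_nonneg (m (π o))), abs_sub_comm (b o)]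
  exact mul_le_mul_of_nonneg_right (hm.sq_le _) (abs_nonneg _)

theorem eLpNorm_weight_sub_mul_le (hπ : Measurable π) (hm : IsRootWeight M m)
    (hm₀ : IsRootWeight M m₀) (ha : Measurable a) (hb : Measurable b) (ha2 : MemLp a 2 μ)
    (hb2 : MemLp b 2 μ)
    (h : rootLaw μ π (fun o => m (π o) * a o) = rootLaw μ π fun o => m₀ (π o) * b o) :
    eLpNorm (fun o => (m (π o) - m₀ (π o)) * b o) 2 μ ≤
      (ENNReal.ofReal (M ^ 2) *
        (eLpNorm (fun o => a o - b o) 2 μ * eLpNorm (fun o => a o + b o) 2 μ)) ^ (1 / 2 : ℝ) := by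
  have hint : Integrable (fun o => |m (π o) ^ 2 - m₀ (π o) ^ 2| * b o ^ 2) μ := by
    refine hb2.integrable_sq.bdd_mul (c := M ^ 2)
      (((hm.measurable.comp hπ).pow_const 2).sub
        ((hm₀.measurable.comp hπ).pow_const 2)).abs.aestronglyMeasurable
      (ae_of_all _ fun o => ?_)
    rw [Real.norm_eq_abs, abs_abs]
    exact abs_sub_le_of_nonneg_of_le (sq_nonneg _) (hm.sq_le _) (sq_nonneg _) (hm₀.sq_le _)
  have hsq (x : E) : (m x - m₀ x) ^ 2 ≤ |m x ^ 2 - m₀ x ^ 2| := by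
    rw [← sq_abs, sq, sq_sub_sq, abs_mul, mul_comm |m x + _|,
      abs_of_nonneg (add_nonneg (hm.nonneg x) (hm₀.nonneg x))]
    refine mul_le_mul_of_nonneg_left (abs_le.2 ?_) (abs_nonneg _)
    constructor <;> linarith [hm.nonneg x, hm₀.nonneg x]
  rw [eLpNorm_two_eq]
  refine ENNReal.rpow_le_rpow ?_ (by norm_num)
  refine le_trans ?_ (integral_abs_sq_sub_sq_mul_sq_le hπ hm hm₀ ha hb ha2 hb2 h)
  rw [ofReal_integral_eq_lintegral_ofReal hint (ae_of_all _ fun o => by positivity)]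
  refine lintegral_mono fun o => ENNReal.ofReal_le_ofReal ?_
  rw [mul_pow]
  exact mul_le_mul_of_nonneg_right (hsq _) (sq_nonneg _)

theorem eLpNorm_indicator_two_mul_lt_le (hπ : Measurable π) (hm : IsRootWeight M m)
    (hm₀ : IsRootWeight M m₀) (ha : MemLp a 2 μ) (hb : MemLp b 2 μ)
    (h : rootLaw μ π (fun o => m (π o) * a o) = rootLaw μ π fun o => m₀ (π o) * b o) :
    eLpNorm ((π ⁻¹' {x | 2 * m₀ x < m x}).indicator fun o => m₀ (π o) * b o) 2 μ ≤
      2 * eLpNorm ((π ⁻¹' {x | 2 * m₀ x < m x}).indicator fun o => m₀ (π o) * (a o - b o)) 2 μ := by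
  have hB : MeasurableSet {x | 2 * m₀ x < m x} :=
    measurableSet_lt (hm₀.measurable.const_mul 2) hm.measurable
  set B := {x | 2 * m₀ x < m x}
  set N := eLpNorm ((π ⁻¹' B).indicator fun o => m₀ (π o) * b o) 2 μ
  set D := eLpNorm ((π ⁻¹' B).indicator fun o => m₀ (π o) * (a o - b o)) 2 μ
  have hN : eLpNorm ((π ⁻¹' B).indicator fun o => m (π o) * a o) 2 μ = N :=
    eLpNorm_indicator_preimage_congr hπ h hB
  have hN_ne_top : N ≠ ∞ := ((hm₀.memLp_mul hπ hb).indicator (hπ hB)).2.ne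
  have htri : 2 * N ≤ N + 2 * D := by
    rw [two_mul_eLpNorm, two_mul_eLpNorm, ← hN]
    refine eLpNorm_le_add_of_abs_le_add ((hm.memLp_mul hπ ha).1.indicator (hπ hB))
      (((hm₀.memLp_mul hπ (ha.sub hb)).1.indicator (hπ hB)).const_mul 2) fun o => ?_
    by_cases ho : o ∈ π ⁻¹' B
    · simp only [Set.indicator_of_mem ho, abs_mul, abs_two, abs_of_nonneg (hm.nonneg _),
        abs_of_nonneg (hm₀.nonneg _)]
      have hlt : 2 * m₀ (π o) ≤ m (π o) := le_of_lt ho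
      nlinarith [mul_le_mul_of_nonneg_right hlt (abs_nonneg (a o)), hm₀.nonneg (π o),
        mul_le_mul_of_nonneg_left (abs_sub_abs_le_abs_sub (b o) (a o)) (hm₀.nonneg (π o)),
        abs_sub_comm (a o) (b o)]
    · simp [ho]
  rw [two_mul] at htri
  exact (ENNReal.add_le_add_iff_left hN_ne_top).1 htri

theorem eLpNorm_indicator_two_mul_lt_le_add (hπ : Measurable π) (hm : IsRootWeight M m)
    (hm₀ : IsRootWeight M m₀) (ha : MemLp a 2 μ) (hb : MemLp b 2 μ)
    (h : rootLaw μ π (fun o => m (π o) * a o) = rootLaw μ π fun o => m₀ (π o) * b o)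
    {d : Ω → ℝ} (hd : AEStronglyMeasurable d μ) :
    eLpNorm ((π ⁻¹' {x | 2 * m₀ x < m x}).indicator fun o => m₀ (π o) * b o) 2 μ ≤
      2 * (ENNReal.ofReal M * eLpNorm (fun o => a o - b o - d o) 2 μ +
        eLpNorm (fun o => (m (π o) - m₀ (π o)) * d o) 2 μ) := by
  refine (eLpNorm_indicator_two_mul_lt_le hπ hm hm₀ ha hb h).trans ?_
  gcongr
  have he : AEStronglyMeasurable (fun o => m₀ (π o) * (a o - b o - d o)) μ :=
    (hm₀.measurable.comp hπ).aestronglyMeasurable.mul ((ha.1.sub hb.1).sub hd)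
  have hd' : AEStronglyMeasurable (fun o => (m (π o) - m₀ (π o)) * d o) μ :=
    ((hm.measurable.comp hπ).sub (hm₀.measurable.comp hπ)).aestronglyMeasurable.mul hd
  refine (eLpNorm_le_add_of_abs_le_add he hd' fun o => ?_).trans (add_le_add ?_ le_rfl)
  · by_cases ho : o ∈ π ⁻¹' {x | 2 * m₀ x < m x}
    · have hle : |m₀ (π o)| ≤ |m (π o) - m₀ (π o)| := by
        have hlt : 2 * m₀ (π o) < m (π o) := ho
        rw [abs_of_nonneg (hm₀.nonneg _)]
        exact le_trans (by linarith) (le_abs_self _)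
      rw [Set.indicator_of_mem ho]
      calc |m₀ (π o) * (a o - b o)| = |m₀ (π o) * (a o - b o - d o) + m₀ (π o) * d o| := by ring_nf
        _ ≤ |m₀ (π o) * (a o - b o - d o)| + |m₀ (π o) * d o| := abs_add_le _ _
        _ ≤ |m₀ (π o) * (a o - b o - d o)| + |(m (π o) - m₀ (π o)) * d o| := by
            rw [abs_mul _ (d o), abs_mul _ (d o)]
            gcongr
    · rw [Set.indicator_of_notMem ho, abs_zero]
      positivity
  · refine eLpNorm_le_ofReal_mul_of_abs_le_mul fun o => ?_
    rw [abs_mul]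
    exact mul_le_mul_of_nonneg_right (hm₀.abs_le _) (abs_nonneg _)

theorem abs_reweighted_sub_le {u v x y z : ℝ} (hu : u ≤ 2 * v) :
    |u * x - min u (2 * v) * y - v * z| ≤ |u * (x - y - z)| + |(u - v) * z| := by
  rw [min_eq_left hu, show u * x - u * y - v * z = u * (x - y - z) + (u - v) * z by ring]
  exact abs_add_le _ _

theorem abs_reweighted_sub_le_of_two_mul_lt {u v x y z : ℝ} (hv : 0 ≤ v) (hu : 2 * v < u) :
    |u * x - min u (2 * v) * y - v * z| ≤ |(u - v) * z| + (|u * x| + |2 * (v * y)|) := by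
  have hz : |v * z| ≤ |(u - v) * z| := by
    rw [abs_mul, abs_mul, abs_of_nonneg hv, abs_of_nonneg (by linarith : 0 ≤ u - v)]
    gcongr
    linarith
  rw [min_eq_right hu.le, mul_assoc, sub_sub]
  linarith [abs_sub (u * x) (2 * (v * y) + v * z), abs_add_le (2 * (v * y)) (v * z)]

theorem eLpNorm_reweighted_sub_le (hπ : Measurable π) (hm : IsRootWeight M m)
    (hm₀ : IsRootWeight M m₀) (ha : MemLp a 2 μ) (hb : MemLp b 2 μ)
    (h : rootLaw μ π (fun o => m (π o) * a o) = rootLaw μ π fun o => m₀ (π o) * b o)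
    {d : Ω → ℝ} (hd : AEStronglyMeasurable d μ) :
    eLpNorm (fun o => m (π o) * a o - min (m (π o)) (2 * m₀ (π o)) * b o - m₀ (π o) * d o) 2 μ ≤
      7 * (ENNReal.ofReal M * eLpNorm (fun o => a o - b o - d o) 2 μ +
        eLpNorm (fun o => (m (π o) - m₀ (π o)) * d o) 2 μ) := by
  have hB := measurableSet_lt (hm₀.measurable.const_mul 2) hm.measurable
  have hlow := eLpNorm_indicator_two_mul_lt_le_add hπ hm hm₀ ha hb h hd
  have hN := eLpNorm_indicator_preimage_congr hπ h hB
  set B := π ⁻¹' {x | 2 * m₀ x < m x}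
  set N := eLpNorm (B.indicator fun o => m₀ (π o) * b o) 2 μ
  set E := ENNReal.ofReal M * eLpNorm (fun o => a o - b o - d o) 2 μ +
    eLpNorm (fun o => (m (π o) - m₀ (π o)) * d o) 2 μ
  have he : AEStronglyMeasurable (fun o => m (π o) * (a o - b o - d o)) μ :=
    (hm.measurable.comp hπ).aestronglyMeasurable.mul ((ha.1.sub hb.1).sub hd)
  have hd' : AEStronglyMeasurable (fun o => (m (π o) - m₀ (π o)) * d o) μ :=
    ((hm.measurable.comp hπ).sub (hm₀.measurable.comp hπ)).aestronglyMeasurable.mul hd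
  have hBa : AEStronglyMeasurable (B.indicator fun o => m (π o) * a o) μ :=
    (hm.memLp_mul hπ ha).1.indicator (hπ hB)
  have hBb : AEStronglyMeasurable (fun o => 2 * B.indicator (fun o => m₀ (π o) * b o) o) μ :=
    ((hm₀.memLp_mul hπ hb).1.indicator (hπ hB)).const_mul 2
  calc _ ≤ eLpNorm (fun o => |m (π o) * (a o - b o - d o)| + |(m (π o) - m₀ (π o)) * d o|) 2 μ +
        eLpNorm (fun o => |B.indicator (fun o => m (π o) * a o) o| +
          |2 * B.indicator (fun o => m₀ (π o) * b o) o|) 2 μ := by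
        refine eLpNorm_le_add_of_abs_le_add (he.norm.add hd'.norm) (hBa.norm.add hBb.norm)
          fun o => le_trans ?_ (add_le_add (le_abs_self _) (le_abs_self _))
        by_cases ho : o ∈ B
        · rw [Set.indicator_of_mem ho, Set.indicator_of_mem ho]
          exact (abs_reweighted_sub_le_of_two_mul_lt (hm₀.nonneg _) ho).trans
            (add_le_add_left (le_add_of_nonneg_left (abs_nonneg _)) _)
        · simpa only [Set.indicator_of_notMem ho, mul_zero, abs_zero, add_zero] using
            abs_reweighted_sub_le (not_lt.1 ho)
    _ ≤ E + (N + 2 * N) := by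
        rw [two_mul_eLpNorm, ← hN]
        refine add_le_add ((eLpNorm_abs_add_abs_le he hd').trans (add_le_add_left ?_ _))
          (eLpNorm_abs_add_abs_le hBa hBb)
        refine eLpNorm_le_ofReal_mul_of_abs_le_mul fun o => ?_
        rw [abs_mul]
        exact mul_le_mul_of_nonneg_right (hm.abs_le _) (abs_nonneg _)
    _ ≤ E + (2 * E + 2 * (2 * E)) := by gcongr
    _ = 7 * E := by ring

end RootLaw

section ReweightedDQM

variable {Ω E : Type*} [MeasurableSpace Ω] [MeasurableSpace E] {μ : Measure Ω} {π : Ω → E}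

/-- Square-root densities `a θ` that are differentiable in quadratic mean at `0` with score `g`,
together with square-root weights `m θ`, functions of the statistic `π` bounded by `M`, for which
the reweighted law of `π` does not depend on `θ`. -/
structure IsReweightedDQM (μ : Measure Ω) (π : Ω → E) (a : ℝ → Ω → ℝ) (m : ℝ → E → ℝ) (M : ℝ)
    (g : Ω → ℝ) : Prop where
  measurable_statistic : Measurable π
  measurable_root : ∀ θ, Measurable (a θ)
  memLp_root : ∀ θ, MemLp (a θ) 2 μ
  isRootWeight : ∀ θ, IsRootWeight M (m θ)
  rootLaw_eq : ∀ θ, rootLaw μ π (fun o => m θ (π o) * a θ o) =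
    rootLaw μ π fun o => m 0 (π o) * a 0 o
  measurable_score : Measurable g
  memLp_score : MemLp (fun o => g o * a 0 o) 2 μ
  tendsto_quotient : Tendsto
    (fun θ => eLpNorm (fun o => (a θ o - a 0 o) / θ - g o * a 0 o / 2) 2 μ) (𝓝[≠] 0) (𝓝 0)

namespace IsReweightedDQM

variable {a : ℝ → Ω → ℝ} {m : ℝ → E → ℝ} {M : ℝ} {g : Ω → ℝ}

theorem tendsto_root (h : IsReweightedDQM μ π a m M g) :
    Tendsto (fun θ => eLpNorm (fun o => a θ o - a 0 o) 2 μ) (𝓝[≠] 0) (𝓝 0) := by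
  have habs : Tendsto (fun θ : ℝ => ENNReal.ofReal |θ|) (𝓝[≠] 0) (𝓝 0) := by
    have : Tendsto (fun θ : ℝ => ENNReal.ofReal |θ|) (𝓝 0) (𝓝 (ENNReal.ofReal |0|)) :=
      (ENNReal.continuous_ofReal.comp continuous_abs).tendsto 0
    simpa using this.mono_left nhdsWithin_le_nhds
  have hscore : MemLp (fun o => g o * a 0 o / 2) 2 μ := by
    simpa only [div_eq_inv_mul] using h.memLp_score.const_mul (2 : ℝ)⁻¹
  have hlim : Tendsto (fun θ => ENNReal.ofReal |θ| *
      (eLpNorm (fun o => (a θ o - a 0 o) / θ - g o * a 0 o / 2) 2 μ +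
        eLpNorm (fun o => g o * a 0 o / 2) 2 μ)) (𝓝[≠] 0) (𝓝 0) := by
    simpa using ENNReal.Tendsto.mul habs (Or.inr (by simpa using hscore.2.ne))
      (h.tendsto_quotient.add_const _) (Or.inr ENNReal.zero_ne_top)
  refine tendsto_of_tendsto_of_tendsto_of_le_of_le' tendsto_const_nhds hlim
    (.of_forall fun _ => zero_le) ?_
  filter_upwards [self_mem_nhdsWithin] with θ hθ
  have hquot : AEStronglyMeasurable (fun o => (a θ o - a 0 o) / θ - g o * a 0 o / 2) μ :=
    (((h.measurable_root θ).sub (h.measurable_root 0)).div_const θ).aestronglyMeasurable.sub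
      hscore.1
  refine (eLpNorm_le_ofReal_mul_of_abs_le_mul (c := |θ|)
    (v := fun o => (a θ o - a 0 o) / θ - g o * a 0 o / 2 + g o * a 0 o / 2) fun o => ?_).trans
    (mul_le_mul_right (eLpNorm_add_le hquot hscore.1 one_le_two) _)
  rw [← abs_mul, sub_add_cancel, mul_div_cancel₀ _ hθ]

theorem tendsto_weight_sub_mul_root (h : IsReweightedDQM μ π a m M g) :
    Tendsto (fun θ => eLpNorm (fun o => (m θ (π o) - m 0 (π o)) * a 0 o) 2 μ)
      (𝓝[≠] 0) (𝓝 0) := by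
  have hsum (θ : ℝ) : eLpNorm (fun o => a θ o + a 0 o) 2 μ ≤
      eLpNorm (fun o => a θ o - a 0 o) 2 μ + 2 * eLpNorm (a 0) 2 μ := by
    rw [two_mul_eLpNorm]
    refine eLpNorm_le_add_of_abs_le_add ((h.memLp_root θ).1.sub (h.memLp_root 0).1)
      ((h.memLp_root 0).1.const_mul 2) fun o => ?_
    rw [show a θ o + a 0 o = a θ o - a 0 o + 2 * a 0 o by ring]
    exact abs_add_le _ _
  have hlim : Tendsto (fun θ => (ENNReal.ofReal (M ^ 2) * (eLpNorm (fun o => a θ o - a 0 o) 2 μ *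
      (eLpNorm (fun o => a θ o - a 0 o) 2 μ + 2 * eLpNorm (a 0) 2 μ))) ^ (1 / 2 : ℝ))
      (𝓝[≠] 0) (𝓝 0) := by
    have hfin : 2 * eLpNorm (a 0) 2 μ ≠ ∞ :=
      ENNReal.mul_ne_top ENNReal.ofNat_ne_top (h.memLp_root 0).2.ne
    have hmul : Tendsto (fun θ => eLpNorm (fun o => a θ o - a 0 o) 2 μ *
        (eLpNorm (fun o => a θ o - a 0 o) 2 μ + 2 * eLpNorm (a 0) 2 μ)) (𝓝[≠] 0) (𝓝 0) := by
      simpa using ENNReal.Tendsto.mul h.tendsto_root (Or.inr (by simpa using hfin))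
        (h.tendsto_root.add_const _) (Or.inr ENNReal.zero_ne_top)
    simpa using (ENNReal.Tendsto.const_mul hmul (Or.inr ENNReal.ofReal_ne_top)).ennrpow_const
      (1 / 2 : ℝ)
  refine tendsto_of_tendsto_of_tendsto_of_le_of_le tendsto_const_nhds hlim
    (fun _ => zero_le) fun θ => ?_
  refine (eLpNorm_weight_sub_mul_le h.measurable_statistic (h.isRootWeight θ) (h.isRootWeight 0)
    (h.measurable_root θ) (h.measurable_root 0) (h.memLp_root θ) (h.memLp_root 0)
    (h.rootLaw_eq θ)).trans ?_
  gcongr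
  exact hsum θ

theorem tendsto_weight_sub_mul_score (h : IsReweightedDQM μ π a m M g) :
    Tendsto (fun θ => eLpNorm (fun o => (m θ (π o) - m 0 (π o)) * (g o * a 0 o)) 2 μ)
      (𝓝[≠] 0) (𝓝 0) :=
  tendsto_eLpNorm_mul_mul_zero h.measurable_score h.memLp_score
    (fun θ => (((h.isRootWeight θ).measurable.sub (h.isRootWeight 0).measurable).comp
      h.measurable_statistic).aestronglyMeasurable) (h.memLp_root 0).1
    (fun θ o => (h.isRootWeight θ).abs_sub_le (h.isRootWeight 0) (π o))
    h.tendsto_weight_sub_mul_root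

theorem tendsto_reweighted (h : IsReweightedDQM μ π a m M g) :
    Tendsto (fun θ => eLpNorm (fun o => m θ (π o) * a θ o - m 0 (π o) * a 0 o) 2 μ)
      (𝓝[≠] 0) (𝓝 0) := by
  have hlim : Tendsto (fun θ => ENNReal.ofReal M * eLpNorm (fun o => a θ o - a 0 o) 2 μ +
      eLpNorm (fun o => (m θ (π o) - m 0 (π o)) * a 0 o) 2 μ) (𝓝[≠] 0) (𝓝 0) := by
    simpa using (ENNReal.Tendsto.const_mul h.tendsto_root (Or.inr ENNReal.ofReal_ne_top)).add
      h.tendsto_weight_sub_mul_root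
  have hm (θ : ℝ) := (h.isRootWeight θ).measurable.comp h.measurable_statistic
  refine tendsto_of_tendsto_of_tendsto_of_le_of_le tendsto_const_nhds hlim
    (fun _ => zero_le) fun θ => ?_
  refine (eLpNorm_le_add_of_abs_le_add (v := fun o => m θ (π o) * (a θ o - a 0 o))
    (w := fun o => (m θ (π o) - m 0 (π o)) * a 0 o)
    ((hm θ).aestronglyMeasurable.mul ((h.memLp_root θ).1.sub (h.memLp_root 0).1))
    (((hm θ).sub (hm 0)).aestronglyMeasurable.mul (h.memLp_root 0).1) fun o => ?_).trans
    (add_le_add_left (eLpNorm_le_ofReal_mul_of_abs_le_mul fun o => ?_) _)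
  · rw [show m θ (π o) * a θ o - m 0 (π o) * a 0 o =
      m θ (π o) * (a θ o - a 0 o) + (m θ (π o) - m 0 (π o)) * a 0 o by ring]
    exact abs_add_le _ _
  · rw [abs_mul]
    exact mul_le_mul_of_nonneg_right ((h.isRootWeight θ).abs_le _) (abs_nonneg _)

theorem tendsto_truncated (h : IsReweightedDQM μ π a m M g) :
    Tendsto (fun θ => eLpNorm
      (fun o => min (m θ (π o)) (2 * m 0 (π o)) * a 0 o - m 0 (π o) * a 0 o) 2 μ)
      (𝓝[≠] 0) (𝓝 0) := by
  refine tendsto_of_tendsto_of_tendsto_of_le_of_le tendsto_const_nhds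
    h.tendsto_weight_sub_mul_root (fun _ => zero_le) fun θ => eLpNorm_mono fun o => ?_
  rw [← sub_mul, norm_mul, norm_mul]
  refine mul_le_mul_of_nonneg_right ?_ (norm_nonneg _)
  have h0 := (h.isRootWeight 0).nonneg (π o)
  rcases le_total (m θ (π o)) (2 * m 0 (π o)) with hle | hle
  · rw [min_eq_left hle]
  · rw [min_eq_right hle]
    exact abs_le_abs (by linarith) (by linarith)

theorem tendsto_reweighted_quotient (h : IsReweightedDQM μ π a m M g) :
    Tendsto (fun θ => eLpNorm (fun o =>
      (m θ (π o) * a θ o - min (m θ (π o)) (2 * m 0 (π o)) * a 0 o) / θ -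
        m 0 (π o) * (g o * a 0 o / 2)) 2 μ) (𝓝[≠] 0) (𝓝 0) := by
  have hlim : Tendsto (fun θ => 7 * (ENNReal.ofReal M *
      eLpNorm (fun o => (a θ o - a 0 o) / θ - g o * a 0 o / 2) 2 μ +
        eLpNorm (fun o => (m θ (π o) - m 0 (π o)) * (g o * a 0 o)) 2 μ)) (𝓝[≠] 0) (𝓝 0) := by
    simpa using ENNReal.Tendsto.const_mul ((ENNReal.Tendsto.const_mul h.tendsto_quotient
      (Or.inr ENNReal.ofReal_ne_top)).add h.tendsto_weight_sub_mul_score)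
      (Or.inr ENNReal.ofNat_ne_top)
  refine tendsto_of_tendsto_of_tendsto_of_le_of_le' tendsto_const_nhds hlim
    (.of_forall fun _ => zero_le) ?_
  filter_upwards [self_mem_nhdsWithin] with θ hθ
  have hscale (u : Ω → ℝ) : eLpNorm (fun o => θ * u o) 2 μ = ‖θ‖ₑ * eLpNorm u 2 μ :=
    eLpNorm_const_smul θ u 2 μ
  have hθ0 : ‖θ‖ₑ ≠ 0 := enorm_ne_zero.2 hθ
  rw [← ENNReal.mul_le_mul_iff_right hθ0 enorm_ne_top, ← hscale]
  calc eLpNorm (fun o => θ * ((m θ (π o) * a θ o - min (m θ (π o)) (2 * m 0 (π o)) * a 0 o) / θ -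
        m 0 (π o) * (g o * a 0 o / 2))) 2 μ
      = eLpNorm (fun o => m θ (π o) * a θ o - min (m θ (π o)) (2 * m 0 (π o)) * a 0 o -
        m 0 (π o) * (θ * (g o * a 0 o / 2))) 2 μ := by
        congr with o
        rw [mul_sub, mul_div_cancel₀ _ hθ, mul_left_comm θ]
    _ ≤ 7 * (ENNReal.ofReal M * eLpNorm (fun o => a θ o - a 0 o - θ * (g o * a 0 o / 2)) 2 μ +
        eLpNorm (fun o => (m θ (π o) - m 0 (π o)) * (θ * (g o * a 0 o / 2))) 2 μ) :=
        eLpNorm_reweighted_sub_le h.measurable_statistic (h.isRootWeight θ) (h.isRootWeight 0)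
          (h.memLp_root θ) (h.memLp_root 0) (h.rootLaw_eq θ)
          ((h.memLp_score.1.mul_const 2⁻¹).const_mul θ)
    _ = 7 * (ENNReal.ofReal M * (‖θ‖ₑ *
          eLpNorm (fun o => (a θ o - a 0 o) / θ - g o * a 0 o / 2) 2 μ) +
        ‖θ‖ₑ * eLpNorm (fun o => (m θ (π o) - m 0 (π o)) * (g o * a 0 o / 2)) 2 μ) := by
        simp only [← hscale, mul_sub, mul_div_cancel₀ _ hθ, mul_left_comm θ]
    _ ≤ 7 * (ENNReal.ofReal M * (‖θ‖ₑ *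
          eLpNorm (fun o => (a θ o - a 0 o) / θ - g o * a 0 o / 2) 2 μ) +
        ‖θ‖ₑ * eLpNorm (fun o => (m θ (π o) - m 0 (π o)) * (g o * a 0 o)) 2 μ) := by
        gcongr
        refine eLpNorm_mono fun o => ?_
        rw [← mul_div_assoc, norm_div, Real.norm_ofNat]
        exact half_le_self (norm_nonneg _)
    _ = _ := by ring

theorem integral_mul_truncated_sq_eq_zero (h : IsReweightedDQM μ π a m M g) {f : Ω → ℝ}
    (hf : ∀ u : E → ℝ, Measurable u → ∀ R, (∀ x, |u x| ≤ R) →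
      ∫ o, u (π o) * (f o * a 0 o ^ 2) ∂μ = 0) (θ : ℝ) :
    ∫ o, f o * (min (m θ (π o)) (2 * m 0 (π o)) * a 0 o) ^ 2 ∂μ = 0 := by
  have hw := (h.isRootWeight θ).min_two_mul (h.isRootWeight 0)
  refine Eq.trans (integral_congr_ae (ae_of_all _ fun o => ?_))
    (hf (fun x => min (m θ x) (2 * m 0 x) ^ 2) (hw.measurable.pow_const 2) (M ^ 2) fun x =>
      (abs_of_nonneg (sq_nonneg _)).trans_le (hw.sq_le x))
  ring

theorem memLp_reweighted (h : IsReweightedDQM μ π a m M g) (θ : ℝ) :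
    MemLp (fun o => m θ (π o) * a θ o) 2 μ :=
  (h.isRootWeight θ).memLp_mul h.measurable_statistic (h.memLp_root θ)

theorem memLp_truncated (h : IsReweightedDQM μ π a m M g) (θ : ℝ) :
    MemLp (fun o => min (m θ (π o)) (2 * m 0 (π o)) * a 0 o) 2 μ :=
  ((h.isRootWeight θ).min_two_mul (h.isRootWeight 0)).memLp_mul h.measurable_statistic
    (h.memLp_root 0)

theorem truncated_zero (h : IsReweightedDQM μ π a m M g) (o : Ω) :
    min (m 0 (π o)) (2 * m 0 (π o)) * a 0 o = m 0 (π o) * a 0 o := by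
  rw [min_eq_left (le_mul_of_one_le_left ((h.isRootWeight 0).nonneg (π o)) one_le_two)]

theorem eLpNorm_mul_truncated_le (h : IsReweightedDQM μ π a m M g) (f : Ω → ℝ) (θ : ℝ) :
    eLpNorm (fun o => f o * (min (m θ (π o)) (2 * m 0 (π o)) * a 0 o)) 2 μ ≤
      2 * eLpNorm (fun o => f o * (m 0 (π o) * a 0 o)) 2 μ := by
  rw [two_mul_eLpNorm]
  refine eLpNorm_mono fun o => ?_
  have hle : |min (m θ (π o)) (2 * m 0 (π o))| ≤ 2 * |m 0 (π o)| := by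
    rw [abs_of_nonneg (((h.isRootWeight θ).min_two_mul (h.isRootWeight 0)).nonneg _),
      abs_of_nonneg ((h.isRootWeight 0).nonneg _)]
    exact min_le_right _ _
  simp only [norm_mul, Real.norm_eq_abs, abs_two]
  calc |f o| * (|min (m θ (π o)) (2 * m 0 (π o))| * |a 0 o|)
      ≤ |f o| * (2 * |m 0 (π o)| * |a 0 o|) := by gcongr
    _ = 2 * (|f o| * (|m 0 (π o)| * |a 0 o|)) := by ring

theorem tendsto_reweighted_add_truncated (h : IsReweightedDQM μ π a m M g) :
    Tendsto (fun θ => eLpNorm (fun o => m θ (π o) * a θ o +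
      min (m θ (π o)) (2 * m 0 (π o)) * a 0 o - 2 * (m 0 (π o) * a 0 o)) 2 μ)
      (𝓝[≠] 0) (𝓝 0) := by
  have hlim := h.tendsto_reweighted.add h.tendsto_truncated
  rw [add_zero] at hlim
  refine tendsto_of_tendsto_of_tendsto_of_le_of_le tendsto_const_nhds hlim
    (fun _ => zero_le) fun θ => (congrArg (eLpNorm · 2 μ) ?_).trans_le
      (eLpNorm_add_le ((h.memLp_reweighted θ).1.sub (h.memLp_reweighted 0).1)
        ((h.memLp_truncated θ).1.sub (h.memLp_reweighted 0).1) one_le_two)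
  ext o
  simp only [Pi.add_apply]
  ring

-- The square of the truncated root is a function of `π` times `a 0 ^ 2`, so that it contributes
-- nothing.
theorem slope_integral_mul_reweighted_sq (h : IsReweightedDQM μ π a m M g) {f : Ω → ℝ}
    (hfc : ∀ θ, MemLp (fun o => f o * (m θ (π o) * a θ o)) 2 μ)
    (hfk : ∀ θ, MemLp (fun o => f o * (min (m θ (π o)) (2 * m 0 (π o)) * a 0 o)) 2 μ)
    (hf : ∀ u : E → ℝ, Measurable u → ∀ R, (∀ x, |u x| ≤ R) →
      ∫ o, u (π o) * (f o * a 0 o ^ 2) ∂μ = 0) (θ : ℝ) :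
    slope (fun θ => ∫ o, f o * (m θ (π o) * a θ o) ^ 2 ∂μ) 0 θ =
      ∫ o, f o * (m θ (π o) * a θ o + min (m θ (π o)) (2 * m 0 (π o)) * a 0 o) *
        ((m θ (π o) * a θ o - min (m θ (π o)) (2 * m 0 (π o)) * a 0 o) / θ) ∂μ := by
  have hzero : ∫ o, f o * (m 0 (π o) * a 0 o) ^ 2 ∂μ = 0 := by
    simpa only [h.truncated_zero] using h.integral_mul_truncated_sq_eq_zero hf 0
  have hint_c := (hfc θ).integrable_mul (h.memLp_reweighted θ)
  have hint_k := (hfk θ).integrable_mul (h.memLp_truncated θ)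
  simp only [Pi.mul_def, mul_assoc (f _), ← sq] at hint_c hint_k
  calc slope (fun θ => ∫ o, f o * (m θ (π o) * a θ o) ^ 2 ∂μ) 0 θ
      = (∫ o, f o * (m θ (π o) * a θ o) ^ 2 ∂μ -
          ∫ o, f o * (min (m θ (π o)) (2 * m 0 (π o)) * a 0 o) ^ 2 ∂μ) / θ := by
        rw [slope_def_field, hzero, h.integral_mul_truncated_sq_eq_zero hf θ, sub_zero θ]
    _ = _ := by
        rw [← integral_sub hint_c hint_k, ← integral_div]
        exact integral_congr_ae (ae_of_all _ fun o => by ring)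

theorem hasDerivAt_integral (h : IsReweightedDQM μ π a m M g) {f : Ω → ℝ} (hfm : Measurable f)
    {K : ℝ≥0} (hK : ∀ θ, eLpNorm (fun o => f o * (m θ (π o) * a θ o)) 2 μ ≤ K)
    (hf : ∀ u : E → ℝ, Measurable u → ∀ R, (∀ x, |u x| ≤ R) →
      ∫ o, u (π o) * (f o * a 0 o ^ 2) ∂μ = 0) :
    HasDerivAt (fun θ => ∫ o, f o * (m θ (π o) * a θ o) ^ 2 ∂μ)
      (∫ o, f o * g o * (m 0 (π o) * a 0 o) ^ 2 ∂μ) 0 := by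
  have hc := h.memLp_reweighted
  have hk := h.memLp_truncated
  have hfk_le (θ : ℝ) :
      eLpNorm (fun o => f o * (min (m θ (π o)) (2 * m 0 (π o)) * a 0 o)) 2 μ ≤ 2 * K :=
    (h.eLpNorm_mul_truncated_le f θ).trans (mul_le_mul_right (hK 0) 2)
  have hfc (θ : ℝ) : MemLp (fun o => f o * (m θ (π o) * a θ o)) 2 μ :=
    ⟨hfm.aestronglyMeasurable.mul (hc θ).1, (hK θ).trans_lt ENNReal.coe_lt_top⟩
  have hfk (θ : ℝ) : MemLp (fun o => f o * (min (m θ (π o)) (2 * m 0 (π o)) * a 0 o)) 2 μ :=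
    ⟨hfm.aestronglyMeasurable.mul (hk θ).1, (hfk_le θ).trans_lt (by finiteness)⟩
  have hsum_le (θ : ℝ) : eLpNorm (fun o => f o * (m θ (π o) * a θ o +
      min (m θ (π o)) (2 * m 0 (π o)) * a 0 o)) 2 μ ≤ (3 * K : ℝ≥0) := by
    simp only [mul_add]
    refine (eLpNorm_add_le (hfc θ).1 (hfk θ).1 one_le_two).trans
      ((add_le_add (hK θ) (hfk_le θ)).trans_eq ?_)
    push_cast
    ring
  have hscore : MemLp (fun o => m 0 (π o) * (g o * a 0 o / 2)) 2 μ :=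
    (h.isRootWeight 0).memLp_mul h.measurable_statistic (h.memLp_score.mul_const 2⁻¹)
  have hlim := tendsto_integral_mul_mul hfm (fun θ => (hc θ).1.add (hk θ).1)
    ((hc 0).1.const_mul 2) (fun θ => ((hc θ).sub (hk θ)).mul_const θ⁻¹) hscore hsum_le
    (by simpa only [h.truncated_zero, ← two_mul] using hsum_le 0)
    h.tendsto_reweighted_add_truncated h.tendsto_reweighted_quotient
  rw [hasDerivAt_iff_tendsto_slope, funext (h.slope_integral_mul_reweighted_sq hfc hfk hf)]
  refine hlim.trans_eq (congrArg 𝓝 (integral_congr_ae (ae_of_all _ fun o => ?_)))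
  ring

end IsReweightedDQM

end ReweightedDQM

section ConditionalLaw

variable {Ω γ β : Type*} [MeasurableSpace Ω] [MeasurableSpace γ] [MeasurableSpace β]

/-- Under `ν`, the kernel `κ` is a conditional law of `V` given `k`. -/
def HasCondLaw (ν : Measure Ω) (k : Ω → γ) (V : Ω → β) (κ : Kernel γ β) : Prop :=
  ∀ F : γ × β → ℝ≥0∞, Measurable F →
    ∫⁻ ω, F (k ω, V ω) ∂ν = ∫⁻ ω, ∫⁻ v, F (k ω, v) ∂κ (k ω) ∂ν

variable {ν : Measure Ω} {k : Ω → γ} {V : Ω → β} {κ : Kernel γ β}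

theorem hasCondLaw_iff_map_eq [SFinite ν] [IsSFiniteKernel κ] (hk : Measurable k)
    (hV : Measurable V) :
    HasCondLaw ν k V κ ↔ ν.map (fun ω => (k ω, V ω)) = ν.map k ⊗ₘ κ := by
  have hmap (F : γ × β → ℝ≥0∞) (hF : Measurable F) :
      ∫⁻ z, F z ∂(ν.map fun ω => (k ω, V ω)) = ∫⁻ ω, F (k ω, V ω) ∂ν :=
    lintegral_map hF (hk.prodMk hV)
  have hcomp (F : γ × β → ℝ≥0∞) (hF : Measurable F) :
      ∫⁻ z, F z ∂(ν.map k ⊗ₘ κ) = ∫⁻ ω, ∫⁻ v, F (k ω, v) ∂κ (k ω) ∂ν := by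
    rw [Measure.lintegral_compProd hF, lintegral_map (by fun_prop) hk]
  refine ⟨fun h => Measure.ext_of_lintegral _ fun F hF => ?_, fun h F hF => ?_⟩
  · rw [hmap F hF, hcomp F hF, h F hF]
  · rw [← hmap F hF, ← hcomp F hF, h]

theorem hasCondLaw_condDistrib [IsFiniteMeasure ν] [StandardBorelSpace β] [Nonempty β]
    (hk : Measurable k) (hV : Measurable V) : HasCondLaw ν k V (condDistrib V k ν) :=
  (hasCondLaw_iff_map_eq hk hV).2 (compProd_map_condDistrib hV.aemeasurable).symm

theorem HasCondLaw.smul (h : HasCondLaw ν k V κ) (c : ℝ≥0∞) : HasCondLaw (c • ν) k V κ :=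
  fun F hF => by rw [lintegral_smul_measure, lintegral_smul_measure, h F hF]

theorem hasCondLaw_smul_iff {c : ℝ≥0∞} (hc0 : c ≠ 0) (hc : c ≠ ∞) :
    HasCondLaw (c • ν) k V κ ↔ HasCondLaw ν k V κ := by
  refine ⟨fun h => ?_, fun h => h.smul c⟩
  have hinv := h.smul c⁻¹
  rwa [smul_smul, ENNReal.inv_mul_cancel hc0 hc, one_smul] at hinv

theorem exists_lintegral_mul_eq {ι : Type*} {ν : ι → Measure Ω} [IsSFiniteKernel κ]
    (h : ∀ i, HasCondLaw (ν i) k V κ) {G : γ × β → ℝ≥0∞} (hG : Measurable G) :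
    ∃ φ : γ → ℝ≥0∞, Measurable φ ∧ ∀ (i : ι) (u : γ → ℝ≥0∞), Measurable u →
      ∫⁻ ω, u (k ω) * G (k ω, V ω) ∂ν i = ∫⁻ ω, u (k ω) * φ (k ω) ∂ν i := by
  refine ⟨fun c => ∫⁻ v, G (c, v) ∂κ c, hG.lintegral_kernel_prod_right', fun i u hu => ?_⟩
  rw [h i (fun z => u z.1 * G z) (by fun_prop)]
  exact lintegral_congr fun ω =>
    lintegral_const_mul (u (k ω)) (f := fun v => G (k ω, v)) (by fun_prop)

theorem hasCondLaw_prodMkRight_bool_iff {R : Ω → Bool} (hR : Measurable R) :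
    HasCondLaw ν (fun ω => (k ω, R ω)) V (κ.prodMkRight Bool) ↔
      ∀ ℓ, HasCondLaw (ν.restrict (R ⁻¹' {ℓ})) k V κ := by
  have hmeas (ℓ : Bool) : MeasurableSet (R ⁻¹' {ℓ}) := hR (measurableSet_singleton ℓ)
  refine ⟨fun h ℓ F hF => ?_, fun h F hF => ?_⟩
  · have hℓ := h (fun z => (Prod.snd ⁻¹' {ℓ} : Set (γ × Bool)).indicator 1 z.1 * F (z.1.1, z.2))
      (((measurable_one.indicator (measurable_snd (measurableSet_singleton ℓ))).comp
        measurable_fst).mul (by fun_prop))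
    rw [← lintegral_indicator (hmeas ℓ), ← lintegral_indicator (hmeas ℓ)]
    refine Eq.trans (lintegral_congr fun ω => ?_) (hℓ.trans (lintegral_congr fun ω => ?_))
    · by_cases hω : R ω = ℓ <;> simp [Set.indicator, hω]
    · by_cases hω : R ω = ℓ <;> simp [Set.indicator, hω]
  · have hcompl : (R ⁻¹' {true})ᶜ = R ⁻¹' {false} := by
      ext ω
      simp
    have hℓ (ℓ : Bool) : ∫⁻ ω in R ⁻¹' {ℓ}, F ((k ω, R ω), V ω) ∂ν =
        ∫⁻ ω in R ⁻¹' {ℓ}, ∫⁻ v, F ((k ω, R ω), v) ∂(κ.prodMkRight Bool) (k ω, R ω) ∂ν := by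
      refine Eq.trans (setLIntegral_congr_fun (hmeas ℓ) ?_)
        ((h ℓ (fun z => F ((z.1, ℓ), z.2)) (by fun_prop)).trans
          (setLIntegral_congr_fun (hmeas ℓ) ?_))
      · rintro ω rfl
        rfl
      · rintro ω rfl
        rfl
    rw [← lintegral_add_compl _ (hmeas true), hcompl, hℓ, hℓ, ← hcompl,
      lintegral_add_compl _ (hmeas true)]

theorem HasCondLaw.condDistrib_ae_eq [IsFiniteMeasure ν] [StandardBorelSpace β]
    [Nonempty β] [IsFiniteKernel κ] (hk : Measurable k) (hV : Measurable V)
    (h : HasCondLaw ν k V κ) : condDistrib V k ν =ᵐ[ν.map k] κ :=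
  condDistrib_ae_eq_of_measure_eq_compProd k hV.aemeasurable ((hasCondLaw_iff_map_eq hk hV).1 h)

variable [StandardBorelSpace Ω] [StandardBorelSpace β] [Nonempty β]

theorem hasCondLaw_of_condIndepFun {β' : Type*} [MeasurableSpace β'] [StandardBorelSpace β']
    [Nonempty β'] [IsFiniteMeasure ν] {U : Ω → β'} (hk : Measurable k) (hU : Measurable U)
    (hV : Measurable V)
    (h : CondIndepFun (MeasurableSpace.comap k inferInstance) hk.comap_le U V ν) :
    HasCondLaw ν (fun ω => (k ω, U ω)) V ((condDistrib V k ν).prodMkRight β') := by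
  rw [condIndepFun_iff_condDistrib_prod_ae_eq_prodMkRight hV hU hk,
    condDistrib_ae_eq_iff_measure_eq_compProd _ hV.aemeasurable] at h
  exact (hasCondLaw_iff_map_eq (hk.prodMk hU) hV).2 h

theorem condIndepFun_of_hasCondLaw {β' : Type*} [MeasurableSpace β'] [StandardBorelSpace β']
    [Nonempty β'] [IsFiniteMeasure ν] {U : Ω → β'} (hk : Measurable k) (hU : Measurable U)
    (hV : Measurable V) [IsMarkovKernel κ]
    (h : HasCondLaw ν (fun ω => (k ω, U ω)) V (κ.prodMkRight β')) :
    CondIndepFun (MeasurableSpace.comap k inferInstance) hk.comap_le U V ν := by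
  have hV_k : HasCondLaw ν k V κ := fun F hF => h (fun z => F (z.1.1, z.2)) (by fun_prop)
  have hfst : Measure.QuasiMeasurePreserving Prod.fst (ν.map fun ω => (k ω, U ω)) (ν.map k) := by
    refine ⟨measurable_fst, ?_⟩
    rw [Measure.map_map measurable_fst (hk.prodMk hU)]
    exact Measure.AbsolutelyContinuous.rfl
  rw [condIndepFun_iff_condDistrib_prod_ae_eq_prodMkRight hV hU hk]
  filter_upwards [h.condDistrib_ae_eq (hk.prodMk hU) hV, hfst.ae (hV_k.condDistrib_ae_eq hk hV)]
    with z hz hz_fst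
  rw [hz, Kernel.prodMkRight_apply, Kernel.prodMkRight_apply, hz_fst]

theorem condIndepFun_bool_iff [IsFiniteMeasure ν] {R : Ω → Bool} (hk : Measurable k)
    (hR : Measurable R) (hV : Measurable V) {c : Bool → ℝ≥0∞} {ν' : Bool → Measure Ω}
    (hν : ∀ ℓ, ν.restrict (R ⁻¹' {ℓ}) = c ℓ • ν' ℓ) (hc : ∀ ℓ, (c ℓ ≠ 0 ∧ c ℓ ≠ ∞) ∨ ν' ℓ = 0) :
    CondIndepFun (MeasurableSpace.comap k inferInstance) hk.comap_le R V ν ↔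
      ∃ κ : Kernel γ β, IsMarkovKernel κ ∧ ∀ ℓ, HasCondLaw (ν' ℓ) k V κ := by
  have hrestrict (κ : Kernel γ β) : (∀ ℓ, HasCondLaw (ν' ℓ) k V κ) ↔
      HasCondLaw ν (fun ω => (k ω, R ω)) V (κ.prodMkRight Bool) := by
    rw [hasCondLaw_prodMkRight_bool_iff hR]
    refine forall_congr' fun ℓ => ?_
    rw [hν]
    rcases hc ℓ with hc_ℓ | hzero
    · rw [hasCondLaw_smul_iff hc_ℓ.1 hc_ℓ.2]
    · simp only [hzero, smul_zero]
  refine ⟨fun h => ⟨condDistrib V k ν, inferInstance,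
    (hrestrict _).2 (hasCondLaw_of_condIndepFun hk hR hV h)⟩, ?_⟩
  rintro ⟨κ, _, h⟩
  exact condIndepFun_of_hasCondLaw hk hR hV ((hrestrict κ).1 h)

end ConditionalLaw

section CondMean

variable {Ω γ β : Type*} [MeasurableSpace Ω] [MeasurableSpace γ] [MeasurableSpace β]
  {ν : Measure Ω} {k : Ω → γ} {V : Ω → β} {κ : Kernel γ β}

theorem HasCondLaw.of_comp {Ω' : Type*} [MeasurableSpace Ω'] {φ : Ω → Ω'} {k : Ω' → γ}
    {V : Ω' → β} [IsSFiniteKernel κ] (hφ : Measurable φ) (hk : Measurable k) (hV : Measurable V)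
    (h : HasCondLaw ν (fun ω => k (φ ω)) (fun ω => V (φ ω)) κ) : HasCondLaw (ν.map φ) k V κ := by
  intro F hF
  rw [lintegral_map (by fun_prop) hφ,
    lintegral_map (f := fun ω => ∫⁻ v, F (k ω, v) ∂κ (k ω))
      (hF.lintegral_kernel_prod_right'.comp hk) hφ]
  exact h F hF

theorem HasCondLaw.withDensity [IsSFiniteKernel κ] (h : HasCondLaw ν k V κ) (hk : Measurable k)
    (hV : Measurable V) {u : γ → ℝ≥0∞} (hu : Measurable u) :
    HasCondLaw (ν.withDensity fun ω => u (k ω)) k V κ := by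
  intro F hF
  rw [lintegral_withDensity_eq_lintegral_mul _ (by fun_prop) (by fun_prop),
    lintegral_withDensity_eq_lintegral_mul _ (by fun_prop)
      (g := fun ω => ∫⁻ v, F (k ω, v) ∂κ (k ω)) (hF.lintegral_kernel_prod_right'.comp hk)]
  refine (h (fun z => u z.1 * F z) (by fun_prop)).trans (lintegral_congr fun ω => ?_)
  exact lintegral_const_mul (u (k ω)) (f := fun v => F (k ω, v)) (by fun_prop)

/-- The conditional mean of `f (k, V)` given `k = c` when `V` has the conditional law `κ` given
`k`. -/
def condMean (κ : Kernel γ β) (f : γ × β → ℝ) (c : γ) : ℝ := ∫ v, f (c, v) ∂κ c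

theorem measurable_condMean [IsSFiniteKernel κ] {f : γ × β → ℝ} (hf : Measurable f) :
    Measurable (condMean κ f) :=
  hf.stronglyMeasurable.integral_kernel_prod_right'.measurable

theorem abs_condMean_le [IsMarkovKernel κ] {f : γ × β → ℝ} {M : ℝ} (hf : ∀ z, |f z| ≤ M) (c : γ) :
    |condMean κ f c| ≤ M := by
  have hbound := norm_integral_le_of_norm_le_const (μ := κ c) (f := fun v => f (c, v))
    (ae_of_all _ fun v => hf (c, v))
  rwa [probReal_univ, mul_one] at hbound

theorem integrable_of_abs_le [IsFiniteKernel κ] {f : γ × β → ℝ} (hf : Measurable f) {M : ℝ}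
    (hM : ∀ z, |f z| ≤ M) (c : γ) : Integrable (fun v => f (c, v)) (κ c) :=
  .of_bound (C := M) (Measurable.aestronglyMeasurable (by fun_prop))
    (ae_of_all _ fun v => hM (c, v))

theorem condMean_sub_condMean [IsMarkovKernel κ] {f : γ × β → ℝ} {c : γ}
    (hf : Integrable (fun v => f (c, v)) (κ c)) :
    condMean κ (fun z => f z - condMean κ f z.1) c = 0 := by
  simp only [condMean]
  rw [integral_sub hf (integrable_const _), integral_const, probReal_univ, one_smul, sub_self]

theorem HasCondLaw.ae_integrable [IsSFiniteKernel κ] (h : HasCondLaw ν k V κ) (hk : Measurable k)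
    {f : γ × β → ℝ} (hf : Measurable f) (hi : Integrable (fun ω => f (k ω, V ω)) ν) :
    ∀ᵐ ω ∂ν, Integrable (fun v => f (k ω, v)) (κ (k ω)) := by
  have hfinite := hi.2
  rw [HasFiniteIntegral, h (fun z => ‖f z‖ₑ) hf.enorm] at hfinite
  filter_upwards [ae_lt_top (hf.enorm.lintegral_kernel_prod_right'.comp hk) hfinite.ne] with ω hω
  exact ⟨Measurable.aestronglyMeasurable (by fun_prop), hω⟩

theorem HasCondLaw.integrable_condMean [IsSFiniteKernel κ] (h : HasCondLaw ν k V κ)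
    (hk : Measurable k) {f : γ × β → ℝ} (hf : Measurable f)
    (hi : Integrable (fun ω => f (k ω, V ω)) ν) :
    Integrable (fun ω => condMean κ f (k ω)) ν := by
  refine ⟨((measurable_condMean hf).comp hk).aestronglyMeasurable, ?_⟩
  refine lt_of_le_of_lt (lintegral_mono fun ω => enorm_integral_le_lintegral_enorm _) ?_
  rw [← h (fun z => ‖f z‖ₑ) hf.enorm]
  exact hi.2

theorem HasCondLaw.integral_eq_integral_condMean [SFinite ν] [IsSFiniteKernel κ]
    (h : HasCondLaw ν k V κ) (hk : Measurable k) (hV : Measurable V) {f : γ × β → ℝ}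
    (hf : Measurable f) (hi : Integrable (fun ω => f (k ω, V ω)) ν) :
    ∫ ω, f (k ω, V ω) ∂ν = ∫ ω, condMean κ f (k ω) ∂ν := by
  have hmap := (hasCondLaw_iff_map_eq hk hV).1 h
  have hint : Integrable f (ν.map k ⊗ₘ κ) := by
    rw [← hmap]
    exact (integrable_map_measure hf.aestronglyMeasurable (hk.prodMk hV).aemeasurable).2 hi
  calc ∫ ω, f (k ω, V ω) ∂ν = ∫ z, f z ∂(ν.map fun ω => (k ω, V ω)) :=
        (integral_map (hk.prodMk hV).aemeasurable hf.aestronglyMeasurable).symm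
    _ = ∫ c, condMean κ f c ∂(ν.map k) := by
        rw [hmap, Measure.integral_compProd hint]
        rfl
    _ = ∫ ω, condMean κ f (k ω) ∂ν :=
        integral_map hk.aemeasurable (measurable_condMean hf).aestronglyMeasurable

theorem ofReal_integral_sq_le {m : Measure β} [IsProbabilityMeasure m] {f : β → ℝ}
    (hf : AEStronglyMeasurable f m) :
    ENNReal.ofReal ((∫ y, f y ∂m) ^ 2) ≤ ∫⁻ y, ENNReal.ofReal (f y ^ 2) ∂m := by
  have hCS := enorm_integral_mul_le hf (aestronglyMeasurable_const (b := (1 : ℝ)))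
  rw [eLpNorm_const (1 : ℝ) two_ne_zero (IsProbabilityMeasure.ne_zero m), measure_univ,
    ENNReal.one_rpow, mul_one, enorm_one, mul_one, eLpNorm_two_eq] at hCS
  simp only [mul_one] at hCS
  rw [← sq_abs, ENNReal.ofReal_pow (abs_nonneg _), ← Real.enorm_eq_ofReal_abs]
  refine (pow_le_pow_left' hCS 2).trans_eq ?_
  rw [← ENNReal.rpow_natCast, ← ENNReal.rpow_mul, Nat.cast_ofNat, one_div,
    inv_mul_cancel₀ two_ne_zero, ENNReal.rpow_one]

theorem HasCondLaw.eLpNorm_condMean_le [IsMarkovKernel κ] (h : HasCondLaw ν k V κ)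
    {f : γ × β → ℝ} (hf : Measurable f) :
    eLpNorm (fun ω => condMean κ f (k ω)) 2 ν ≤ eLpNorm (fun ω => f (k ω, V ω)) 2 ν := by
  rw [eLpNorm_two_eq, eLpNorm_two_eq, h (fun z => ENNReal.ofReal (f z ^ 2)) (by fun_prop)]
  refine ENNReal.rpow_le_rpow (lintegral_mono fun ω => ?_) (by norm_num)
  exact ofReal_integral_sq_le (Measurable.aestronglyMeasurable (by fun_prop))

theorem HasCondLaw.eLpNorm_sub_condMean_sub_le [IsMarkovKernel κ]
    (h : HasCondLaw ν k V κ) (hk : Measurable k) (hV : Measurable V) {f g : γ × β → ℝ}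
    (hf : Measurable f) (hg : Measurable g) (hfi : Integrable (fun ω => f (k ω, V ω)) ν)
    (hgi : Integrable (fun ω => g (k ω, V ω)) ν) (hzero : ∀ᵐ ω ∂ν, condMean κ f (k ω) = 0) :
    eLpNorm (fun ω => g (k ω, V ω) - condMean κ g (k ω) - f (k ω, V ω)) 2 ν ≤
      2 * eLpNorm (fun ω => f (k ω, V ω) - g (k ω, V ω)) 2 ν := by
  let r : γ × β → ℝ := fun z => f z - g z
  have hr : Measurable r := hf.sub hg
  have hmean : (fun ω => g (k ω, V ω) - condMean κ g (k ω) - f (k ω, V ω)) =ᵐ[ν]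
      -((fun ω => r (k ω, V ω)) - fun ω => condMean κ r (k ω)) := by
    filter_upwards [hzero, h.ae_integrable hk hf hfi, h.ae_integrable hk hg hgi]
      with ω hω hf_int hg_int
    have hsub : condMean κ r (k ω) = condMean κ f (k ω) - condMean κ g (k ω) :=
      integral_sub hf_int hg_int
    simp only [Pi.neg_apply, Pi.sub_apply, hsub, hω, r]
    ring
  rw [eLpNorm_congr_ae hmean, eLpNorm_neg, two_mul]
  exact (eLpNorm_sub_le (Measurable.aestronglyMeasurable (by fun_prop))
    ((measurable_condMean hr).comp hk).aestronglyMeasurable one_le_two).trans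
    (add_le_add_right (h.eLpNorm_condMean_le hr) _)

theorem HasCondLaw.exists_tendsto_of_condMean_eq_zero [IsFiniteMeasure ν] [IsMarkovKernel κ]
    (h : HasCondLaw ν k V κ) (hk : Measurable k) (hV : Measurable V) {f : γ × β → ℝ}
    (hf : Measurable f) (hL : MemLp (fun ω => f (k ω, V ω)) 2 ν)
    (hzero : ∀ᵐ ω ∂ν, condMean κ f (k ω) = 0) :
    ∃ F : ℕ → γ × β → ℝ, (∀ n, Measurable (F n)) ∧ (∀ n z, |F n z| ≤ n + n) ∧
      (∀ n c, condMean κ (F n) c = 0) ∧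
      Tendsto (fun n => eLpNorm (fun ω => F n (k ω, V ω) - f (k ω, V ω)) 2 ν) atTop (𝓝 0) := by
  let tail (n : ℕ) : γ × β → ℝ := {z | (n : ℝ) < |f z|}.indicator f
  let head (n : ℕ) : γ × β → ℝ := fun z => f z - tail n z
  have hhead (n : ℕ) : Measurable (head n) :=
    hf.sub (hf.indicator (measurableSet_lt measurable_const hf.abs))
  have hhead_le (n : ℕ) (z : γ × β) : |head n z| ≤ n := by
    by_cases hz : (n : ℝ) < |f z|
    · simp only [head, tail, Set.indicator, Set.mem_ofPred_eq, if_pos hz, sub_self, abs_zero]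
      exact n.cast_nonneg
    · simp only [head, tail, Set.indicator, Set.mem_ofPred_eq, if_neg hz, sub_zero]
      exact not_lt.1 hz
  refine ⟨fun n z => head n z - condMean κ (head n) z.1,
    fun n => (hhead n).sub ((measurable_condMean (hhead n)).comp measurable_fst),
    fun n z => (abs_sub _ _).trans (add_le_add (hhead_le n z) (abs_condMean_le (hhead_le n) z.1)),
    fun n c => condMean_sub_condMean (integrable_of_abs_le (hhead n) (hhead_le n) c), ?_⟩
  have htail : Tendsto (fun n => 2 * eLpNorm (fun ω => tail n (k ω, V ω)) 2 ν) atTop (𝓝 0) := by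
    have hlim := ENNReal.Tendsto.const_mul (tendsto_eLpNorm_indicator_natCast_lt
      (f := fun ω => f (k ω, V ω)) (by fun_prop) ENNReal.ofNat_ne_top hL)
      (Or.inr (ENNReal.ofNat_ne_top (n := 2)))
    rwa [mul_zero] at hlim
  refine tendsto_of_tendsto_of_tendsto_of_le_of_le tendsto_const_nhds htail
    (fun _ => zero_le) fun n => ?_
  have hbound := h.eLpNorm_sub_condMean_sub_le hk hV hf (hhead n) (hL.integrable one_le_two)
    (.of_bound (C := n) (Measurable.aestronglyMeasurable (by fun_prop))
      (ae_of_all _ fun ω => hhead_le n _)) hzero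
  simpa only [head, sub_sub_cancel] using hbound

end CondMean

section PopulationLabels

variable {𝒳 𝒮 : Type*} [MeasurableSpace 𝒳] [MeasurableSpace 𝒮]

namespace Population

/-- The probability of the label `ℓ` when `R = 1` has probability `ρ`. -/
def weight (ρ : unitInterval) (ℓ : Bool) : ℝ≥0∞ :=
  if ℓ then (unitInterval.toNNReal ρ : ℝ≥0∞) else unitInterval.toNNReal (unitInterval.symm ρ)

theorem mix_eq (p : Population 𝒳 𝒮) (ρ : unitInterval) :
    p.mix ρ = weight ρ true • p.given true + weight ρ false • p.given false := rfl

theorem weight_ne_top (ρ : unitInterval) (ℓ : Bool) : weight ρ ℓ ≠ ∞ := by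
  cases ℓ <;> simp [weight]

theorem weight_ne_zero {ρ : unitInterval} (h0 : 0 < ρ) (h1 : ρ < 1) (ℓ : Bool) :
    weight ρ ℓ ≠ 0 := by
  have htoNNReal {x : unitInterval} (hx : 0 < x) : (unitInterval.toNNReal x : ℝ≥0∞) ≠ 0 :=
    ENNReal.coe_ne_zero.2 fun h => hx.ne' (Subtype.ext (congrArg NNReal.toReal h))
  cases ℓ
  · exact htoNNReal (unitInterval.pos_iff_ne_zero.2 (by simpa using h1.ne))
  · exact htoNNReal h0

theorem given_label_ae (p : Population 𝒳 𝒮) (ℓ : Bool) : ∀ᵐ w ∂p.given ℓ, R w = ℓ := by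
  have hmap : p.given ℓ = (p.law ℓ : Measure (Unlabelled 𝒳 𝒮)).map fun u => (u, ℓ) := by
    rw [given, Measure.prod_dirac]
  rw [hmap]
  exact (ae_map_iff (by fun_prop) (measurable_R (measurableSet_singleton ℓ))).2
    (ae_of_all _ fun _ => rfl)

theorem given_restrict_label (p : Population 𝒳 𝒮) (ℓ : Bool) :
    (p.given ℓ).restrict (R ⁻¹' {ℓ}) = p.given ℓ :=
  Measure.restrict_eq_self_of_ae_mem (p.given_label_ae ℓ)

theorem given_restrict_label_of_ne (p : Population 𝒳 𝒮) {ℓ ℓ' : Bool} (h : ℓ ≠ ℓ') :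
    (p.given ℓ).restrict (R ⁻¹' {ℓ'}) = 0 := by
  rw [Measure.restrict_eq_zero]
  refine measure_mono_null (fun w hw => ?_) (ae_iff.1 (p.given_label_ae ℓ))
  exact fun hR => h (hR.symm.trans hw)

theorem mix_restrict_label (p : Population 𝒳 𝒮) (ρ : unitInterval) (ℓ : Bool) :
    (p.mix ρ).restrict (R ⁻¹' {ℓ}) = weight ρ ℓ • p.given ℓ := by
  rw [mix_eq, Measure.restrict_add, Measure.restrict_smul, Measure.restrict_smul]
  cases ℓ
  · rw [given_restrict_label, given_restrict_label_of_ne p (by decide), smul_zero, zero_add]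
  · rw [given_restrict_label, given_restrict_label_of_ne p (by decide), smul_zero, add_zero]

theorem lintegral_P (p : Population 𝒳 𝒮) (G : Full 𝒳 𝒮 → ℝ≥0∞) :
    ∫⁻ w, G w ∂p.P = weight p.labelProb true * ∫⁻ w, G w ∂p.given true +
      weight p.labelProb false * ∫⁻ w, G w ∂p.given false := by
  rw [P, mix_eq, lintegral_add_measure, lintegral_smul_measure, lintegral_smul_measure,
    smul_eq_mul, smul_eq_mul]

theorem nonempty_surrogate (p : Population 𝒳 𝒮) : Nonempty 𝒮 := by
  have : Nonempty (Unlabelled 𝒳 𝒮) :=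
    nonempty_of_isProbabilityMeasure (p.law true : Measure (Unlabelled 𝒳 𝒮))
  exact ⟨this.some.2.2.1 true⟩

instance (p : Population 𝒳 𝒮) : IsProbabilityMeasure p.lawX :=
  Measure.isProbabilityMeasure_map measurable_X.aemeasurable

instance (p : Population 𝒳 𝒮) : IsProbabilityMeasure p.lawXLabelled :=
  Measure.isProbabilityMeasure_map measurable_X.aemeasurable

end Population

theorem setLIntegral_treatment_eq (m : Measure (Full 𝒳 𝒮)) (a : Bool) (G : Full 𝒳 𝒮 → ℝ≥0∞) :
    ∫⁻ w in T ⁻¹' {a}, G w ∂m = ∫⁻ w, (if T w = a then 1 else 0) * G w ∂m := by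
  rw [← lintegral_indicator (measurable_T (measurableSet_singleton a))]
  refine lintegral_congr fun w => ?_
  by_cases h : T w = a <;> simp [Set.indicator, h]

theorem setLIntegral_treatment_add (m : Measure (Full 𝒳 𝒮)) (G : Full 𝒳 𝒮 → ℝ≥0∞) :
    ∫⁻ w in T ⁻¹' {true}, G w ∂m + ∫⁻ w in T ⁻¹' {false}, G w ∂m = ∫⁻ w, G w ∂m := by
  have hcompl : (T ⁻¹' {false} : Set (Full 𝒳 𝒮)) = (T ⁻¹' {true})ᶜ := by
    ext w
    simp
  rw [hcompl, lintegral_add_compl _ (measurable_T (measurableSet_singleton true))]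

theorem measurable_ite_bool {α : Type*} [MeasurableSpace α] (a : Bool) {t : α → Bool}
    (ht : Measurable t) : Measurable fun z => if t z = a then (1 : ℝ≥0∞) else 0 :=
  Measurable.ite (ht (measurableSet_singleton a)) measurable_const measurable_const

variable [StandardBorelSpace 𝒳] [StandardBorelSpace 𝒮]

namespace Population

section LabelIndependence

variable {γ β : Type*} [MeasurableSpace γ] [MeasurableSpace β] [StandardBorelSpace β] [Nonempty β]

theorem condIndepFun_label_mix_iff (p : Population 𝒳 𝒮) {ρ : unitInterval} (h0 : 0 < ρ)
    (h1 : ρ < 1) {k : Full 𝒳 𝒮 → γ} {V : Full 𝒳 𝒮 → β} (hk : Measurable k) (hV : Measurable V) :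
    CondIndepFun (MeasurableSpace.comap k inferInstance) hk.comap_le R V (p.mix ρ) ↔
      ∃ κ : Kernel γ β, IsMarkovKernel κ ∧ ∀ ℓ, HasCondLaw (p.given ℓ) k V κ :=
  condIndepFun_bool_iff hk measurable_R hV (mix_restrict_label p ρ)
    fun ℓ => Or.inl ⟨weight_ne_zero h0 h1 ℓ, weight_ne_top ρ ℓ⟩

theorem condIndepFun_label_cond_iff (p : Population 𝒳 𝒮) {ρ : unitInterval} (h0 : 0 < ρ)
    (h1 : ρ < 1) {k : Full 𝒳 𝒮 → γ} {V : Full 𝒳 𝒮 → β} (hk : Measurable k) (hV : Measurable V)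
    (s : Set (Full 𝒳 𝒮)) :
    CondIndepFun (MeasurableSpace.comap k inferInstance) hk.comap_le R V (cond (p.mix ρ) s) ↔
      ∃ κ : Kernel γ β, IsMarkovKernel κ ∧ ∀ ℓ, HasCondLaw ((p.given ℓ).restrict s) k V κ := by
  refine condIndepFun_bool_iff hk measurable_R hV
    (c := fun ℓ => (p.mix ρ s)⁻¹ * weight ρ ℓ) (fun ℓ => ?_) fun ℓ => ?_
  · rw [ProbabilityTheory.cond, Measure.restrict_smul,
      Measure.restrict_comm (measurable_R (measurableSet_singleton ℓ)), mix_restrict_label,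
      Measure.restrict_smul, smul_smul]
  · by_cases hs : p.mix ρ s = 0
    · right
      rw [Measure.restrict_eq_zero]
      simp only [mix_eq, Measure.add_apply, Measure.smul_apply, smul_eq_mul, add_eq_zero,
        mul_eq_zero, weight_ne_zero h0 h1, false_or] at hs
      cases ℓ
      · exact hs.2
      · exact hs.1
    · left
      exact ⟨mul_ne_zero (ENNReal.inv_ne_zero.2 (measure_ne_top _ _)) (weight_ne_zero h0 h1 ℓ),
        ENNReal.mul_ne_top (ENNReal.inv_ne_top.2 hs) (weight_ne_top ρ ℓ)⟩

end LabelIndependence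

variable {ε : ℝ} {C : ℝ≥0} {p : Population 𝒳 𝒮}

/- Integrate out `Y(a)`, then `S(a)`, then `T`: each of the three conditional laws is the same for
both labels. -/
theorem exists_setLIntegral_arm_eq (hp : Assumptions ε C p) (a : Bool)
    {G : (𝒳 × 𝒮) × ℝ → ℝ≥0∞} (hG : Measurable G) :
    ∃ φ : 𝒳 → ℝ≥0∞, Measurable φ ∧ ∀ (ℓ : Bool) (u : 𝒳 → ℝ≥0∞), Measurable u →
      ∫⁻ w in T ⁻¹' {a}, u (X w) * G ((X w, Spot a w), Ypot a w) ∂p.given ℓ =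
        ∫⁻ w, u (X w) * φ (X w) ∂p.given ℓ := by
  have := p.nonempty_surrogate
  obtain ⟨ρY, hρY0, hρY1, hY⟩ := hp.missing_at_random a
  obtain ⟨ρS, hρS0, hρS1, hS⟩ := hp.label_surrogate a
  obtain ⟨ρT, hρT0, hρT1, hT⟩ := hp.label_treatment
  obtain ⟨κY, _, hκY⟩ := (p.condIndepFun_label_cond_iff hρY0 hρY1
    (measurable_X.prodMk (measurable_Spot a)) (measurable_Ypot a) _).1 hY
  obtain ⟨κS, _, hκS⟩ := (p.condIndepFun_label_mix_iff hρS0 hρS1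
    (measurable_T.prodMk measurable_X) (measurable_Spot a)).1 hS
  obtain ⟨κT, _, hκT⟩ :=
    (p.condIndepFun_label_mix_iff hρT0 hρT1 measurable_X measurable_T).1 hT
  obtain ⟨H, hH, hH_eq⟩ := exists_lintegral_mul_eq hκY hG
  obtain ⟨J, hJ, hJ_eq⟩ := exists_lintegral_mul_eq hκS
    (G := fun z => (if z.1.1 = a then 1 else 0) * H (z.1.2, z.2))
    ((measurable_ite_bool a (by fun_prop)).mul (by fun_prop))
  obtain ⟨φ, hφ, hφ_eq⟩ := exists_lintegral_mul_eq hκT (G := fun z => J (z.2, z.1)) (by fun_prop)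
  refine ⟨φ, hφ, fun ℓ u hu => ?_⟩
  calc ∫⁻ w in T ⁻¹' {a}, u (X w) * G ((X w, Spot a w), Ypot a w) ∂p.given ℓ
      = ∫⁻ w in T ⁻¹' {a}, u (X w) * H (X w, Spot a w) ∂p.given ℓ :=
        hH_eq ℓ (fun z => u z.1) (by fun_prop)
    _ = ∫⁻ w, u (X w) * ((if T w = a then 1 else 0) * H (X w, Spot a w)) ∂p.given ℓ := by
        rw [setLIntegral_treatment_eq]
        exact lintegral_congr fun w => mul_left_comm _ _ _
    _ = ∫⁻ w, u (X w) * J (T w, X w) ∂p.given ℓ := hJ_eq ℓ (fun z => u z.2) (by fun_prop)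
    _ = ∫⁻ w, u (X w) * φ (X w) ∂p.given ℓ := hφ_eq ℓ u hu

theorem exists_lintegral_obs_eq (hp : Assumptions ε C p) {G : Obs 𝒳 𝒮 → ℝ≥0∞}
    (hG : Measurable G) :
    ∃ φ : 𝒳 → ℝ≥0∞, Measurable φ ∧ ∀ (ℓ : Bool) (u : 𝒳 → ℝ≥0∞), Measurable u →
      ∫⁻ w, u (X w) * G (obs w) ∂p.given ℓ = ∫⁻ w, u (X w) * φ (X w) ∂p.given ℓ := by
  choose φ hφ hφ_eq using fun a => exists_setLIntegral_arm_eq hp a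
    (G := fun z => G (z.1.1, a, z.1.2, z.2)) (by fun_prop)
  refine ⟨fun x => φ true x + φ false x, (hφ true).add (hφ false), fun ℓ u hu => ?_⟩
  have harm (a : Bool) : ∫⁻ w in T ⁻¹' {a}, u (X w) * G (obs w) ∂p.given ℓ =
      ∫⁻ w, u (X w) * φ a (X w) ∂p.given ℓ := by
    rw [← hφ_eq a ℓ u hu]
    refine setLIntegral_congr_fun (measurable_T (measurableSet_singleton a)) ?_
    rintro w rfl
    rfl
  have hmeas : Measurable fun w : Full 𝒳 𝒮 => u (X w) * φ true (X w) :=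
    (hu.mul (hφ true)).comp measurable_X
  rw [← setLIntegral_treatment_add, harm, harm, ← lintegral_add_left hmeas]
  exact lintegral_congr fun w => (mul_add _ _ _).symm

theorem map_obs_P (hp : Assumptions ε C p) :
    p.P.map obs = p.Q.withDensity fun o => p.lawX.rnDeriv p.lawXLabelled o.1 := by
  refine Measure.ext_of_lintegral _ fun G hG => ?_
  obtain ⟨φ, hφ, hφ_eq⟩ := exists_lintegral_obs_eq hp hG
  have hr : Measurable (p.lawX.rnDeriv p.lawXLabelled) := Measure.measurable_rnDeriv _ _
  have hφ_one (ℓ : Bool) : ∫⁻ w, G (obs w) ∂p.given ℓ = ∫⁻ w, φ (X w) ∂p.given ℓ := by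
    simpa only [one_mul] using hφ_eq ℓ (fun _ => 1) measurable_const
  calc ∫⁻ o, G o ∂p.P.map obs = ∫⁻ w, φ (X w) ∂p.P := by
        rw [lintegral_map hG measurable_obs, lintegral_P, lintegral_P, hφ_one, hφ_one]
    _ = ∫⁻ x, φ x ∂p.lawX := by rw [lawX, lintegral_map hφ measurable_X]
    _ = ∫⁻ x, p.lawX.rnDeriv p.lawXLabelled x * φ x ∂p.lawXLabelled :=
        (lintegral_rnDeriv_mul hp.absolutelyContinuous hφ.aemeasurable).symm
    _ = ∫⁻ w, p.lawX.rnDeriv p.lawXLabelled (X w) * φ (X w) ∂p.given true :=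
        lintegral_map (hr.mul hφ) measurable_X
    _ = ∫⁻ w, p.lawX.rnDeriv p.lawXLabelled (X w) * G (obs w) ∂p.given true :=
        (hφ_eq true _ hr).symm
    _ = ∫⁻ o, p.lawX.rnDeriv p.lawXLabelled o.1 * G o ∂p.Q :=
        (lintegral_map (f := fun o : Obs 𝒳 𝒮 => p.lawX.rnDeriv p.lawXLabelled o.1 * G o)
          (by fun_prop) measurable_obs).symm
    _ = _ := (lintegral_withDensity_eq_lintegral_mul _ (by fun_prop) hG).symm

end Population

end PopulationLabels

section InversePropensityWeighting

attribute [local fun_prop] measurable_X measurable_T measurable_Spot measurable_Ypot measurable_S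
  measurable_Y measurable_obs

variable {𝒳 𝒮 : Type*} [MeasurableSpace 𝒳] [MeasurableSpace 𝒮]

theorem measurable_XTS : Measurable fun w : Full 𝒳 𝒮 => (X w, T w, S w) := by
  fun_prop

namespace Population

/-- The density ratio truncated at its essential bound, so that it is bounded everywhere. -/
def clippedRatio (p : Population 𝒳 𝒮) (C : ℝ≥0) (x : 𝒳) : ℝ := min (p.densityRatio x) C

/-- The probability of treatment `a` given the covariates, truncated to its essential range, so that
it is bounded away from zero everywhere. -/
def clippedPropensity (p : Population 𝒳 𝒮) (ε : ℝ) (a : Bool) (x : 𝒳) : ℝ :=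
  if a then max ε (min (p.propensity x) (1 - ε)) else 1 - max ε (min (p.propensity x) (1 - ε))

/-- The signed inverse propensity weight `t / e*(x) - (1 - t) / (1 - e*(x))`. -/
def ipWeight (p : Population 𝒳 𝒮) (ε : ℝ) (x : 𝒳) (t : Bool) : ℝ :=
  if t then (p.clippedPropensity ε true x)⁻¹ else -(p.clippedPropensity ε false x)⁻¹

/-- The inverse propensity weighted regression residual: the influence function without its density
ratio. -/
def residual (p : Population 𝒳 𝒮) (ε : ℝ) (o : Obs 𝒳 𝒮) : ℝ :=
  p.ipWeight ε o.1 o.2.1 * (o.2.2.2 - p.regression o.2.1 o.1 o.2.2.1)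

@[fun_prop]
theorem measurable_clippedRatio (p : Population 𝒳 𝒮) (C : ℝ≥0) : Measurable (p.clippedRatio C) :=
  (Measure.measurable_rnDeriv _ _).ennreal_toReal.min measurable_const

theorem clippedRatio_nonneg (p : Population 𝒳 𝒮) (C : ℝ≥0) (x : 𝒳) : 0 ≤ p.clippedRatio C x :=
  le_min ENNReal.toReal_nonneg C.2

theorem clippedRatio_le (p : Population 𝒳 𝒮) (C : ℝ≥0) (x : 𝒳) : p.clippedRatio C x ≤ C :=
  min_le_right _ _

@[fun_prop]
theorem measurable_clippedPropensity (p : Population 𝒳 𝒮) (ε : ℝ) (a : Bool) :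
    Measurable (p.clippedPropensity ε a) := by
  have hprop : Measurable p.propensity :=
    (Kernel.measurable_coe _ (measurableSet_singleton true)).ennreal_toReal
  unfold clippedPropensity
  cases a
  · exact (measurable_const.max (hprop.min measurable_const)).const_sub 1
  · exact measurable_const.max (hprop.min measurable_const)

theorem le_clippedPropensity (p : Population 𝒳 𝒮) {ε : ℝ} (hε : ε < 1 / 2) (a : Bool) (x : 𝒳) :
    ε ≤ p.clippedPropensity ε a x := by
  cases a
  · exact le_sub_comm.1 (max_le (by linarith) (min_le_right _ _))
  · exact le_max_left _ _

theorem clippedPropensity_of_mem (p : Population 𝒳 𝒮) {ε : ℝ} {x : 𝒳}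
    (h : ε ≤ p.propensity x ∧ p.propensity x ≤ 1 - ε) (a : Bool) :
    p.clippedPropensity ε a x = if a then p.propensity x else 1 - p.propensity x := by
  simp only [clippedPropensity, min_eq_left h.2, max_eq_right h.1]

@[fun_prop]
theorem measurable_ipWeight (p : Population 𝒳 𝒮) (ε : ℝ) {α : Type*} [MeasurableSpace α]
    {x : α → 𝒳} {t : α → Bool} (hx : Measurable x) (ht : Measurable t) :
    Measurable fun z => p.ipWeight ε (x z) (t z) :=
  Measurable.ite (ht (measurableSet_singleton true)) (by fun_prop) (by fun_prop)

theorem abs_ipWeight_le (p : Population 𝒳 𝒮) {ε : ℝ} (hε0 : 0 < ε) (hε : ε < 1 / 2) (x : 𝒳)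
    (t : Bool) : |p.ipWeight ε x t| ≤ ε⁻¹ := by
  have hinv (a : Bool) : |(p.clippedPropensity ε a x)⁻¹| ≤ ε⁻¹ := by
    have hle := p.le_clippedPropensity hε a x
    rw [abs_inv, abs_of_nonneg (hε0.le.trans hle)]
    exact inv_anti₀ hε0 hle
  cases t
  · exact (abs_neg _).trans_le (hinv false)
  · exact hinv true

@[fun_prop]
theorem measurable_regression (p : Population 𝒳 𝒮) {α : Type*} [MeasurableSpace α]
    {t : α → Bool} {x : α → 𝒳} {s : α → 𝒮} (ht : Measurable t) (hx : Measurable x)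
    (hs : Measurable s) : Measurable fun z => p.regression (t z) (x z) (s z) :=
  (StronglyMeasurable.integral_condDistrib (f := fun z : (𝒳 × Bool × 𝒮) × ℝ => z.2)
    (measurable_snd.stronglyMeasurable)).measurable.comp (hx.prodMk (ht.prodMk hs))

@[fun_prop]
theorem measurable_residual (p : Population 𝒳 𝒮) (ε : ℝ) : Measurable (p.residual ε) := by
  unfold residual
  fun_prop

theorem Q_map_fst (p : Population 𝒳 𝒮) : p.Q.map Prod.fst = p.lawXLabelled :=
  Measure.map_map measurable_fst measurable_obs

theorem map_obs_map_fst (p : Population 𝒳 𝒮) : (p.P.map obs).map Prod.fst = p.lawX :=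
  Measure.map_map measurable_fst measurable_obs

theorem ae_Q_of_ae_lawXLabelled (p : Population 𝒳 𝒮) {r : 𝒳 → Prop}
    (h : ∀ᵐ x ∂p.lawXLabelled, r x) : ∀ᵐ o ∂p.Q, r o.1 := by
  rw [← Q_map_fst] at h
  exact ae_of_ae_map measurable_fst.aemeasurable h

theorem ae_P_of_ae_lawX (p : Population 𝒳 𝒮) {r : 𝒳 → Prop}
    (h : ∀ᵐ x ∂p.lawX, r x) : ∀ᵐ w ∂p.P, r (X w) :=
  ae_of_ae_map measurable_X.aemeasurable h

theorem lawX_eq_of_lawXTS_eq {p q : Population 𝒳 𝒮} (h : p.lawXTS = q.lawXTS) :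
    p.lawX = q.lawX := by
  have hfst (r : Population 𝒳 𝒮) : r.lawX = r.lawXTS.map Prod.fst :=
    (Measure.map_map measurable_fst measurable_XTS).symm
  rw [hfst, hfst, h]

theorem propensity_eq_of_lawXTS_eq {p q : Population 𝒳 𝒮} (h : p.lawXTS = q.lawXTS) :
    p.propensity = q.propensity := by
  have hXT (r : Population 𝒳 𝒮) :
      r.P.map (fun w => (X w, T w)) = r.lawXTS.map fun z => (z.1, z.2.1) :=
    (Measure.map_map (g := fun z : 𝒳 × Bool × 𝒮 => (z.1, z.2.1)) (by fun_prop)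
      measurable_XTS).symm
  have hcond : condDistrib T X p.P = condDistrib T X q.P := by
    simp only [condDistrib, hXT, h]
  funext x
  rw [propensity, propensity, hcond]

theorem lawXLabelled_eq_of_Q_eq {p q : Population 𝒳 𝒮} (h : p.Q = q.Q) :
    p.lawXLabelled = q.lawXLabelled := by
  rw [← Q_map_fst, ← Q_map_fst, h]

theorem ipWeight_eq_of_lawXTS_eq {p q : Population 𝒳 𝒮} (h : p.lawXTS = q.lawXTS) :
    p.ipWeight = q.ipWeight := by
  funext ε x t
  simp only [ipWeight, clippedPropensity, propensity_eq_of_lawXTS_eq h]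

theorem clippedRatio_congr {p q : Population 𝒳 𝒮} (h : p.lawX = q.lawX)
    (h' : p.lawXLabelled = q.lawXLabelled) : p.clippedRatio = q.clippedRatio := by
  funext C x
  rw [clippedRatio, clippedRatio, densityRatio, densityRatio, h, h']

theorem condDistrib_treatment_singleton {ε : ℝ} {p : Population 𝒳 𝒮}
    (ho : ∀ᵐ x ∂p.lawX, ε ≤ p.propensity x ∧ p.propensity x ≤ 1 - ε) (a : Bool) :
    ∀ᵐ x ∂p.lawX, condDistrib T X p.P x {a} = ENNReal.ofReal (p.clippedPropensity ε a x) := by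
  filter_upwards [ho] with x hx
  have htrue : condDistrib T X p.P x {true} = ENNReal.ofReal (p.propensity x) := by
    rw [propensity, ofReal_measureReal]
  rw [p.clippedPropensity_of_mem hx]
  cases a
  · have hcompl : ({false} : Set Bool) = {true}ᶜ := by
      ext b
      simp
    rw [hcompl, prob_compl_eq_one_sub (measurableSet_singleton true), htrue,
      if_neg Bool.false_ne_true, ENNReal.ofReal_sub 1 (q := p.propensity x) measureReal_nonneg,
      ENNReal.ofReal_one]
  · rw [htrue, if_pos rfl]

variable [StandardBorelSpace 𝒳] [StandardBorelSpace 𝒮] {ε : ℝ} {C : ℝ≥0} {p : Population 𝒳 𝒮}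

theorem ae_lawXLabelled_of_ae_lawX (hp : Assumptions ε C p) {r : 𝒳 → Prop}
    (h : ∀ᵐ x ∂p.lawX, r x) : ∀ᵐ x ∂p.lawXLabelled, p.densityRatio x ≠ 0 → r x := by
  rw [← Measure.withDensity_rnDeriv_eq _ _ hp.absolutelyContinuous,
    ae_withDensity_iff (Measure.measurable_rnDeriv _ _)] at h
  filter_upwards [h] with x hx hratio
  exact hx (ENNReal.toReal_ne_zero.1 hratio).1

theorem clippedRatio_ae_eq (hp : Assumptions ε C p) :
    ∀ᵐ x ∂p.lawXLabelled, p.clippedRatio C x = p.densityRatio x := by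
  filter_upwards [ae_lawXLabelled_of_ae_lawX hp hp.densityRatio_le] with x hx
  refine min_eq_left ?_
  by_cases hzero : p.densityRatio x = 0
  · rw [hzero]
    exact C.2
  · exact hx hzero

theorem map_obs_P_eq_clippedRatio (hp : Assumptions ε C p) :
    p.P.map obs = p.Q.withDensity fun o => ENNReal.ofReal (p.clippedRatio C o.1) := by
  rw [map_obs_P hp]
  refine withDensity_congr_ae ?_
  filter_upwards [p.ae_Q_of_ae_lawXLabelled (clippedRatio_ae_eq hp),
    p.ae_Q_of_ae_lawXLabelled (Measure.rnDeriv_lt_top p.lawX p.lawXLabelled)]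
    with o hratio hfinite
  rw [hratio, densityRatio, ENNReal.ofReal_toReal hfinite.ne]

theorem psi_ae_eq (hp : Assumptions ε C p) :
    p.psi =ᵐ[p.Q] fun o => p.clippedRatio C o.1 * p.residual ε o := by
  filter_upwards [p.ae_Q_of_ae_lawXLabelled (clippedRatio_ae_eq hp),
    p.ae_Q_of_ae_lawXLabelled (ae_lawXLabelled_of_ae_lawX hp hp.overlap)] with o hratio hoverlap
  obtain ⟨x, t, s, y⟩ := o
  simp only at hratio hoverlap
  rw [hratio]
  by_cases hzero : p.densityRatio x = 0
  · simp only [psi, hzero, mul_zero, zero_div, zero_mul, sub_zero]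
  · have hprop := p.clippedPropensity_of_mem (hoverlap hzero)
    cases t
    · simp only [psi, residual, ipWeight, hprop, Bool.false_eq_true, if_false]
      ring
    · simp only [psi, residual, ipWeight, hprop, if_true]
      ring

theorem setLIntegral_treatment_eq_clippedPropensity {a : Bool}
    (hu : CondIndepFun (MeasurableSpace.comap X inferInstance) measurable_X.comap_le
      (fun w => (Ypot a w, Spot a w)) T p.P)
    (ho : ∀ᵐ x ∂p.lawX, ε ≤ p.propensity x ∧ p.propensity x ≤ 1 - ε)
    {F : 𝒳 × ℝ → ℝ≥0∞} (hF : Measurable F) :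
    ∫⁻ w in T ⁻¹' {a}, F (X w, Ypot a w) ∂p.P =
      ∫⁻ w, ENNReal.ofReal (p.clippedPropensity ε a (X w)) * F (X w, Ypot a w) ∂p.P := by
  have := p.nonempty_surrogate
  rw [setLIntegral_treatment_eq, hasCondLaw_of_condIndepFun measurable_X
    ((measurable_Ypot a).prodMk (measurable_Spot a)) measurable_T hu
    (fun z => (if z.2 = a then 1 else 0) * F (z.1.1, z.1.2.1))
    ((measurable_ite_bool a (by fun_prop)).mul (by fun_prop))]
  refine lintegral_congr_ae ?_
  filter_upwards [p.ae_P_of_ae_lawX (condDistrib_treatment_singleton ho a)] with w hw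
  have hind (t : Bool) :
      (if t = a then (1 : ℝ≥0∞) else 0) = ({a} : Set Bool).indicator 1 t := by
    simp only [Set.indicator, Set.mem_singleton_iff, Pi.one_apply]
  simp only [Kernel.prodMkRight_apply]
  rw [lintegral_mul_const _ Measurable.of_discrete, lintegral_congr hind,
    lintegral_indicator_one (measurableSet_singleton a), hw]

end Population

end InversePropensityWeighting

section Identification

attribute [local fun_prop] measurable_X measurable_T measurable_Spot measurable_Ypot measurable_S
  measurable_Y measurable_obs

variable {𝒳 𝒮 : Type*} [MeasurableSpace 𝒳] [MeasurableSpace 𝒮]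

/-- The part `(X, T, S)` of an observation, whose unconditional law is known in the model. -/
def xts (o : Obs 𝒳 𝒮) : 𝒳 × Bool × 𝒮 := (o.1, o.2.1, o.2.2.1)

@[fun_prop]
theorem measurable_xts : Measurable (xts : Obs 𝒳 𝒮 → 𝒳 × Bool × 𝒮) := by
  unfold xts
  fun_prop

namespace Population

/-- The conditional law of `Y` given `(X, T, S)` and `R = 1`. -/
def outcomeKernel (p : Population 𝒳 𝒮) : Kernel (𝒳 × Bool × 𝒮) ℝ :=
  condDistrib Y (fun w => (X w, T w, S w)) (p.given true)

instance (p : Population 𝒳 𝒮) : IsMarkovKernel p.outcomeKernel := by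
  unfold outcomeKernel
  infer_instance

theorem hasCondLaw_Q (p : Population 𝒳 𝒮) :
    HasCondLaw p.Q xts (fun o => o.2.2.2) p.outcomeKernel :=
  .of_comp measurable_obs measurable_xts (by fun_prop)
    (hasCondLaw_condDistrib measurable_XTS measurable_Y)

theorem regression_eq_condMean (p : Population 𝒳 𝒮) (o : Obs 𝒳 𝒮) :
    p.regression o.2.1 o.1 o.2.2.1 = condMean p.outcomeKernel Prod.snd (xts o) := rfl

theorem lawXTS_eq_map_xts (p : Population 𝒳 𝒮) : p.lawXTS = (p.P.map obs).map xts :=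
  (Measure.map_map measurable_xts measurable_obs).symm

instance (p : Population 𝒳 𝒮) : IsProbabilityMeasure p.lawXTS :=
  Measure.isProbabilityMeasure_map measurable_XTS.aemeasurable

section LabelledMoments

variable {p : Population 𝒳 𝒮} {ε : ℝ}

theorem integrable_Y_Q (h : Integrable Y (p.given true)) :
    Integrable (fun o : Obs 𝒳 𝒮 => o.2.2.2) p.Q :=
  (integrable_map_measure (Measurable.aestronglyMeasurable (by fun_prop))
    measurable_obs.aemeasurable).2 h

theorem integrable_regression_Q (h : Integrable Y (p.given true)) :
    Integrable (fun o : Obs 𝒳 𝒮 => p.regression o.2.1 o.1 o.2.2.1) p.Q := by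
  simp only [regression_eq_condMean]
  exact p.hasCondLaw_Q.integrable_condMean measurable_xts measurable_snd (integrable_Y_Q h)

theorem condMean_mul_residual_ae_eq_zero (h : Integrable Y (p.given true)) (ε : ℝ)
    (u : 𝒳 → ℝ) : ∀ᵐ o ∂p.Q, condMean p.outcomeKernel
      (fun z => u z.1.1 * p.residual ε (z.1.1, z.1.2.1, z.1.2.2, z.2)) (xts o) = 0 := by
  filter_upwards [p.hasCondLaw_Q.ae_integrable measurable_xts measurable_snd (integrable_Y_Q h)]
    with o ho
  have hcentred := condMean_sub_condMean (f := Prod.snd) (c := xts o) ho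
  simp only [condMean, residual] at hcentred ⊢
  rw [integral_const_mul, integral_const_mul]
  exact mul_eq_zero_of_right _ (mul_eq_zero_of_right _ hcentred)

theorem integrable_mul_residual_Q (h : Integrable Y (p.given true)) (hε0 : 0 < ε)
    (hε : ε < 1 / 2) {u : 𝒳 → ℝ} (hu : Measurable u) {c : ℝ} (hc : ∀ x, |u x| ≤ c) :
    Integrable (fun o => u o.1 * p.residual ε o) p.Q :=
  (((integrable_Y_Q h).sub (integrable_regression_Q h)).bdd_mul (c := ε⁻¹)
    (Measurable.aestronglyMeasurable (by fun_prop))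
    (ae_of_all _ fun _ => p.abs_ipWeight_le hε0 hε _ _)).bdd_mul (c := c)
    (Measurable.aestronglyMeasurable (by fun_prop)) (ae_of_all _ fun _ => hc _)

theorem integral_mul_residual (h : Integrable Y (p.given true)) (hε0 : 0 < ε) (hε : ε < 1 / 2)
    {u : 𝒳 → ℝ} (hu : Measurable u) {c : ℝ} (hc : ∀ x, |u x| ≤ c) :
    ∫ o, u o.1 * p.residual ε o ∂p.Q = 0 :=
  (p.hasCondLaw_Q.integral_eq_integral_condMean measurable_xts (by fun_prop)
    (f := fun z => u z.1.1 * p.residual ε (z.1.1, z.1.2.1, z.1.2.2, z.2)) (by fun_prop)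
    (integrable_mul_residual_Q h hε0 hε hu hc)).trans
    (integral_eq_zero_of_ae (condMean_mul_residual_ae_eq_zero h ε u))

end LabelledMoments

theorem lintegral_Y_sq_le (m : Measure (Full 𝒳 𝒮)) :
    ∫⁻ w, ENNReal.ofReal (Y w ^ 2) ∂m ≤
      ∫⁻ w, ENNReal.ofReal (Ypot true w ^ 2) ∂m + ∫⁻ w, ENNReal.ofReal (Ypot false w ^ 2) ∂m := by
  rw [← lintegral_add_left (by fun_prop)]
  refine lintegral_mono fun w => ?_
  simp only [Y]
  cases T w
  · exact le_add_self
  · exact le_self_add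

theorem integrable_ipWeight_mul {p q : Population 𝒳 𝒮} {ε : ℝ} (hε0 : 0 < ε) (hε : ε < 1 / 2)
    {V : Full 𝒳 𝒮 → ℝ} (hV : Integrable V p.P) :
    Integrable (fun w => q.ipWeight ε (X w) (T w) * V w) p.P :=
  hV.bdd_mul (c := ε⁻¹) (Measurable.aestronglyMeasurable (by fun_prop))
    (ae_of_all _ fun _ => q.abs_ipWeight_le hε0 hε _ _)

theorem residual_sq_le (p : Population 𝒳 𝒮) {ε : ℝ} (hε0 : 0 < ε) (hε : ε < 1 / 2)
    (o : Obs 𝒳 𝒮) : p.residual ε o ^ 2 ≤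
      2 * (ε⁻¹) ^ 2 * (o.2.2.2 ^ 2 + p.regression o.2.1 o.1 o.2.2.1 ^ 2) := by
  have hweight : p.ipWeight ε o.1 o.2.1 ^ 2 ≤ (ε⁻¹) ^ 2 :=
    sq_le_sq.2 ((p.abs_ipWeight_le hε0 hε _ _).trans (le_abs_self _))
  calc p.residual ε o ^ 2
      = p.ipWeight ε o.1 o.2.1 ^ 2 * (o.2.2.2 - p.regression o.2.1 o.1 o.2.2.1) ^ 2 :=
        mul_pow _ _ 2
    _ ≤ (ε⁻¹) ^ 2 * (2 * (o.2.2.2 ^ 2 + p.regression o.2.1 o.1 o.2.2.1 ^ 2)) := by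
        gcongr
        linarith [add_sq_le (a := o.2.2.2) (b := -p.regression o.2.1 o.1 o.2.2.1)]
    _ = 2 * (ε⁻¹) ^ 2 * (o.2.2.2 ^ 2 + p.regression o.2.1 o.1 o.2.2.1 ^ 2) := by ring

theorem lintegral_residual_sq_le (p q : Population 𝒳 𝒮) {ε : ℝ} (hε0 : 0 < ε) (hε : ε < 1 / 2) :
    ∫⁻ o, ENNReal.ofReal (p.residual ε o ^ 2) ∂(q.P.map obs) ≤
      ENNReal.ofReal (2 * (ε⁻¹) ^ 2) *
        (∫⁻ w, ENNReal.ofReal (Y w ^ 2) ∂q.P +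
          ∫⁻ z, ENNReal.ofReal (p.regression z.2.1 z.1 z.2.2 ^ 2) ∂q.lawXTS) := by
  have hY : ∫⁻ w, ENNReal.ofReal (Y w ^ 2) ∂q.P =
      ∫⁻ o, ENNReal.ofReal (o.2.2.2 ^ 2) ∂(q.P.map obs) :=
    (lintegral_map (f := fun o : Obs 𝒳 𝒮 => ENNReal.ofReal (o.2.2.2 ^ 2)) (by fun_prop)
      measurable_obs).symm
  rw [hY, lawXTS_eq_map_xts, lintegral_map (by fun_prop) measurable_xts,
    ← lintegral_add_left (by fun_prop), ← lintegral_const_mul' _ _ ENNReal.ofReal_ne_top]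
  refine lintegral_mono fun o => ?_
  rw [← ENNReal.ofReal_add (sq_nonneg _) (sq_nonneg _), ← ENNReal.ofReal_mul (by positivity)]
  exact ENNReal.ofReal_le_ofReal (p.residual_sq_le hε0 hε o)

variable [StandardBorelSpace 𝒳] [StandardBorelSpace 𝒮] {ε : ℝ} {C : ℝ≥0} {p : Population 𝒳 𝒮}

theorem hasCondLaw_map_obs (hp : Assumptions ε C p) :
    HasCondLaw (p.P.map obs) xts (fun o => o.2.2.2) p.outcomeKernel := by
  rw [map_obs_P_eq_clippedRatio hp]
  exact p.hasCondLaw_Q.withDensity measurable_xts (by fun_prop)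
    (u := fun z => ENNReal.ofReal (p.clippedRatio C z.1)) (by fun_prop)

theorem lintegral_outcome_sq (hp : Assumptions ε C p) (a : Bool) :
    ∫⁻ w, ENNReal.ofReal (Ypot a w ^ 2) ∂p.P = ENNReal.ofReal (∫ w, Ypot a w ^ 2 ∂p.P) :=
  (ofReal_integral_eq_lintegral_ofReal (hp.outcome_memLp a).integrable_sq
    (ae_of_all _ fun _ => sq_nonneg _)).symm

theorem lintegral_Y_sq_ne_top (hp : Assumptions ε C p) :
    ∫⁻ w, ENNReal.ofReal (Y w ^ 2) ∂p.P ≠ ∞ := by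
  refine ne_top_of_le_ne_top ?_ (lintegral_Y_sq_le p.P)
  rw [lintegral_outcome_sq hp, lintegral_outcome_sq hp]
  finiteness

theorem memLp_Y (hp : Assumptions ε C p) : MemLp Y 2 p.P :=
  (memLp_two_iff_lintegral_sq measurable_Y.aestronglyMeasurable).2 (lintegral_Y_sq_ne_top hp)

theorem memLp_regression (hp : Assumptions ε C p) :
    MemLp (fun z : 𝒳 × Bool × 𝒮 => p.regression z.2.1 z.1 z.2.2) 2 p.lawXTS := by
  have hY : MemLp (fun o : Obs 𝒳 𝒮 => o.2.2.2) 2 (p.P.map obs) :=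
    (memLp_map_measure_iff (Measurable.aestronglyMeasurable (by fun_prop))
      measurable_obs.aemeasurable).2 (memLp_Y hp)
  rw [lawXTS_eq_map_xts, memLp_map_measure_iff (Measurable.aestronglyMeasurable (by fun_prop))
    measurable_xts.aemeasurable]
  exact ⟨Measurable.aestronglyMeasurable (by fun_prop),
    ((hasCondLaw_map_obs hp).eLpNorm_condMean_le measurable_snd).trans_lt hY.2⟩

theorem lintegral_regression_sq_ne_top (hp : Assumptions ε C p) :
    ∫⁻ z, ENNReal.ofReal (p.regression z.2.1 z.1 z.2.2 ^ 2) ∂p.lawXTS ≠ ∞ :=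
  (memLp_two_iff_lintegral_sq (Measurable.aestronglyMeasurable (by fun_prop))).1
    (memLp_regression hp)

theorem map_restrict_treatment (hp : Assumptions ε C p) (a : Bool) :
    (p.P.restrict (T ⁻¹' {a})).map (fun w => (X w, Ypot a w)) =
      (p.P.map fun w => (X w, Ypot a w)).withDensity
        fun z => ENNReal.ofReal (p.clippedPropensity ε a z.1) := by
  have hm : Measurable fun w : Full 𝒳 𝒮 => (X w, Ypot a w) := by fun_prop
  have hu : Measurable fun z : 𝒳 × ℝ => ENNReal.ofReal (p.clippedPropensity ε a z.1) := by fun_prop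
  refine Measure.ext_of_lintegral _ fun F hF => ?_
  rw [lintegral_map hF hm,
    setLIntegral_treatment_eq_clippedPropensity (hp.unconfounded a) hp.overlap hF,
    lintegral_withDensity_eq_lintegral_mul _ hu hF, lintegral_map (hu.mul hF) hm]
  rfl

theorem setIntegral_inv_clippedPropensity_mul (hp : Assumptions ε C p) (hε0 : 0 < ε)
    (hε : ε < 1 / 2) (a : Bool) :
    ∫ w in T ⁻¹' {a}, (p.clippedPropensity ε a (X w))⁻¹ * Y w ∂p.P = ∫ w, Ypot a w ∂p.P := by
  have hm : Measurable fun w : Full 𝒳 𝒮 => (X w, Ypot a w) := by fun_prop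
  have hF : Measurable fun z : 𝒳 × ℝ => (p.clippedPropensity ε a z.1)⁻¹ * z.2 := by fun_prop
  have hpos (x : 𝒳) : 0 < p.clippedPropensity ε a x := hε0.trans_le (p.le_clippedPropensity hε a x)
  calc ∫ w in T ⁻¹' {a}, (p.clippedPropensity ε a (X w))⁻¹ * Y w ∂p.P
      = ∫ w in T ⁻¹' {a}, (p.clippedPropensity ε a (X w))⁻¹ * Ypot a w ∂p.P :=
        setIntegral_congr_fun (measurable_T (measurableSet_singleton a))
          fun w (hw : T w = a) => by simp only [Y, hw]
    _ = ∫ z, (p.clippedPropensity ε a z.1)⁻¹ * z.2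
          ∂((p.P.restrict (T ⁻¹' {a})).map fun w => (X w, Ypot a w)) :=
        (integral_map hm.aemeasurable hF.aestronglyMeasurable).symm
    _ = ∫ z, z.2 ∂(p.P.map fun w => (X w, Ypot a w)) := by
        rw [map_restrict_treatment hp, integral_withDensity_eq_integral_toReal_smul (by fun_prop)
          (ae_of_all _ fun _ => ENNReal.ofReal_lt_top)]
        refine integral_congr_ae (ae_of_all _ fun z => ?_)
        simp only [smul_eq_mul]
        rw [ENNReal.toReal_ofReal (hpos _).le, mul_inv_cancel_left₀ (hpos _).ne']
    _ = ∫ w, Ypot a w ∂p.P := integral_map hm.aemeasurable (by fun_prop)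

theorem ate_eq_integral_ipWeight (hp : Assumptions ε C p) (hε0 : 0 < ε) (hε : ε < 1 / 2) :
    p.ate = ∫ w, p.ipWeight ε (X w) (T w) * Y w ∂p.P := by
  have hmeas (a : Bool) : MeasurableSet (T ⁻¹' {a} : Set (Full 𝒳 𝒮)) :=
    measurable_T (measurableSet_singleton a)
  have hcompl : (T ⁻¹' {true} : Set (Full 𝒳 𝒮))ᶜ = T ⁻¹' {false} := by
    ext w
    simp
  rw [← integral_add_compl (hmeas true)
    (integrable_ipWeight_mul hε0 hε ((memLp_Y hp).integrable one_le_two)), hcompl, ate,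
    ← setIntegral_inv_clippedPropensity_mul hp hε0 hε true,
    ← setIntegral_inv_clippedPropensity_mul hp hε0 hε false, sub_eq_add_neg, ← integral_neg]
  congr 1
  · exact setIntegral_congr_fun (hmeas true) fun w (hw : T w = true) => by
      simp only [ipWeight, hw, if_true]
  · exact setIntegral_congr_fun (hmeas false) fun w (hw : T w = false) => by
      simp only [ipWeight, hw, Bool.false_eq_true, if_false, neg_mul]

theorem memLp_psi (hp : Assumptions ε C p) (hε0 : 0 < ε) (hε : ε < 1 / 2) :
    MemLp p.psi 2 p.Q := by
  have hfinite : ∫⁻ o, ENNReal.ofReal (p.residual ε o ^ 2) ∂(p.P.map obs) ≠ ∞ :=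
    ne_top_of_le_ne_top (ENNReal.mul_ne_top ENNReal.ofReal_ne_top (ENNReal.add_ne_top.2
      ⟨lintegral_Y_sq_ne_top hp, lintegral_regression_sq_ne_top hp⟩))
      (lintegral_residual_sq_le p p hε0 hε)
  rw [map_obs_P_eq_clippedRatio hp,
    lintegral_withDensity_eq_lintegral_mul _ (by fun_prop) (by fun_prop)] at hfinite
  rw [memLp_congr_ae (psi_ae_eq hp),
    memLp_two_iff_lintegral_sq (Measurable.aestronglyMeasurable (by fun_prop))]
  refine ne_top_of_le_ne_top (ENNReal.mul_ne_top (ENNReal.coe_ne_top (r := C)) hfinite) ?_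
  rw [← lintegral_const_mul' _ _ ENNReal.coe_ne_top]
  refine lintegral_mono fun o => ?_
  simp only [Pi.mul_apply]
  rw [← ENNReal.ofReal_mul (p.clippedRatio_nonneg C _), ← ENNReal.ofReal_coe_nnreal,
    ← ENNReal.ofReal_mul C.coe_nonneg, mul_pow, sq (p.clippedRatio C o.1), mul_assoc]
  exact ENNReal.ofReal_le_ofReal (mul_le_mul_of_nonneg_right (p.clippedRatio_le C _)
    (mul_nonneg (p.clippedRatio_nonneg C _) (sq_nonneg _)))

theorem ate_eq_integral_residual {q : Population 𝒳 𝒮} (hp : Assumptions ε C p)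
    (hq : Assumptions ε C q) (h : q.lawXTS = p.lawXTS) (hε0 : 0 < ε) (hε : ε < 1 / 2) :
    q.ate = ∫ o, p.residual ε o ∂(q.P.map obs) +
      ∫ z, p.ipWeight ε z.1 z.2.1 * p.regression z.2.1 z.1 z.2.2 ∂p.lawXTS := by
  have hregression : Integrable (fun w => p.regression (T w) (X w) (S w)) q.P := by
    have hmemLp : MemLp (fun z : 𝒳 × Bool × 𝒮 => p.regression z.2.1 z.1 z.2.2) 2 q.lawXTS :=
      h ▸ memLp_regression hp
    exact (hmemLp.integrable one_le_two).comp_measurable measurable_XTS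
  have hresidual (w : Full 𝒳 𝒮) : p.residual ε (obs w) = p.ipWeight ε (X w) (T w) * Y w -
      p.ipWeight ε (X w) (T w) * p.regression (T w) (X w) (S w) := mul_sub _ _ _
  rw [ate_eq_integral_ipWeight hq hε0 hε, ipWeight_eq_of_lawXTS_eq h, ← h,
    integral_map measurable_obs.aemeasurable (by fun_prop), lawXTS,
    integral_map measurable_XTS.aemeasurable (Measurable.aestronglyMeasurable (by fun_prop))]
  simp only [hresidual]
  rw [integral_sub (integrable_ipWeight_mul hε0 hε ((memLp_Y hq).integrable one_le_two))
    (integrable_ipWeight_mul hε0 hε hregression), sub_add_cancel]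

end Population

end Identification

section Derivative

attribute [local fun_prop] measurable_obs

section RootDensity

variable {Ω : Type*} [MeasurableSpace Ω] {Q μ : Measure Ω}

/-- The square root of the density of `Q` with respect to the dominating measure `μ`. -/
def rootDensity (Q μ : Measure Ω) (o : Ω) : ℝ := √(Q.rnDeriv μ o).toReal

@[fun_prop]
theorem measurable_rootDensity (Q μ : Measure Ω) : Measurable (rootDensity Q μ) :=
  (Measure.measurable_rnDeriv _ _).ennreal_toReal.sqrt

variable [IsProbabilityMeasure Q] [SigmaFinite μ]

theorem withDensity_rootDensity_sq (h : Q ≪ μ) :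
    μ.withDensity (fun o => ENNReal.ofReal (rootDensity Q μ o ^ 2)) = Q := by
  conv_rhs => rw [← Measure.withDensity_rnDeriv_eq Q μ h]
  refine withDensity_congr_ae ?_
  filter_upwards [Q.rnDeriv_lt_top μ] with o ho
  rw [rootDensity, Real.sq_sqrt ENNReal.toReal_nonneg, ENNReal.ofReal_toReal ho.ne]

theorem integral_mul_rootDensity_sq (h : Q ≪ μ) (f : Ω → ℝ) :
    ∫ o, f o * rootDensity Q μ o ^ 2 ∂μ = ∫ o, f o ∂Q := by
  rw [← integral_withDensity_sq (measurable_rootDensity Q μ), withDensity_rootDensity_sq h]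

theorem memLp_mul_rootDensity (h : Q ≪ μ) {f : Ω → ℝ} (hf : Measurable f) (hf2 : MemLp f 2 Q) :
    MemLp (fun o => f o * rootDensity Q μ o) 2 μ := by
  refine ⟨Measurable.aestronglyMeasurable (by fun_prop), ?_⟩
  rw [← eLpNorm_withDensity_sq (measurable_rootDensity Q μ) hf, withDensity_rootDensity_sq h]
  exact hf2.2

theorem memLp_rootDensity (h : Q ≪ μ) : MemLp (rootDensity Q μ) 2 μ := by
  simpa only [one_mul] using memLp_mul_rootDensity h measurable_const (memLp_const (1 : ℝ))

end RootDensity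

namespace Population

variable {𝒳 𝒮 : Type*} [MeasurableSpace 𝒳] [MeasurableSpace 𝒮]

theorem isRootWeight_sqrt_clippedRatio (p : Population 𝒳 𝒮) (C : ℝ≥0) :
    IsRootWeight (√C) fun x => √(p.clippedRatio C x) where
  measurable := by fun_prop
  nonneg _ := Real.sqrt_nonneg _
  le x := Real.sqrt_le_sqrt (p.clippedRatio_le C x)

variable [StandardBorelSpace 𝒳] [StandardBorelSpace 𝒮] {ε : ℝ} {C : ℝ≥0} {p q : Population 𝒳 𝒮}
  {γ : ℝ → Population 𝒳 𝒮} {g : Lp ℝ 2 p.Q}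

theorem map_obs_P_eq_rootDensity {μ : Measure (Obs 𝒳 𝒮)} [SigmaFinite μ] (hp : Assumptions ε C p)
    (h : p.Q ≪ μ) : p.P.map obs = μ.withDensity fun o =>
      ENNReal.ofReal ((√(p.clippedRatio C o.1) * rootDensity p.Q μ o) ^ 2) := by
  rw [map_obs_P_eq_clippedRatio hp]
  conv_lhs => rw [← withDensity_rootDensity_sq h]
  rw [← withDensity_mul _ (by fun_prop) (by fun_prop)]
  refine congrArg μ.withDensity (funext fun o => ?_)
  rw [Pi.mul_apply, mul_pow, Real.sq_sqrt (p.clippedRatio_nonneg C _), mul_comm,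
    ENNReal.ofReal_mul (p.clippedRatio_nonneg C _)]

theorem eLpNorm_residual_le (hq : Assumptions ε C q)
    (h : q.lawXTS = p.lawXTS) (hε0 : 0 < ε) (hε : ε < 1 / 2) {K : ℝ}
    (hK : ∀ a, ∫ w, Ypot a w ^ 2 ∂q.P ≤ K) :
    eLpNorm (p.residual ε) 2 (q.P.map obs) ≤ (ENNReal.ofReal (2 * (ε⁻¹) ^ 2) *
      (ENNReal.ofReal K + ENNReal.ofReal K +
        ∫⁻ z, ENNReal.ofReal (p.regression z.2.1 z.1 z.2.2 ^ 2) ∂p.lawXTS)) ^ (1 / 2 : ℝ) := by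
  have hY : ∫⁻ w, ENNReal.ofReal (Y w ^ 2) ∂q.P ≤ ENNReal.ofReal K + ENNReal.ofReal K := by
    refine (lintegral_Y_sq_le q.P).trans ?_
    rw [lintegral_outcome_sq hq, lintegral_outcome_sq hq]
    exact add_le_add (ENNReal.ofReal_le_ofReal (hK true)) (ENNReal.ofReal_le_ofReal (hK false))
  rw [eLpNorm_two_eq]
  refine ENNReal.rpow_le_rpow ((lintegral_residual_sq_le p q hε0 hε).trans ?_) (by norm_num)
  rw [h]
  gcongr

theorem exists_eLpNorm_residual_le (hp : Assumptions ε C p) (hε0 : 0 < ε) (hε : ε < 1 / 2)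
    (hγ : IsSmoothSubmodel (model ε C p) p γ g) :
    ∃ K : ℝ≥0, ∀ θ, eLpNorm (p.residual ε) 2 ((γ θ).P.map obs) ≤ K := by
  obtain ⟨K, hK⟩ := hγ.moment
  have hfinite : (ENNReal.ofReal (2 * (ε⁻¹) ^ 2) * (ENNReal.ofReal K + ENNReal.ofReal K +
      ∫⁻ z, ENNReal.ofReal (p.regression z.2.1 z.1 z.2.2 ^ 2) ∂p.lawXTS)) ^ (1 / 2 : ℝ) ≠ ∞ :=
    ENNReal.rpow_ne_top_of_nonneg (by norm_num) (ENNReal.mul_ne_top ENNReal.ofReal_ne_top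
      (ENNReal.add_ne_top.2 ⟨by finiteness, lintegral_regression_sq_ne_top hp⟩))
  exact ⟨_, fun θ => (eLpNorm_residual_le (hγ.mem θ).1 (hγ.mem θ).2 hε0 hε (hK θ)).trans
    (ENNReal.coe_toNNReal hfinite).ge⟩

theorem isReweightedDQM {μ : Measure (Obs 𝒳 𝒮)} [SigmaFinite μ]
    (hγ : IsSmoothSubmodel (model ε C p) p γ g) (hμ : ∀ θ, (γ θ).Q ≪ μ)
    (hscore : Tendsto (fun θ : ℝ => ∫⁻ o, ENNReal.ofReal
      (((rootDensity (γ θ).Q μ o - rootDensity (γ 0).Q μ o) / θ -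
        g o * rootDensity (γ 0).Q μ o / 2) ^ 2) ∂μ) (𝓝[≠] 0) (𝓝 0)) :
    IsReweightedDQM μ Prod.fst (fun θ => rootDensity (γ θ).Q μ)
      (fun θ x => √((γ θ).clippedRatio C x)) (√C) g where
  measurable_statistic := measurable_fst
  measurable_root θ := measurable_rootDensity _ _
  memLp_root θ := memLp_rootDensity (hμ θ)
  isRootWeight θ := (γ θ).isRootWeight_sqrt_clippedRatio C
  rootLaw_eq θ := by
    rw [rootLaw, rootLaw, ← map_obs_P_eq_rootDensity (hγ.mem θ).1 (hμ θ),
      ← map_obs_P_eq_rootDensity (hγ.mem 0).1 (hμ 0), map_obs_map_fst, map_obs_map_fst,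
      lawX_eq_of_lawXTS_eq ((hγ.mem θ).2.trans (hγ.mem 0).2.symm)]
  measurable_score := (Lp.stronglyMeasurable g).measurable
  memLp_score := by
    refine memLp_mul_rootDensity (hμ 0) (Lp.stronglyMeasurable g).measurable ?_
    rw [hγ.base]
    exact Lp.memLp g
  tendsto_quotient := by
    simp only [eLpNorm_two_eq]
    simpa using hscore.ennrpow_const (1 / 2 : ℝ)

theorem integral_psi_mul (hp : Assumptions ε C p) (hγ : IsSmoothSubmodel (model ε C p) p γ g)
    {μ : Measure (Obs 𝒳 𝒮)} [SigmaFinite μ] (hμ : (γ 0).Q ≪ μ) :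
    ∫ o, p.residual ε o * g o * (√((γ 0).clippedRatio C o.1) * rootDensity (γ 0).Q μ o) ^ 2 ∂μ =
      ∫ o, p.psi o * g o ∂p.Q := by
  have hratio : (γ 0).clippedRatio = p.clippedRatio :=
    clippedRatio_congr (lawX_eq_of_lawXTS_eq (hγ.mem 0).2) (lawXLabelled_eq_of_Q_eq hγ.base)
  simp only [mul_pow, Real.sq_sqrt ((γ 0).clippedRatio_nonneg C _), ← mul_assoc]
  rw [integral_mul_rootDensity_sq hμ fun o => p.residual ε o * g o * (γ 0).clippedRatio C o.1,
    hγ.base, hratio]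
  refine integral_congr_ae ?_
  filter_upwards [psi_ae_eq hp] with o ho
  rw [ho]
  ring

theorem hasDerivAt_ate (hp : Assumptions ε C p) (hε0 : 0 < ε) (hε : ε < 1 / 2)
    (hγ : IsSmoothSubmodel (model ε C p) p γ g) :
    HasDerivAt (fun θ => (γ θ).ate) (∫ o, p.psi o * g o ∂p.Q) 0 := by
  obtain ⟨μ, _, hac, hscore⟩ := hγ.score
  have hμ (θ : ℝ) : (γ θ).Q ≪ μ := hac θ
  obtain ⟨K, hK⟩ := exists_eLpNorm_residual_le hp hε0 hε hγ
  have hlaw (θ : ℝ) := map_obs_P_eq_rootDensity (hγ.mem θ).1 (hμ θ)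
  have hroot (θ : ℝ) : Measurable fun o : Obs 𝒳 𝒮 =>
      √((γ θ).clippedRatio C o.1) * rootDensity (γ θ).Q μ o := by fun_prop
  have hdqm : IsReweightedDQM μ Prod.fst (fun θ => rootDensity (γ θ).Q μ)
      (fun θ x => √((γ θ).clippedRatio C x)) (√C) g := isReweightedDQM hγ hμ hscore
  have hbound (θ : ℝ) : eLpNorm (fun o => p.residual ε o *
      (√((γ θ).clippedRatio C o.1) * rootDensity (γ θ).Q μ o)) 2 μ ≤ K := by
    rw [← eLpNorm_withDensity_sq (hroot θ) (p.measurable_residual ε), ← hlaw]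
    exact hK θ
  have hcentred (u : 𝒳 → ℝ) (hu : Measurable u) (R : ℝ) (hR : ∀ x, |u x| ≤ R) :
      ∫ o, u o.1 * (p.residual ε o * rootDensity (γ 0).Q μ o ^ 2) ∂μ = 0 := by
    simp only [← mul_assoc]
    rw [integral_mul_rootDensity_sq (hμ 0) fun o => u o.1 * p.residual ε o, hγ.base]
    exact integral_mul_residual hp.outcome_integrable hε0 hε hu hR
  have hate (θ : ℝ) : (γ θ).ate =
      ∫ o, p.residual ε o * (√((γ θ).clippedRatio C o.1) * rootDensity (γ θ).Q μ o) ^ 2 ∂μ +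
        ∫ z, p.ipWeight ε z.1 z.2.1 * p.regression z.2.1 z.1 z.2.2 ∂p.lawXTS := by
    rw [ate_eq_integral_residual hp (hγ.mem θ).1 (hγ.mem θ).2 hε0 hε, hlaw,
      integral_withDensity_sq (hroot θ)]
  rw [funext hate, ← integral_psi_mul hp hγ (hμ 0)]
  exact (hdqm.hasDerivAt_integral (p.measurable_residual ε) hbound hcentred).add_const _

end Population

end Derivative

section ObservedKernel

theorem HasCondLaw.compProd {Ω γ β β' : Type*} [MeasurableSpace Ω] [MeasurableSpace γ]
    [MeasurableSpace β] [MeasurableSpace β'] {ν : Measure Ω} {k : Ω → γ} {V : Ω → β} {W : Ω → β'}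
    {κ : Kernel γ β} [IsSFiniteKernel κ] {η : Kernel (γ × β) β'} [IsSFiniteKernel η]
    (hV : HasCondLaw ν k V κ) (hW : HasCondLaw ν (fun ω => (k ω, V ω)) W η) :
    HasCondLaw ν k (fun ω => (V ω, W ω)) (κ ⊗ₖ η) := by
  intro F hF
  refine (hW (fun z => F (z.1.1, z.1.2, z.2)) (by fun_prop)).trans
    ((hV (fun z => ∫⁻ w, F (z.1, z.2, w) ∂η z) ?_).trans (lintegral_congr fun ω => ?_))
  · exact Measurable.lintegral_kernel_prod_right'
      (f := fun z : (γ × β) × β' => F (z.1.1, z.1.2, z.2)) (by fun_prop)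
  · exact (Kernel.lintegral_compProd κ η (k ω) (f := fun z => F (k ω, z)) (by fun_prop)).symm

variable {𝒳 𝒮 : Type*} [MeasurableSpace 𝒳] [MeasurableSpace 𝒮]

/-- The conditional law of the surrogate and the outcome given the covariates and the treatment,
with surrogate law `σ` and outcome law `κ`. -/
def armKernel (σ : Kernel (𝒳 × Bool) 𝒮) (κ : Kernel (𝒳 × Bool × 𝒮) ℝ) :
    Kernel (𝒳 × Bool) (𝒮 × ℝ) :=
  σ ⊗ₖ κ.comap (fun z : (𝒳 × Bool) × 𝒮 => (z.1.1, z.1.2, z.2)) (by fun_prop)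

/-- The conditional law of `(T, S, Y)` given the covariates, with treatment law `τ`, surrogate law
`σ` and outcome law `κ`. -/
def obsKernel (τ : Kernel 𝒳 Bool) (σ : Kernel (𝒳 × Bool) 𝒮) (κ : Kernel (𝒳 × Bool × 𝒮) ℝ) :
    Kernel 𝒳 (Bool × 𝒮 × ℝ) :=
  τ ⊗ₖ armKernel σ κ

/-- The kernel `κ` of outcome laws reweighted by the density `D`. -/
def tiltedKernel (κ : Kernel (𝒳 × Bool × 𝒮) ℝ) [IsSFiniteKernel κ] (D : Obs 𝒳 𝒮 → ℝ≥0∞) :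
    Kernel (𝒳 × Bool × 𝒮) ℝ :=
  κ.withDensity fun z y => D (z.1, z.2.1, z.2.2, y)

variable {τ : Kernel 𝒳 Bool} {σ : Kernel (𝒳 × Bool) 𝒮} {κ κ' : Kernel (𝒳 × Bool × 𝒮) ℝ}
  [IsMarkovKernel τ] [IsMarkovKernel σ] [IsMarkovKernel κ] [IsMarkovKernel κ']

instance : IsMarkovKernel (armKernel σ κ) := by
  unfold armKernel
  infer_instance

instance : IsMarkovKernel (obsKernel τ σ κ) := by
  unfold obsKernel
  infer_instance

theorem lintegral_armKernel (c : 𝒳 × Bool) {F : 𝒮 × ℝ → ℝ≥0∞} (hF : Measurable F) :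
    ∫⁻ z, F z ∂armKernel σ κ c = ∫⁻ s, ∫⁻ y, F (s, y) ∂κ (c.1, c.2, s) ∂σ c := by
  rw [armKernel, Kernel.lintegral_compProd _ _ _ hF]
  rfl

theorem lintegral_compProd_obsKernel (m : Measure 𝒳) [SFinite m] {G : Obs 𝒳 𝒮 → ℝ≥0∞}
    (hG : Measurable G) : ∫⁻ o, G o ∂(m ⊗ₘ obsKernel τ σ κ) =
      ∫⁻ x, ∫⁻ t, ∫⁻ s, ∫⁻ y, G (x, t, s, y) ∂κ (x, t, s) ∂σ (x, t) ∂τ x ∂m := by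
  rw [Measure.lintegral_compProd hG]
  refine lintegral_congr fun x => ?_
  rw [obsKernel, Kernel.lintegral_compProd _ _ _ (by fun_prop)]
  exact lintegral_congr fun t =>
    lintegral_armKernel (x, t) (F := fun z => G (x, t, z)) (by fun_prop)

theorem map_xts_compProd_obsKernel_congr (m : Measure 𝒳) [SFinite m] :
    (m ⊗ₘ obsKernel τ σ κ).map xts = (m ⊗ₘ obsKernel τ σ κ').map xts := by
  refine Measure.ext_of_lintegral _ fun F hF => ?_
  rw [lintegral_map hF measurable_xts, lintegral_map hF measurable_xts,
    lintegral_compProd_obsKernel m (G := fun o => F (xts o)) (by fun_prop),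
    lintegral_compProd_obsKernel m (G := fun o => F (xts o)) (by fun_prop)]
  simp only [xts, lintegral_const, measure_univ]

variable {D : Obs 𝒳 𝒮 → ℝ≥0∞}

theorem lintegral_tiltedKernel (hD : Measurable D) (z : 𝒳 × Bool × 𝒮) {F : ℝ → ℝ≥0∞}
    (hF : Measurable F) :
    ∫⁻ y, F y ∂tiltedKernel κ D z = ∫⁻ y, D (z.1, z.2.1, z.2.2, y) * F y ∂κ z :=
  Kernel.lintegral_withDensity _ (by unfold Function.uncurry; fun_prop) z hF

theorem isMarkovKernel_tiltedKernel (hD : Measurable D)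
    (hD_one : ∀ z : 𝒳 × Bool × 𝒮, ∫⁻ y, D (z.1, z.2.1, z.2.2, y) ∂κ z = 1) :
    IsMarkovKernel (tiltedKernel κ D) := by
  refine ⟨fun z => ⟨?_⟩⟩
  rw [← lintegral_one, lintegral_tiltedKernel hD z (F := fun _ => 1) measurable_const]
  simpa only [mul_one] using hD_one z

theorem compProd_obsKernel_tiltedKernel (m : Measure 𝒳) [SFinite m] (hD : Measurable D)
    [IsMarkovKernel (tiltedKernel κ D)] :
    m ⊗ₘ obsKernel τ σ (tiltedKernel κ D) = (m ⊗ₘ obsKernel τ σ κ).withDensity D := by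
  refine Measure.ext_of_lintegral _ fun G hG => ?_
  rw [lintegral_withDensity_eq_lintegral_mul _ hD hG, lintegral_compProd_obsKernel m hG,
    lintegral_compProd_obsKernel m (hD.mul hG)]
  refine lintegral_congr fun x => lintegral_congr fun t => lintegral_congr fun s => ?_
  exact lintegral_tiltedKernel hD (x, t, s) (F := fun y => G (x, t, s, y)) (by fun_prop)

end ObservedKernel

section OfKernels

attribute [local fun_prop] measurable_X measurable_T measurable_Spot measurable_Ypot

variable {𝒳 𝒮 : Type*} [MeasurableSpace 𝒳] [MeasurableSpace 𝒮]

theorem measurable_eval_bool {α β : Type*} [MeasurableSpace α] [MeasurableSpace β] {b : α → Bool}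
    {f : α → Bool → β} (hb : Measurable b) (hf : Measurable f) : Measurable fun w => f w (b w) := by
  have heval : Measurable fun z : (Bool → β) × Bool => z.1 z.2 :=
    measurable_from_prod_countable_left fun a => measurable_pi_apply a
  exact heval.comp (hf.prodMk hb)

/-- The component of a pair of treatment arms that belongs to the treatment `a`. -/
def selectArm {β : Type*} (a : Bool) (z : β × β) : β := if a then z.1 else z.2

@[fun_prop]
theorem measurable_selectArm {α β : Type*} [MeasurableSpace α] [MeasurableSpace β] {a : α → Bool}
    {z : α → β × β} (ha : Measurable a) (hz : Measurable z) :
    Measurable fun w => selectArm (a w) (z w) :=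
  Measurable.ite (ha (measurableSet_singleton true)) hz.fst hz.snd

theorem lintegral_selectArm {β : Type*} [MeasurableSpace β] (a : Bool) (m : Bool → Measure β)
    [∀ b, IsProbabilityMeasure (m b)] {F : β → ℝ≥0∞} (hF : Measurable F) :
    ∫⁻ z, F (selectArm a z) ∂(m true).prod (m false) = ∫⁻ z, F z ∂m a := by
  cases a
  · exact measurePreserving_snd.lintegral_comp hF
  · exact measurePreserving_fst.lintegral_comp hF

/-- Build a unit from its covariates, its treatment and its two arms, the treated arm first. -/
def assemble (z : 𝒳 × Bool × (𝒮 × ℝ) × (𝒮 × ℝ)) : Unlabelled 𝒳 𝒮 :=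
  (z.1, z.2.1, fun a => (selectArm a z.2.2).1, fun a => (selectArm a z.2.2).2)

@[fun_prop]
theorem measurable_assemble : Measurable (assemble : _ → Unlabelled 𝒳 𝒮) := by
  unfold assemble
  fun_prop

namespace Population

variable (ν : Bool → ProbabilityMeasure 𝒳) (τ : Kernel 𝒳 Bool) [IsMarkovKernel τ]
  (σ : Kernel (𝒳 × Bool) 𝒮) [IsMarkovKernel σ] (κ : Kernel (𝒳 × Bool × 𝒮) ℝ) [IsMarkovKernel κ]

/-- The law of a unit with covariate law `m` whose treatment and two arms are independent given the
covariates. -/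
def unitLaw (m : Measure 𝒳) : Measure (Unlabelled 𝒳 𝒮) :=
  (m ⊗ₘ (τ ×ₖ ((armKernel σ κ).comap (fun x => (x, true)) (by fun_prop) ×ₖ
    (armKernel σ κ).comap (fun x => (x, false)) (by fun_prop)))).map assemble

instance (m : Measure 𝒳) [IsProbabilityMeasure m] : IsProbabilityMeasure (unitLaw τ σ κ m) :=
  Measure.isProbabilityMeasure_map measurable_assemble.aemeasurable

/-- The population without labelled units in which the covariates have the law `ν ℓ` given `R = ℓ`
and both labels share the conditional laws of the treatment, the surrogates and the outcomes given
the covariates. Setting `P(R = 1) = 0` makes `ν false` the unconditional law of the covariates, so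
that it can be chosen independently of `ν true`. -/
def ofKernels : Population 𝒳 𝒮 where
  labelProb := 0
  law ℓ := ⟨unitLaw τ σ κ (ν ℓ : Measure 𝒳), inferInstance⟩

theorem P_ofKernels : (ofKernels ν τ σ κ).P = (ofKernels ν τ σ κ).given false := by
  rw [P, mix_eq]
  simp [weight, ofKernels]

theorem lintegral_given_ofKernels (ℓ : Bool) {G : Full 𝒳 𝒮 → ℝ≥0∞} (hG : Measurable G) :
    ∫⁻ w, G w ∂(ofKernels ν τ σ κ).given ℓ =
      ∫⁻ x, ∫⁻ t, ∫⁻ z, G (assemble (x, t, z), ℓ) ∂(armKernel σ κ (x, true)).prod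
        (armKernel σ κ (x, false)) ∂τ x ∂(ν ℓ : Measure 𝒳) := by
  have hgiven : (ofKernels ν τ σ κ).given ℓ =
      (unitLaw τ σ κ (ν ℓ : Measure 𝒳)).map fun u => (u, ℓ) := by
    rw [given, Measure.prod_dirac]
    rfl
  rw [hgiven, lintegral_map hG (by fun_prop), unitLaw, lintegral_map (by fun_prop) (by fun_prop),
    Measure.lintegral_compProd (by fun_prop)]
  refine lintegral_congr fun x => ?_
  rw [Kernel.prod_apply, Kernel.prod_apply, Kernel.comap_apply, Kernel.comap_apply,
    lintegral_prod _ (by fun_prop)]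

theorem lintegral_arm_ofKernels (ℓ : Bool) (α : Bool → Bool) {H : Obs 𝒳 𝒮 → ℝ≥0∞}
    (hH : Measurable H) :
    ∫⁻ w, H (X w, T w, Spot (α (T w)) w, Ypot (α (T w)) w) ∂(ofKernels ν τ σ κ).given ℓ =
      ∫⁻ x, ∫⁻ t, ∫⁻ z, H (x, t, z) ∂armKernel σ κ (x, α t) ∂τ x ∂(ν ℓ : Measure 𝒳) := by
  have hα : Measurable α := Measurable.of_discrete
  have hS : Measurable fun w : Full 𝒳 𝒮 => Spot (α (T w)) w :=
    measurable_eval_bool (f := fun w : Full 𝒳 𝒮 => w.1.2.2.1) (by fun_prop) (by fun_prop)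
  have hY : Measurable fun w : Full 𝒳 𝒮 => Ypot (α (T w)) w :=
    measurable_eval_bool (f := fun w : Full 𝒳 𝒮 => w.1.2.2.2) (by fun_prop) (by fun_prop)
  rw [lintegral_given_ofKernels ν τ σ κ ℓ (by fun_prop)]
  exact lintegral_congr fun x => lintegral_congr fun t => lintegral_selectArm (α t)
    (fun a => armKernel σ κ (x, a)) (F := fun z => H (x, t, z)) (by fun_prop)

theorem map_X_ofKernels (ℓ : Bool) :
    ((ofKernels ν τ σ κ).given ℓ).map X = (ν ℓ : Measure 𝒳) := by
  refine Measure.ext_of_lintegral _ fun F hF => ?_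
  rw [lintegral_map hF measurable_X]
  refine (lintegral_arm_ofKernels ν τ σ κ ℓ id (H := fun o => F o.1) (by fun_prop)).trans ?_
  simp only [lintegral_const, measure_univ, mul_one]

theorem map_obs_ofKernels (ℓ : Bool) :
    ((ofKernels ν τ σ κ).given ℓ).map obs = (ν ℓ : Measure 𝒳) ⊗ₘ obsKernel τ σ κ := by
  refine Measure.ext_of_lintegral _ fun G hG => ?_
  rw [lintegral_map hG measurable_obs, Measure.lintegral_compProd hG]
  refine (lintegral_arm_ofKernels ν τ σ κ ℓ id hG).trans (lintegral_congr fun x => ?_)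
  exact (Kernel.lintegral_compProd τ (armKernel σ κ) x (f := fun z => G (x, z)) (by fun_prop)).symm

theorem hasCondLaw_treatment_ofKernels (ℓ : Bool) :
    HasCondLaw ((ofKernels ν τ σ κ).given ℓ) X T τ := by
  intro F hF
  refine (lintegral_arm_ofKernels ν τ σ κ ℓ id (H := fun o => F (o.1, o.2.1))
    (by fun_prop)).trans (Eq.trans ?_ (lintegral_arm_ofKernels ν τ σ κ ℓ id
      (H := fun o => ∫⁻ t, F (o.1, t) ∂τ o.1)
      (hF.lintegral_kernel_prod_right'.comp measurable_fst)).symm)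
  simp only [lintegral_const, measure_univ, mul_one]

theorem hasCondLaw_unconfounded_ofKernels (ℓ a : Bool) :
    HasCondLaw ((ofKernels ν τ σ κ).given ℓ) (fun w => (X w, (Ypot a w, Spot a w))) T
      (τ.prodMkRight (ℝ × 𝒮)) := by
  intro F hF
  have hinner : Measurable fun c : 𝒳 × ℝ × 𝒮 => ∫⁻ t, F (c, t) ∂τ.prodMkRight (ℝ × 𝒮) c :=
    hF.lintegral_kernel_prod_right'
  refine (lintegral_arm_ofKernels ν τ σ κ ℓ (fun _ => a)
    (H := fun o => F ((o.1, (o.2.2.2, o.2.2.1)), o.2.1)) (by fun_prop)).trans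
      (Eq.trans (lintegral_congr fun x => ?_) (lintegral_arm_ofKernels ν τ σ κ ℓ (fun _ => a)
        (H := fun o => ∫⁻ t, F ((o.1, (o.2.2.2, o.2.2.1)), t) ∂τ o.1)
        (hinner.comp (f := fun o : Obs 𝒳 𝒮 => (o.1, (o.2.2.2, o.2.2.1))) (by fun_prop))).symm)
  simp only [lintegral_const, measure_univ, mul_one]
  exact lintegral_lintegral_swap (by unfold Function.uncurry; fun_prop)

theorem hasCondLaw_surrogate_ofKernels (ℓ a : Bool) :
    HasCondLaw ((ofKernels ν τ σ κ).given ℓ) (fun w => (T w, X w)) (Spot a)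
      (σ.comap (fun z : Bool × 𝒳 => (z.2, a)) (by fun_prop)) := by
  intro F hF
  have hinner : Measurable fun c : Bool × 𝒳 => ∫⁻ s, F (c, s) ∂σ (c.2, a) :=
    hF.lintegral_kernel_prod_right' (κ := σ.comap (fun z : Bool × 𝒳 => (z.2, a)) (by fun_prop))
  refine (lintegral_arm_ofKernels ν τ σ κ ℓ (fun _ => a)
    (H := fun o => F ((o.2.1, o.1), o.2.2.1)) (by fun_prop)).trans
      (Eq.trans (lintegral_congr fun x => lintegral_congr fun t => ?_)
        (lintegral_arm_ofKernels ν τ σ κ ℓ (fun _ => a)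
          (H := fun o => ∫⁻ s, F ((o.2.1, o.1), s) ∂σ (o.1, a))
          (hinner.comp (f := fun o : Obs 𝒳 𝒮 => (o.2.1, o.1)) (by fun_prop))).symm)
  rw [lintegral_armKernel _ (by fun_prop)]
  simp only [lintegral_const, measure_univ, mul_one]

theorem hasCondLaw_outcome_ofKernels (ℓ a : Bool) :
    HasCondLaw (((ofKernels ν τ σ κ).given ℓ).restrict {w | T w = a})
      (fun w => (X w, Spot a w)) (Ypot a)
      (κ.comap (fun z : 𝒳 × 𝒮 => (z.1, a, z.2)) (by fun_prop)) := by
  intro F hF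
  have hinner : Measurable fun c : 𝒳 × 𝒮 => ∫⁻ y, F (c, y) ∂κ (c.1, a, c.2) :=
    hF.lintegral_kernel_prod_right'
      (κ := κ.comap (fun z : 𝒳 × 𝒮 => (z.1, a, z.2)) (by fun_prop))
  have htreated (G : Full 𝒳 𝒮 → ℝ≥0∞) : ∫⁻ w in {w | T w = a}, G w ∂(ofKernels ν τ σ κ).given ℓ =
      ∫⁻ w, (if T w = a then 1 else 0) * G w ∂(ofKernels ν τ σ κ).given ℓ :=
    setLIntegral_treatment_eq _ a G
  rw [htreated, htreated]
  refine (lintegral_arm_ofKernels ν τ σ κ ℓ (fun _ => a)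
    (H := fun o => (if o.2.1 = a then 1 else 0) * F ((o.1, o.2.2.1), o.2.2.2))
    ((measurable_ite_bool a (by fun_prop)).mul (by fun_prop))).trans
      (Eq.trans (lintegral_congr fun x => lintegral_congr fun t => ?_)
        (lintegral_arm_ofKernels ν τ σ κ ℓ (fun _ => a)
          (H := fun o => (if o.2.1 = a then 1 else 0) *
            ∫⁻ y, F ((o.1, o.2.2.1), y) ∂κ (o.1, a, o.2.2.1))
          ((measurable_ite_bool a (by fun_prop)).mul
            (hinner.comp (f := fun o : Obs 𝒳 𝒮 => (o.1, o.2.2.1)) (by fun_prop)))).symm)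
  have hinner' : Measurable fun z : 𝒮 × ℝ => ∫⁻ y, F ((x, z.1), y) ∂κ (x, a, z.1) :=
    hinner.comp (f := fun z : 𝒮 × ℝ => (x, z.1)) (by fun_prop)
  refine (lintegral_const_mul (if t = a then 1 else 0) (f := fun z : 𝒮 × ℝ => F ((x, z.1), z.2))
    (by fun_prop)).trans (Eq.trans (congrArg _ ?_) (lintegral_const_mul _ hinner').symm)
  rw [lintegral_armKernel _ (F := fun z => F ((x, z.1), z.2)) (by fun_prop),
    lintegral_armKernel _ hinner']
  simp only [lintegral_const, measure_univ, mul_one]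

end Population

end OfKernels

section Tilting

variable {𝒳 𝒮 : Type*} [MeasurableSpace 𝒳] [MeasurableSpace 𝒮]

namespace Population

section OutcomeBounds

variable [StandardBorelSpace 𝒳] [StandardBorelSpace 𝒮] {ε : ℝ} {C : ℝ≥0} {p : Population 𝒳 𝒮}

theorem ofReal_mul_lintegral_outcome_sq_le {a : Bool} (hε : ε < 1 / 2)
    (hu : CondIndepFun (MeasurableSpace.comap X inferInstance) measurable_X.comap_le
      (fun w => (Ypot a w, Spot a w)) T p.P)
    (ho : ∀ᵐ x ∂p.lawX, ε ≤ p.propensity x ∧ p.propensity x ≤ 1 - ε) :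
    ENNReal.ofReal ε * ∫⁻ w, ENNReal.ofReal (Ypot a w ^ 2) ∂p.P ≤
      ∫⁻ w, ENNReal.ofReal (Y w ^ 2) ∂p.P :=
  calc ENNReal.ofReal ε * ∫⁻ w, ENNReal.ofReal (Ypot a w ^ 2) ∂p.P
      = ∫⁻ w, ENNReal.ofReal ε * ENNReal.ofReal (Ypot a w ^ 2) ∂p.P :=
        (lintegral_const_mul' _ _ ENNReal.ofReal_ne_top).symm
    _ ≤ ∫⁻ w, ENNReal.ofReal (p.clippedPropensity ε a (X w)) *
          ENNReal.ofReal (Ypot a w ^ 2) ∂p.P :=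
        lintegral_mono fun w => mul_le_mul_left
          (ENNReal.ofReal_le_ofReal (p.le_clippedPropensity hε a (X w))) _
    _ = ∫⁻ w in T ⁻¹' {a}, ENNReal.ofReal (Ypot a w ^ 2) ∂p.P :=
        (setLIntegral_treatment_eq_clippedPropensity hu ho
          (F := fun z => ENNReal.ofReal (z.2 ^ 2)) (by fun_prop)).symm
    _ = ∫⁻ w in T ⁻¹' {a}, ENNReal.ofReal (Y w ^ 2) ∂p.P :=
        setLIntegral_congr_fun (measurable_T (measurableSet_singleton a))
          fun w (hw : T w = a) => by simp only [Y, hw]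
    _ ≤ ∫⁻ w, ENNReal.ofReal (Y w ^ 2) ∂p.P := setLIntegral_le_lintegral _ _

theorem outcome_sq_bound_ne_top (hp : Assumptions ε C p) (hε0 : 0 < ε) {c : ℝ≥0∞} (hc : c ≠ ∞) :
    (ENNReal.ofReal ε)⁻¹ * (c * ∫⁻ w, ENNReal.ofReal (Y w ^ 2) ∂p.P) ≠ ∞ :=
  ENNReal.mul_ne_top (ENNReal.inv_ne_top.2 (ENNReal.ofReal_pos.2 hε0).ne')
    (ENNReal.mul_ne_top hc (lintegral_Y_sq_ne_top hp))

end OutcomeBounds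

/-- The conditional law of `T` given `X` and `R = 1`. -/
def treatmentKernel (p : Population 𝒳 𝒮) : Kernel 𝒳 Bool := condDistrib T X (p.given true)

instance (p : Population 𝒳 𝒮) : IsMarkovKernel p.treatmentKernel := by
  unfold treatmentKernel
  infer_instance

variable [StandardBorelSpace 𝒮] [Nonempty 𝒮]

/-- The conditional law of `S` given `(X, T)` and `R = 1`. -/
def surrogateKernel (p : Population 𝒳 𝒮) : Kernel (𝒳 × Bool) 𝒮 :=
  condDistrib S (fun w => (X w, T w)) (p.given true)

instance (p : Population 𝒳 𝒮) : IsMarkovKernel p.surrogateKernel := by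
  unfold surrogateKernel
  infer_instance

theorem hasCondLaw_obs (p : Population 𝒳 𝒮) :
    HasCondLaw (p.given true) X (fun w => (T w, S w, Y w))
      (obsKernel p.treatmentKernel p.surrogateKernel p.outcomeKernel) := by
  have houtcome : HasCondLaw (p.given true) (fun w => ((X w, T w), S w)) Y
      (p.outcomeKernel.comap (fun z : (𝒳 × Bool) × 𝒮 => (z.1.1, z.1.2, z.2)) (by fun_prop)) :=
    fun F hF => hasCondLaw_condDistrib measurable_XTS measurable_Y
      (fun z => F (((z.1.1, z.1.2.1), z.1.2.2), z.2)) (by fun_prop)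
  have hsurrogate : HasCondLaw (p.given true) (fun w => (X w, T w)) S p.surrogateKernel :=
    hasCondLaw_condDistrib (measurable_X.prodMk measurable_T) measurable_S
  have htreatment : HasCondLaw (p.given true) X T p.treatmentKernel :=
    hasCondLaw_condDistrib measurable_X measurable_T
  exact htreatment.compProd (hsurrogate.compProd houtcome)

theorem Q_eq_compProd (p : Population 𝒳 𝒮) : p.Q =
    p.lawXLabelled ⊗ₘ obsKernel p.treatmentKernel p.surrogateKernel p.outcomeKernel :=
  (hasCondLaw_iff_map_eq measurable_X
    (measurable_T.prodMk (measurable_S.prodMk measurable_Y))).1 p.hasCondLaw_obs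

theorem map_obs_P_eq_compProd [StandardBorelSpace 𝒳] {ε : ℝ} {C : ℝ≥0} {p : Population 𝒳 𝒮}
    (hp : Assumptions ε C p) : p.P.map obs =
      p.lawX ⊗ₘ obsKernel p.treatmentKernel p.surrogateKernel p.outcomeKernel := by
  have hQ : HasCondLaw p.Q Prod.fst Prod.snd
      (obsKernel p.treatmentKernel p.surrogateKernel p.outcomeKernel) :=
    .of_comp measurable_obs measurable_fst measurable_snd p.hasCondLaw_obs
  have hP : HasCondLaw (p.P.map obs) Prod.fst Prod.snd
      (obsKernel p.treatmentKernel p.surrogateKernel p.outcomeKernel) := by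
    rw [map_obs_P hp]
    exact hQ.withDensity measurable_fst measurable_snd (Measure.measurable_rnDeriv _ _)
  rw [← map_obs_map_fst, ← (hasCondLaw_iff_map_eq measurable_fst measurable_snd).1 hP]
  exact Measure.map_id.symm

/-- The population in which the conditional law of the outcome is reweighted by the density `D`. -/
def tilt (p : Population 𝒳 𝒮) (D : Obs 𝒳 𝒮 → ℝ≥0∞)
    [IsMarkovKernel (tiltedKernel p.outcomeKernel D)] : Population 𝒳 𝒮 :=
  ofKernels (fun ℓ => if ℓ then ⟨p.lawXLabelled, inferInstance⟩ else ⟨p.lawX, inferInstance⟩)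
    p.treatmentKernel p.surrogateKernel (tiltedKernel p.outcomeKernel D)

section TiltLaws

variable (p : Population 𝒳 𝒮) (D : Obs 𝒳 𝒮 → ℝ≥0∞)
  [IsMarkovKernel (tiltedKernel p.outcomeKernel D)]

theorem lawX_tilt : (p.tilt D).lawX = p.lawX := by
  rw [lawX, tilt, P_ofKernels, map_X_ofKernels]
  rfl

theorem lawXLabelled_tilt : (p.tilt D).lawXLabelled = p.lawXLabelled := by
  rw [lawXLabelled, tilt, map_X_ofKernels]
  rfl

theorem densityRatio_tilt : (p.tilt D).densityRatio = p.densityRatio := by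
  funext x
  rw [densityRatio, densityRatio, lawX_tilt, lawXLabelled_tilt]

theorem map_obs_P_tilt_eq_compProd : (p.tilt D).P.map obs =
    p.lawX ⊗ₘ obsKernel p.treatmentKernel p.surrogateKernel (tiltedKernel p.outcomeKernel D) := by
  rw [tilt, P_ofKernels, map_obs_ofKernels]
  rfl

theorem unconfounded_tilt [StandardBorelSpace 𝒳] (a : Bool) :
    CondIndepFun (MeasurableSpace.comap X inferInstance) measurable_X.comap_le
      (fun w => (Ypot a w, Spot a w)) T (p.tilt D).P := by
  refine condIndepFun_of_hasCondLaw measurable_X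
    ((measurable_Ypot a).prodMk (measurable_Spot a)) measurable_T (κ := p.treatmentKernel) ?_
  rw [tilt, P_ofKernels]
  exact hasCondLaw_unconfounded_ofKernels _ _ _ _ _ _

variable {D}

theorem Q_tilt (hD : Measurable D) : (p.tilt D).Q = p.Q.withDensity D := by
  rw [Q, tilt, map_obs_ofKernels, compProd_obsKernel_tiltedKernel _ hD, Q_eq_compProd]
  rfl

theorem integrable_Y_tilt (hp : Integrable Y (p.given true)) (hD : Measurable D) {c : ℝ≥0∞}
    (hc : c ≠ ∞) (hDc : ∀ o, D o ≤ c) : Integrable Y ((p.tilt D).given true) := by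
  have hle : (p.tilt D).Q ≤ c • p.Q := by
    rw [Q_tilt p hD, ← withDensity_const]
    exact withDensity_mono (ae_of_all _ hDc)
  exact (((integrable_Y_Q hp).smul_measure hc).mono_measure hle).comp_measurable measurable_obs

end TiltLaws

variable [StandardBorelSpace 𝒳] {ε : ℝ} {C : ℝ≥0} {p : Population 𝒳 𝒮} {D : Obs 𝒳 𝒮 → ℝ≥0∞}
  [IsMarkovKernel (tiltedKernel p.outcomeKernel D)]

theorem map_obs_P_tilt (hp : Assumptions ε C p) (hD : Measurable D) :
    (p.tilt D).P.map obs = (p.P.map obs).withDensity D := by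
  rw [map_obs_P_tilt_eq_compProd, compProd_obsKernel_tiltedKernel _ hD, map_obs_P_eq_compProd hp]

theorem lawXTS_tilt (hp : Assumptions ε C p) : (p.tilt D).lawXTS = p.lawXTS := by
  rw [lawXTS_eq_map_xts, lawXTS_eq_map_xts, map_obs_P_tilt_eq_compProd, map_obs_P_eq_compProd hp]
  exact map_xts_compProd_obsKernel_congr _

theorem overlap_tilt (hp : Assumptions ε C p) :
    ∀ᵐ x ∂(p.tilt D).lawX, ε ≤ (p.tilt D).propensity x ∧ (p.tilt D).propensity x ≤ 1 - ε := by
  rw [lawX_tilt, propensity_eq_of_lawXTS_eq (lawXTS_tilt hp)]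
  exact hp.overlap

theorem lintegral_Y_sq_tilt_le (hp : Assumptions ε C p) (hD : Measurable D) {c : ℝ≥0∞}
    (hDc : ∀ o, D o ≤ c) :
    ∫⁻ w, ENNReal.ofReal (Y w ^ 2) ∂(p.tilt D).P ≤ c * ∫⁻ w, ENNReal.ofReal (Y w ^ 2) ∂p.P := by
  have hobs (q : Population 𝒳 𝒮) : ∫⁻ w, ENNReal.ofReal (Y w ^ 2) ∂q.P =
      ∫⁻ o, ENNReal.ofReal (o.2.2.2 ^ 2) ∂(q.P.map obs) :=
    (lintegral_map (f := fun o : Obs 𝒳 𝒮 => ENNReal.ofReal (o.2.2.2 ^ 2)) (by fun_prop)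
      measurable_obs).symm
  have hle : (p.tilt D).P.map obs ≤ c • p.P.map obs := by
    rw [map_obs_P_tilt hp hD, ← withDensity_const]
    exact withDensity_mono (ae_of_all _ hDc)
  rw [hobs, hobs, ← smul_eq_mul, ← lintegral_smul_measure]
  exact lintegral_mono' hle le_rfl

theorem lintegral_outcome_sq_tilt_le (hp : Assumptions ε C p) (hε0 : 0 < ε) (hε : ε < 1 / 2)
    (hD : Measurable D) {c : ℝ≥0∞} (hDc : ∀ o, D o ≤ c) (a : Bool) :
    ∫⁻ w, ENNReal.ofReal (Ypot a w ^ 2) ∂(p.tilt D).P ≤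
      (ENNReal.ofReal ε)⁻¹ * (c * ∫⁻ w, ENNReal.ofReal (Y w ^ 2) ∂p.P) := by
  rw [mul_comm, ← div_eq_mul_inv, ENNReal.le_div_iff_mul_le
    (Or.inl (ENNReal.ofReal_pos.2 hε0).ne') (Or.inl ENNReal.ofReal_ne_top), mul_comm]
  exact (ofReal_mul_lintegral_outcome_sq_le hε (p.unconfounded_tilt D a) (overlap_tilt hp)).trans
    (lintegral_Y_sq_tilt_le hp hD hDc)

theorem assumptions_tilt (hp : Assumptions ε C p) (hε0 : 0 < ε) (hε : ε < 1 / 2)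
    (hD : Measurable D) {c : ℝ≥0∞} (hc : c ≠ ∞) (hDc : ∀ o, D o ≤ c) :
    Assumptions ε C (p.tilt D) where
  unconfounded := p.unconfounded_tilt D
  missing_at_random a := by
    obtain ⟨ρ, h0, h1⟩ := exists_between (zero_lt_one' unitInterval)
    exact ⟨ρ, h0, h1, ((p.tilt D).condIndepFun_label_cond_iff h0 h1
      (measurable_X.prodMk (measurable_Spot a)) (measurable_Ypot a) _).2
        ⟨_, inferInstance, fun ℓ => hasCondLaw_outcome_ofKernels _ _ _ _ ℓ a⟩⟩
  label_surrogate a := by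
    obtain ⟨ρ, h0, h1⟩ := exists_between (zero_lt_one' unitInterval)
    exact ⟨ρ, h0, h1, ((p.tilt D).condIndepFun_label_mix_iff h0 h1
      (measurable_T.prodMk measurable_X) (measurable_Spot a)).2
        ⟨_, inferInstance, fun ℓ => hasCondLaw_surrogate_ofKernels _ _ _ _ ℓ a⟩⟩
  label_treatment := by
    obtain ⟨ρ, h0, h1⟩ := exists_between (zero_lt_one' unitInterval)
    exact ⟨ρ, h0, h1, ((p.tilt D).condIndepFun_label_mix_iff h0 h1 measurable_X measurable_T).2
      ⟨_, inferInstance, fun ℓ => hasCondLaw_treatment_ofKernels _ _ _ _ ℓ⟩⟩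
  overlap := overlap_tilt hp
  absolutelyContinuous := by
    rw [lawX_tilt, lawXLabelled_tilt]
    exact hp.absolutelyContinuous
  densityRatio_le := by
    rw [lawX_tilt, densityRatio_tilt]
    exact hp.densityRatio_le
  outcome_memLp a := (memLp_two_iff_lintegral_sq (measurable_Ypot a).aestronglyMeasurable).2
    (ne_top_of_le_ne_top (outcome_sq_bound_ne_top hp hε0 hc)
      (lintegral_outcome_sq_tilt_le hp hε0 hε hD hDc a))
  outcome_integrable := p.integrable_Y_tilt hp.outcome_integrable hD hc hDc

theorem tilt_mem_model (hp : Assumptions ε C p) (hε0 : 0 < ε) (hε : ε < 1 / 2)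
    (hD : Measurable D) {c : ℝ≥0∞} (hc : c ≠ ∞) (hDc : ∀ o, D o ≤ c) : p.tilt D ∈ model ε C p :=
  ⟨assumptions_tilt hp hε0 hε hD hc hDc, lawXTS_tilt hp⟩

theorem integral_outcome_sq_tilt_le (hp : Assumptions ε C p) (hε0 : 0 < ε) (hε : ε < 1 / 2)
    (hD : Measurable D) {c : ℝ≥0∞} (hc : c ≠ ∞) (hDc : ∀ o, D o ≤ c) (a : Bool) :
    ∫ w, Ypot a w ^ 2 ∂(p.tilt D).P ≤
      ((ENNReal.ofReal ε)⁻¹ * (c * ∫⁻ w, ENNReal.ofReal (Y w ^ 2) ∂p.P)).toReal := by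
  rw [← ENNReal.ofReal_le_iff_le_toReal (outcome_sq_bound_ne_top hp hε0 hc),
    ← lintegral_outcome_sq (assumptions_tilt hp hε0 hε hD hc hDc)]
  exact lintegral_outcome_sq_tilt_le hp hε0 hε hD hDc a

end Population

end Tilting

section LinearTilt

theorem abs_sqrt_one_add_sub_le {u : ℝ} (hu : |u| ≤ 1) : |√(1 + u) - 1 - u / 2| ≤ u ^ 2 / 2 := by
  obtain ⟨r, hr, rfl⟩ : ∃ r : ℝ, 0 ≤ r ∧ u = r ^ 2 - 1 :=
    ⟨√(1 + u), Real.sqrt_nonneg _, by rw [Real.sq_sqrt (by linarith [(abs_le.1 hu).1])]; ring⟩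
  have hsqrt : √(1 + (r ^ 2 - 1)) = r := by rw [add_sub_cancel, Real.sqrt_sq hr]
  have herror : r - 1 - (r ^ 2 - 1) / 2 = -((r - 1) ^ 2 / 2) := by ring
  have hfactor : 1 ≤ (r + 1) ^ 2 := one_le_pow₀ (by linarith)
  rw [hsqrt, herror, abs_neg, abs_of_nonneg (by positivity)]
  calc (r - 1) ^ 2 / 2 ≤ (r - 1) ^ 2 * (r + 1) ^ 2 / 2 := by
        gcongr
        exact le_mul_of_one_le_right (sq_nonneg _) hfactor
    _ = (r ^ 2 - 1) ^ 2 / 2 := by ring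

theorem abs_mul_le_of_abs_le {a v M c : ℝ} (hv : |v| ≤ M) (ha : |a| * M ≤ c) : |a * v| ≤ c := by
  rw [abs_mul]
  exact (mul_le_mul_of_nonneg_left hv (abs_nonneg a)).trans ha

theorem abs_sqrt_slope_sub_le {θ v M : ℝ} (hθ : θ ≠ 0) (hv : |v| ≤ M) (hθM : |θ| * M ≤ 1) :
    |(√(1 + θ * v) - 1) / θ - v / 2| ≤ |θ| * M ^ 2 / 2 := by
  have hslope : (√(1 + θ * v) - 1) / θ - v / 2 = (√(1 + θ * v) - 1 - θ * v / 2) / θ := by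
    field_simp
  rw [hslope, abs_div, div_le_iff₀ (abs_pos.2 hθ)]
  calc |√(1 + θ * v) - 1 - θ * v / 2| ≤ (θ * v) ^ 2 / 2 :=
        abs_sqrt_one_add_sub_le (abs_mul_le_of_abs_le hv hθM)
    _ = |θ| ^ 2 * |v| ^ 2 / 2 := by rw [sq_abs, sq_abs, mul_pow]
    _ ≤ |θ| ^ 2 * M ^ 2 / 2 := by gcongr
    _ = |θ| * M ^ 2 / 2 * |θ| := by ring

theorem eventually_abs_mul_le_one (M : ℝ) : ∀ᶠ θ : ℝ in 𝓝 0, |θ| * M ≤ 1 := by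
  have hlim : Tendsto (fun θ : ℝ => |θ| * M) (𝓝 0) (𝓝 (|0| * M)) :=
    Continuous.tendsto (by fun_prop) 0
  rw [abs_zero, zero_mul] at hlim
  exact hlim.eventually_le_const zero_lt_one

/-- The parameter `θ`, set to zero where `1 + θ f` could be negative for a function `f` bounded by
`M`. -/
def truncParam (M θ : ℝ) : ℝ := if |θ| * M ≤ 1 then θ else 0

theorem truncParam_eq_self {M θ : ℝ} (h : |θ| * M ≤ 1) : truncParam M θ = θ := if_pos h

theorem abs_truncParam_mul_le (M θ : ℝ) : |truncParam M θ| * M ≤ 1 := by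
  by_cases h : |θ| * M ≤ 1
  · rwa [truncParam_eq_self h]
  · rw [truncParam, if_neg h, abs_zero, zero_mul]
    exact zero_le_one

variable {Ω : Type*} {f : Ω → ℝ} {M : ℝ}

/-- The density of the linear perturbation with score `f` and parameter `θ`, which is constantly one
for large `θ`. -/
def linearTilt (f : Ω → ℝ) (M θ : ℝ) (o : Ω) : ℝ≥0∞ := ENNReal.ofReal (1 + truncParam M θ * f o)

theorem linearTilt_le_two (hM : ∀ o, |f o| ≤ M) (θ : ℝ) (o : Ω) : linearTilt f M θ o ≤ 2 := by
  rw [linearTilt, ← ENNReal.ofReal_ofNat 2]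
  refine ENNReal.ofReal_le_ofReal ?_
  linarith [(abs_le.1 (abs_mul_le_of_abs_le (hM o) (abs_truncParam_mul_le M θ))).2]

variable [MeasurableSpace Ω]

@[fun_prop]
theorem measurable_linearTilt (hf : Measurable f) (M θ : ℝ) : Measurable (linearTilt f M θ) := by
  unfold linearTilt
  fun_prop

theorem lintegral_linearTilt {m : Measure Ω} [IsProbabilityMeasure m] (hf : Measurable f)
    (hM : ∀ o, |f o| ≤ M) (hmean : ∫ o, f o ∂m = 0) (θ : ℝ) :
    ∫⁻ o, linearTilt f M θ o ∂m = 1 := by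
  have hint : Integrable (fun o => truncParam M θ * f o) m :=
    (Integrable.of_bound hf.aestronglyMeasurable M (ae_of_all _ hM)).const_mul _
  have hnonneg (o : Ω) : 0 ≤ 1 + truncParam M θ * f o := by
    linarith [(abs_le.1 (abs_mul_le_of_abs_le (hM o) (abs_truncParam_mul_le M θ))).1]
  calc ∫⁻ o, linearTilt f M θ o ∂m = ENNReal.ofReal (∫ o, (1 + truncParam M θ * f o) ∂m) :=
        (ofReal_integral_eq_lintegral_ofReal ((integrable_const 1).add hint)
          (ae_of_all _ hnonneg)).symm
    _ = 1 := by
        rw [integral_add (integrable_const 1) hint, integral_const_mul, hmean, mul_zero, add_zero,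
          integral_const, probReal_univ, one_smul, ENNReal.ofReal_one]

theorem hasScore_of_withDensity {Q : Measure Ω} [IsFiniteMeasure Q] {Qθ : ℝ → Measure Ω}
    {g : Ω → ℝ} (hf : Measurable f) (hM : ∀ o, |f o| ≤ M) (hgf : g =ᵐ[Q] f)
    (hac : ∀ θ, Qθ θ ≪ Q)
    (hQθ : ∀ θ, |θ| * M ≤ 1 → Qθ θ = Q.withDensity fun o => ENNReal.ofReal (1 + θ * f o)) :
    HasScore Qθ g := by
  have hdensity {θ : ℝ} (hθ : |θ| * M ≤ 1) :
      (fun o => √((Qθ θ).rnDeriv Q o).toReal) =ᵐ[Q] fun o => √(1 + θ * f o) := by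
    rw [hQθ θ hθ]
    filter_upwards [Measure.rnDeriv_withDensity Q
      (f := fun o => ENNReal.ofReal (1 + θ * f o)) (by fun_prop)] with o ho
    rw [ho, ENNReal.toReal_ofReal]
    linarith [(abs_le.1 (abs_mul_le_of_abs_le (hM o) hθ)).1]
  have hbound : Tendsto (fun θ : ℝ => ENNReal.ofReal ((|θ| * M ^ 2 / 2) ^ 2) * Q Set.univ)
      (𝓝[≠] 0) (𝓝 0) := by
    have hlim : Tendsto (fun θ : ℝ => ENNReal.ofReal ((|θ| * M ^ 2 / 2) ^ 2) * Q Set.univ) (𝓝 0)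
        (𝓝 (ENNReal.ofReal ((|0| * M ^ 2 / 2) ^ 2) * Q Set.univ)) :=
      ENNReal.Tendsto.mul_const (ENNReal.tendsto_ofReal (Continuous.tendsto (by fun_prop) 0))
        (Or.inr (measure_ne_top Q _))
    rw [abs_zero, zero_mul, zero_div, zero_pow two_ne_zero, ENNReal.ofReal_zero, zero_mul] at hlim
    exact hlim.mono_left nhdsWithin_le_nhds
  refine ⟨Q, inferInstance, hac, tendsto_of_tendsto_of_tendsto_of_le_of_le' tendsto_const_nhds
    hbound (Eventually.of_forall fun _ => zero_le) ?_⟩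
  filter_upwards [nhdsWithin_le_nhds (eventually_abs_mul_le_one M), self_mem_nhdsWithin]
    with θ hθ hθ0
  rw [← lintegral_const]
  refine lintegral_mono_ae ?_
  filter_upwards [hdensity hθ, hdensity (eventually_abs_mul_le_one M).self_of_nhds, hgf]
    with o hdens hdens0 hscore
  rw [hdens, hdens0, hscore, zero_mul, add_zero, Real.sqrt_one, mul_one]
  exact ENNReal.ofReal_le_ofReal
    (sq_le_sq.2 ((abs_sqrt_slope_sub_le hθ0 (hM o) hθ).trans (le_abs_self _)))

end LinearTilt

section EfficiencyBound

theorem ofReal_inner_sq_div_le {E : Type*} [NormedAddCommGroup E] [InnerProductSpace ℝ E]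
    (x y : E) : ENNReal.ofReal (inner ℝ x y ^ 2) / ENNReal.ofReal (‖y‖ ^ 2) ≤
      ENNReal.ofReal (‖x‖ ^ 2) := by
  refine ENNReal.div_le_of_le_mul ?_
  rw [← ENNReal.ofReal_mul (sq_nonneg _), ← mul_pow, ← sq_abs (inner ℝ x y)]
  exact ENNReal.ofReal_le_ofReal (pow_le_pow_left₀ (abs_nonneg _) (abs_real_inner_le_norm x y) 2)

theorem tendsto_ofReal_inner_sq_div {E : Type*} [NormedAddCommGroup E] [InnerProductSpace ℝ E]
    {x : E} (hx : x ≠ 0) :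
    Tendsto (fun y => ENNReal.ofReal (inner ℝ x y ^ 2) / ENNReal.ofReal (‖y‖ ^ 2)) (𝓝 x)
      (𝓝 (ENNReal.ofReal (‖x‖ ^ 2))) := by
  have hpos : 0 < ‖x‖ ^ 2 := pow_pos (norm_pos_iff.2 hx) 2
  have hval : ENNReal.ofReal (inner ℝ x x ^ 2) / ENNReal.ofReal (‖x‖ ^ 2) =
      ENNReal.ofReal (‖x‖ ^ 2) := by
    rw [← ENNReal.ofReal_div_of_pos hpos, real_inner_self_eq_norm_sq, sq (‖x‖ ^ 2),
      mul_div_cancel_right₀ _ hpos.ne']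
  rw [← hval]
  exact ENNReal.Tendsto.div
    (ENNReal.tendsto_ofReal (Continuous.tendsto (by fun_prop) x))
    (Or.inr (ENNReal.ofReal_pos.2 hpos).ne')
    (ENNReal.tendsto_ofReal (Continuous.tendsto (by fun_prop) x)) (Or.inl ENNReal.ofReal_ne_top)

theorem inner_toLp_eq_integral {Ω : Type*} [MeasurableSpace Ω] {μ : Measure Ω} {φ : Ω → ℝ}
    (hφ : MemLp φ 2 μ) (g : Lp ℝ 2 μ) : inner ℝ (hφ.toLp φ) g = ∫ o, φ o * g o ∂μ := by
  rw [L2.inner_def]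
  refine integral_congr_ae ?_
  filter_upwards [hφ.coeFn_toLp] with o ho
  rw [ho, real_inner_eq_re_inner, RCLike.inner_apply, conj_trivial, mul_comm, RCLike.re_to_real]

theorem norm_sq_eq_integral_of_ae_eq {Ω : Type*} [MeasurableSpace Ω] {μ : Measure Ω} {φ : Ω → ℝ}
    {g : Lp ℝ 2 μ} (h : g =ᵐ[μ] φ) : ‖g‖ ^ 2 = ∫ o, φ o ^ 2 ∂μ := by
  have hφ : MemLp φ 2 μ := (memLp_congr_ae h).1 (Lp.memLp g)
  obtain rfl : g = hφ.toLp φ := Lp.ext (h.trans hφ.coeFn_toLp.symm)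
  rw [← real_inner_self_eq_norm_sq, inner_toLp_eq_integral hφ]
  refine integral_congr_ae ?_
  filter_upwards [hφ.coeFn_toLp] with o ho
  rw [ho, sq]

/-- The scores of the smooth submodels of `M` through `p`. -/
def scores {𝒳 𝒮 : Type*} [MeasurableSpace 𝒳] [MeasurableSpace 𝒮] (M : Set (Population 𝒳 𝒮))
    (p : Population 𝒳 𝒮) : Set (Lp ℝ 2 p.Q) :=
  {g | ∃ γ, IsSmoothSubmodel M p γ g}

theorem efficiencyBound_eq_of_mem_closure_scores {𝒳 𝒮 : Type*} [MeasurableSpace 𝒳]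
    [MeasurableSpace 𝒮] {M : Set (Population 𝒳 𝒮)} {p : Population 𝒳 𝒮} {φ : Obs 𝒳 𝒮 → ℝ}
    (hφ : MemLp φ 2 p.Q) (hscores : hφ.toLp φ ∈ closure (scores M p))
    (hderiv : ∀ γ (g : Lp ℝ 2 p.Q), IsSmoothSubmodel M p γ g →
      HasDerivAt (fun θ => (γ θ).ate) (∫ o, φ o * g o ∂p.Q) 0) :
    efficiencyBound M p = ENNReal.ofReal (∫ o, φ o ^ 2 ∂p.Q) := by
  have hnorm (g : Lp ℝ 2 p.Q) : ∫ o, g o ^ 2 ∂p.Q = ‖g‖ ^ 2 :=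
    (norm_sq_eq_integral_of_ae_eq EventuallyEq.rfl).symm
  rw [← norm_sq_eq_integral_of_ae_eq hφ.coeFn_toLp]
  refine le_antisymm ?_ ?_
  · refine iSup₂_le fun γ g => iSup₂_le fun hγ d => iSup_le fun hd => ?_
    rw [hd.unique (hderiv γ g hγ), hnorm, ← inner_toLp_eq_integral hφ]
    exact ofReal_inner_sq_div_le _ _
  · by_cases h0 : hφ.toLp φ = 0
    · rw [h0, norm_zero, zero_pow two_ne_zero, ENNReal.ofReal_zero]
      exact zero_le
    have := mem_closure_iff_nhdsWithin_neBot.1 hscores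
    refine le_of_tendsto (x := 𝓝[scores M p] hφ.toLp φ)
      ((tendsto_ofReal_inner_sq_div h0).mono_left nhdsWithin_le_nhds)
      (eventually_mem_nhdsWithin.mono fun g hg => ?_)
    obtain ⟨γ, hγ⟩ := hg
    rw [inner_toLp_eq_integral hφ, ← hnorm]
    exact le_iSup₂_of_le γ g (le_iSup₂_of_le hγ _ (le_iSup_of_le (hderiv γ g hγ) le_rfl))

end EfficiencyBound

namespace Population

variable {𝒳 𝒮 : Type*} [MeasurableSpace 𝒳] [MeasurableSpace 𝒮]

theorem isMarkovKernel_tiltedKernel_linearTilt (p : Population 𝒳 𝒮)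
    {F : (𝒳 × Bool × 𝒮) × ℝ → ℝ} (hF : Measurable F) {M : ℝ} (hM : ∀ z, |F z| ≤ M)
    (hmean : ∀ c, condMean p.outcomeKernel F c = 0) (θ : ℝ) :
    IsMarkovKernel
      (tiltedKernel p.outcomeKernel (linearTilt (fun o => F (xts o, o.2.2.2)) M θ)) :=
  isMarkovKernel_tiltedKernel (by fun_prop) fun z =>
    lintegral_linearTilt (f := fun y => F (z, y)) (by fun_prop) (fun y => hM (z, y)) (hmean z) θ

variable [StandardBorelSpace 𝒳] [StandardBorelSpace 𝒮] {ε : ℝ} {C : ℝ≥0} {p : Population 𝒳 𝒮}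

theorem mem_scores_of_condMean_eq_zero (hp : Assumptions ε C p) (hε0 : 0 < ε) (hε : ε < 1 / 2)
    {F : (𝒳 × Bool × 𝒮) × ℝ → ℝ} (hF : Measurable F) {M : ℝ} (hM : ∀ z, |F z| ≤ M)
    (hmean : ∀ c, condMean p.outcomeKernel F c = 0) {g : Lp ℝ 2 p.Q}
    (hg : g =ᵐ[p.Q] fun o => F (xts o, o.2.2.2)) : g ∈ scores (model ε C p) p := by
  have := p.nonempty_surrogate
  set f : Obs 𝒳 𝒮 → ℝ := fun o => F (xts o, o.2.2.2)
  have hf : Measurable f := by fun_prop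
  have hfM (o : Obs 𝒳 𝒮) : |f o| ≤ M := hM _
  have hD (θ : ℝ) : Measurable (linearTilt f M θ) := measurable_linearTilt hf M θ
  have := p.isMarkovKernel_tiltedKernel_linearTilt hF hM hmean
  have hQ (θ : ℝ) : (p.tilt (linearTilt f M θ)).Q = p.Q.withDensity (linearTilt f M θ) :=
    p.Q_tilt (hD θ)
  have hQ_small (θ : ℝ) (hθ : |θ| * M ≤ 1) : (p.tilt (linearTilt f M θ)).Q =
      p.Q.withDensity fun o => ENNReal.ofReal (1 + θ * f o) := by
    rw [hQ]
    unfold linearTilt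
    rw [truncParam_eq_self hθ]
  refine ⟨fun θ => p.tilt (linearTilt f M θ), fun θ =>
    tilt_mem_model hp hε0 hε (hD θ) ENNReal.ofNat_ne_top (linearTilt_le_two hfM θ), ?_,
    hasScore_of_withDensity hf hfM hg (fun θ => hQ θ ▸ withDensity_absolutelyContinuous _ _)
      hQ_small,
    _, fun θ => integral_outcome_sq_tilt_le hp hε0 hε (hD θ) ENNReal.ofNat_ne_top
      (linearTilt_le_two hfM θ)⟩
  rw [hQ_small 0 (eventually_abs_mul_le_one M).self_of_nhds]
  simp only [zero_mul, add_zero, ENNReal.ofReal_one]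
  exact withDensity_one

theorem toLp_psi_mem_closure_scores (hp : Assumptions ε C p) (hε0 : 0 < ε) (hε : ε < 1 / 2) :
    (memLp_psi hp hε0 hε).toLp p.psi ∈ closure (scores (model ε C p) p) := by
  let f (z : (𝒳 × Bool × 𝒮) × ℝ) : ℝ :=
    p.clippedRatio C z.1.1 * p.residual ε (z.1.1, z.1.2.1, z.1.2.2, z.2)
  obtain ⟨F, hF, hF_le, hmean, hlim⟩ := p.hasCondLaw_Q.exists_tendsto_of_condMean_eq_zero
    measurable_xts (by fun_prop) (f := f) (by fun_prop)
    ((memLp_congr_ae (psi_ae_eq hp)).1 (memLp_psi hp hε0 hε))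
    (condMean_mul_residual_ae_eq_zero hp.outcome_integrable ε (p.clippedRatio C))
  have hL (n : ℕ) : MemLp (fun o => F n (xts o, o.2.2.2)) 2 p.Q :=
    .of_bound (Measurable.aestronglyMeasurable (by fun_prop)) _ (ae_of_all _ fun o => hF_le n _)
  refine mem_closure_of_tendsto (f := fun n => (hL n).toLp _) (b := atTop) ?_
    (Eventually.of_forall fun n => mem_scores_of_condMean_eq_zero hp hε0 hε (hF n) (hF_le n)
      (hmean n) (hL n).coeFn_toLp)
  rw [Lp.tendsto_Lp_iff_tendsto_eLpNorm'']
  refine hlim.congr fun n => eLpNorm_congr_ae ?_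
  filter_upwards [psi_ae_eq hp] with o ho
  rw [Pi.sub_apply, ho]
  rfl

theorem isEfficientInfluenceFunction_psi (hp : Assumptions ε C p) (hε0 : 0 < ε) (hε : ε < 1 / 2) :
    IsEfficientInfluenceFunction (model ε C p) p p.psi :=
  ⟨⟨memLp_psi hp hε0 hε,
      closure_mono Submodule.subset_span (toLp_psi_mem_closure_scores hp hε0 hε)⟩,
    fun _ _ => hasDerivAt_ate hp hε0 hε⟩

end Population

end

end SurrogateATE

theorem theorem6 {𝒳 𝒮 : Type*} [MeasurableSpace 𝒳] [MeasurableSpace 𝒮]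
    [StandardBorelSpace 𝒳] [StandardBorelSpace 𝒮]
    (ε : ℝ) (hε : 0 < ε) (hε' : ε < 1 / 2) (C : ℝ≥0) (hC : 0 < C)
    (p : SurrogateATE.Population 𝒳 𝒮) (hp : SurrogateATE.Assumptions ε C p) :
    SurrogateATE.IsEfficientInfluenceFunction (SurrogateATE.model ε C p) p p.psi ∧
      SurrogateATE.efficiencyBound (SurrogateATE.model ε C p) p =
        ENNReal.ofReal (∫ o, p.psi o ^ 2 ∂p.Q) :=
  ⟨SurrogateATE.Population.isEfficientInfluenceFunction_psi hp hε hε',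
    SurrogateATE.efficiencyBound_eq_of_mem_closure_scores
      (SurrogateATE.Population.memLp_psi hp hε hε')
      (SurrogateATE.Population.toLp_psi_mem_closure_scores hp hε hε')
      fun _ _ => SurrogateATE.Population.hasDerivAt_ate hp hε hε'⟩
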